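/- Let $\mathbf D$ be the class of functions $f\in L_2(\mathbb R^3)$ whose first-order generalized partial derivatives are in $L_2(\mathbb R^3)$, with $\|f\|_{\mathbf D}^2=\int_{\mathbb R^3}\|\nabla f\|^2dv$, and let $\mathbf D^*$ be the class of generalized functions $l$ on $\mathbb R^3$ for which there is $M<\infty$ with $|l(\varphi)|\le M\|\varphi\|_{\mathbf D}$ for all $\varphi\in C_c^\infty(\mathbb R^3)$; such an $l$ is extended to $\mathbf D$ by continuity in $\|\cdot\|_{\mathbf D}$. Let $E\subset\mathbb R^3$ be a compact set with smooth boundary $\partial E$ (near each boundary point, $E=\{\rho\le 0\}$ with $\rho$ smooth and $\nabla\rho\ne0$), let $k\in\mathbb R$, and let $l\in\mathbf D^*$ have support in $E$. Let $U=U_k^l\in\mathbf D$ be a $k$-potential function of $l$, i.e. $$l(f)=\frac1{4\pi}\int_{\mathbb R^3}(\nabla f,\nabla U)\,dv-k^2\int_E fU\,dv\qquad\text{for all } f\in\mathbf D ,$$ and assume that all second-order generalized derivatives of $U$ on $\mathbb R^3\setminus\partial E$ are integrable functions. Let $\Delta U$ denote the (almost everywhere defined) function $\sum_i\partial^2U/\partial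 x_i^2$ on $\mathbb R^3\setminus\partial E$. Let $\vec n_+$ and $\vec n_-$ be the outer and inner unit normals of $E$ on $\partial E$, and for a unit vector $\vec n$ put $\frac{\partial U}{\partial\vec n}(\vec x)=\lim_{t\to+0}\frac{U(\vec x+t\vec n)-U(\vec x)}t$. Then $U$ can be modified on a set of Lebesgue measure zero so that $\frac{\partial U}{\partial\vec n_+}$ and $\frac{\partial U}{\partial\vec n_-}$ exist almost everywhere on $\partial E$ with respect to surface area $ds$. For every such representative of $U$ these one-sided normal derivatives are integrable on $\partial E$, and for every $\varphi\in C_c^\infty(\mathbb R^3)$ $$l(\varphi)=-k^2\int_E\varphi\,U\,dv-\frac1{4\pi}\int_{\partial E}\varphi\left(\frac{\partial U}{\partial\vec n_+}+\frac{\partial U}{\partial\vec n_-}\right)ds-\frac1{4\pi}\int_{\mathbb R^3}\varphi\,\Delta U\,dv .$$ -/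

import Mathlib

open MeasureTheory Filter Topology Set
open scoped Distributions

noncomputable section

namespace ChargeDistribution

/-- Euclidean three-space. -/
abbrev R3 : Type := EuclideanSpace ℝ (Fin 3)

/-- Smooth compactly supported real functions on `R3`. -/
abbrev TestFn : Type := 𝓓((⊤ : TopologicalSpace.Opens R3), ℝ)

/-- Generalized functions (real distributions) on `R3`. -/
abbrev GenFn : Type := 𝓓'((⊤ : TopologicalSpace.Opens R3), ℝ)

/-- On the open set `Ω`, the `i`-th partial derivative of the generalized function given by `f`
is the generalized function given by `g`. -/
def IsWeakPartial (Ω : TopologicalSpace.Opens R3) (i : Fin 3) (f g : R3 → ℝ) : Prop :=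
  LocallyIntegrableOn f (Ω : Set R3) volume ∧ LocallyIntegrableOn g (Ω : Set R3) volume ∧
    ∀ φ : 𝓓(Ω, ℝ),
      ∫ x, f x * fderiv ℝ φ x (EuclideanSpace.single i 1) = -∫ x, g x * φ x

/-- `G` is a square integrable gradient of `f`, in the sense of generalized functions on `R3`. -/
def HasL2Gradient (f : R3 → ℝ) (G : R3 → R3) : Prop :=
  MemLp G 2 volume ∧ ∀ i : Fin 3, IsWeakPartial ⊤ i f (fun x => G x i)

/-- The Dirichlet class: square integrable functions whose first order generalized partial
derivatives are square integrable functions. -/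
def MemDirichlet (f : R3 → ℝ) : Prop :=
  MemLp f 2 volume ∧ ∃ G : R3 → R3, HasL2Gradient f G

open Classical in
/-- The gradient of a function of the Dirichlet class (it is determined almost everywhere). -/
def grad (f : R3 → ℝ) : R3 → R3 :=
  if h : ∃ G : R3 → R3, HasL2Gradient f G then h.choose else 0

/-- The norm of the Dirichlet class, `‖f‖_D² = ∫ |∇f|²`. -/
def dirichletNorm (f : R3 → ℝ) : ℝ :=
  Real.sqrt (∫ x, ‖grad f x‖ ^ 2)

/-- The class `D*`: generalized functions that are bounded with respect to the norm of the
Dirichlet class. -/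
def MemDirichletDual (l : GenFn) : Prop :=
  ∃ M : ℝ, ∀ φ : TestFn, |l φ| ≤ M * dirichletNorm φ

/-- `l(f) = c` for `l ∈ D*` and `f ∈ D`, where `l` is extended from the test functions to the
Dirichlet class by continuity in the Dirichlet norm: `l(φ)` tends to `c` as the test function `φ`
tends to `f`. -/
def HasValue (l : GenFn) (f : R3 → ℝ) (c : ℝ) : Prop :=
  Tendsto (fun φ : TestFn => l φ)
    (comap (fun φ : TestFn => dirichletNorm (fun x => φ x - f x)) (𝓝 0)) (𝓝 c)

/-- The form `(f, g)_k = (1 / 4π) ∫ (∇f, ∇g) - k² ∫_E f g`. -/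
def dirichletForm (k : ℝ) (E : Set R3) (f g : R3 → ℝ) : ℝ :=
  1 / (4 * Real.pi) * (∫ x, inner ℝ (grad f x) (grad g x)) - k ^ 2 * ∫ x in E, f x * g x

/-- `U` is a `k`-potential function of the charge distribution `l`:
`U ∈ D`, and `l(f) = (f, U)_k` for every `f ∈ D`. -/
def IsPotential (k : ℝ) (E : Set R3) (l : GenFn) (U : R3 → ℝ) : Prop :=
  MemDirichlet U ∧ ∀ f : R3 → ℝ, MemDirichlet f → HasValue l f (dirichletForm k E f U)

/-- Near each of its boundary points, `E` is a sublevel set of a smooth function with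
nonvanishing differential. -/
def HasSmoothBoundary (E : Set R3) : Prop :=
  ∀ x ∈ frontier E, ∃ V : Set R3, IsOpen V ∧ x ∈ V ∧ ∃ ρ : R3 → ℝ,
    ContDiffOn ℝ ((⊤ : ℕ∞) : WithTop ℕ∞) ρ V ∧ (∀ y ∈ V, fderiv ℝ ρ y ≠ 0) ∧
      ∀ y ∈ V, y ∈ E ↔ ρ y ≤ 0

/-- The unit vector `n` is orthogonal to the set `S` at `x`. -/
def IsUnitOrthogonal (S : Set R3) (x n : R3) : Prop :=
  ‖n‖ = 1 ∧ Tendsto (fun y => inner ℝ (y - x) n / ‖y - x‖) (𝓝[S \ {x}] x) (𝓝 0)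

/-- `n` is the outer unit normal of `E` at the boundary point `x`. -/
def IsOuterNormal (E : Set R3) (x n : R3) : Prop :=
  IsUnitOrthogonal (frontier E) x n ∧ ∃ r : ℝ, 0 < r ∧ Metric.ball (x + r • n) r ∩ E = ∅

/-- `n` is the inner unit normal of `E` at the boundary point `x`. -/
def IsInnerNormal (E : Set R3) (x n : R3) : Prop :=
  IsUnitOrthogonal (frontier E) x n ∧ ∃ r : ℝ, 0 < r ∧ Metric.ball (x + r • n) r ⊆ E

/-- The one-sided derivative of `f` at `x` in the direction `n` exists and equals `d`. -/
def HasOneSidedDeriv (f : R3 → ℝ) (x n : R3) (d : ℝ) : Prop :=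
  Tendsto (fun t : ℝ => (f (x + t • n) - f x) / t) (𝓝[>] 0) (𝓝 d)

/-- The surface area measure on the boundary of `E` (two-dimensional Hausdorff measure,
normalized so that it is Lebesgue measure on planes). -/
def surfaceMeasure (E : Set R3) : Measure R3 :=
  (Measure.euclideanHausdorffMeasure 2 : Measure R3).restrict (frontier E)

/-- The complement of the boundary of `E`, as an open set. -/
def offBoundary (E : Set R3) : TopologicalSpace.Opens R3 :=
  ⟨(frontier E)ᶜ, isClosed_frontier.isOpen_compl⟩

end ChargeDistribution

end

open scoped ContDiff Convolution NNReal

namespace ChargeDistribution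

/-! For a test function φ the extension of l by continuity takes the value l(φ), so the defining
identity of U at f = φ reduces the claim to a Green formula for G = ∇U: the integral of G · ∇φ over
space equals minus the surface integral of φ times the sum of the two one-sided normal derivatives,
minus the integral of φ ΔU. The components of G are locally integrable and have integrable weak
derivatives only off ∂E, so G may jump across ∂E, and the surface term is that jump.

The jump is made pointwise on normal segments. Near ∂E the map (p, t) ↦ f p + t N p gives
coordinates in which E is {t ≤ 0} (`exists_boundaryChart`). A function with weak first derivatives
has a representative that is a primitive of its directional derivative along almost every segment of
such a family (`exists_absolutelyContinuous_representative`). Applied to G off ∂E, this shows that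
for almost every p the normal component G · N agrees a.e. on each side with a continuous function,
H₁ for t > 0 and H₂ for t < 0, bounded by an integrable function of p
(`ae_exists_normalComp_extensions`). Applied to U on all of space, it makes U along the same segment
a primitive of G · N through t = 0, so the one-sided derivatives in the directions N and -N exist
and equal H₁(0) and -H₂(0). A one-sided derivative is determined by the values at almost every t
(`oneSided_deriv_unique`), so every other admissible representative of U has the same ones.

For the formula, φ is multiplied by a function of t/δ that vanishes near t = 0. The product is an
admissible test function off ∂E. As δ → 0, the derivative of the cutoff concentrates at t = 0 with
mass 1 on the right and -1 on the left, which produces H₁(0) - H₂(0), the sum of the two normal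
derivatives (`HasTraces.integral_gradient_eq`). The Jacobian of the coordinates at t = 0 is the
surface density by the area formula, and a partition of unity joins the charts. -/

theorem IsWeakPartial.integral_mul_fderiv {Ω : TopologicalSpace.Opens R3} {i : Fin 3}
    {f g : R3 → ℝ} (h : IsWeakPartial Ω i f g) {φ : R3 → ℝ} (hφ : ContDiff ℝ ∞ φ)
    (hc : HasCompactSupport φ) (hs : tsupport φ ⊆ Ω) :
    ∫ x, f x * fderiv ℝ φ x (EuclideanSpace.single i 1) = -∫ x, g x * φ x :=
  h.2.2 ⟨φ, hφ, hc, hs⟩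

/-! ### Mollification and convergence in L¹ -/

/-- Scheffé's lemma. -/
theorem tendsto_integral_abs_sub_of_nonneg {α : Type*} [MeasurableSpace α] {μ : Measure α}
    {f : ℕ → α → ℝ} {g : α → ℝ} (hf : ∀ n, Integrable (f n) μ) (hg : Integrable g μ)
    (hf0 : ∀ n x, 0 ≤ f n x) (hfg : ∀ᵐ x ∂μ, Tendsto (fun n => f n x) atTop (𝓝 (g x)))
    (hint : ∀ n, ∫ x, f n x ∂μ = ∫ x, g x ∂μ) :
    Tendsto (fun n => ∫ x, |f n x - g x| ∂μ) atTop (𝓝 0) := by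
  -- Since f n ≥ 0, the positive part of g - f n is dominated by |g|. The rest of |f n - g| is the
  -- signed difference f n - g, whose integral is zero.
  have hpos : Tendsto (fun n => ∫ x, max (g x - f n x) 0 ∂μ) atTop (𝓝 (∫ _, (0 : ℝ) ∂μ)) := by
    refine tendsto_integral_of_dominated_convergence (fun x => |g x|) (fun n => ?_) hg.abs
      (fun n => ?_) ?_
    · exact (hg.sub (hf n)).pos_part.aestronglyMeasurable
    · refine Eventually.of_forall fun x => ?_
      rw [Real.norm_eq_abs, abs_of_nonneg (le_max_right _ _)]
      exact max_le (by linarith [hf0 n x, le_abs_self (g x)]) (abs_nonneg _)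
    · filter_upwards [hfg] with x hx
      have := ((tendsto_const_nhds (x := g x)).sub hx).max (tendsto_const_nhds (x := (0 : ℝ)))
      simpa using this
  have heq : ∀ n, ∫ x, |f n x - g x| ∂μ = 2 * ∫ x, max (g x - f n x) 0 ∂μ := by
    intro n
    have h1 : ∀ x, |f n x - g x| = 2 * max (g x - f n x) 0 + (f n x - g x) := by
      intro x
      rcases le_total (g x) (f n x) with h | h
      · rw [abs_of_nonneg (by linarith), max_eq_right (by linarith)]; ring
      · rw [abs_of_nonpos (by linarith), max_eq_left (by linarith)]; ring
    simp_rw [h1]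
    have hp : Integrable (fun x => 2 * max (g x - f n x) 0) μ :=
      ((hg.sub (hf n)).pos_part.const_mul 2)
    have hs : Integrable (fun x => f n x - g x) μ := (hf n).sub hg
    rw [integral_add hp hs, integral_const_mul, integral_sub (hf n) hg, hint n]
    ring
  simp_rw [heq]
  simpa using hpos.const_mul 2

/-- Bump functions shrinking to the origin. -/
noncomputable def bumpSeq (n : ℕ) : ContDiffBump (0 : R3) where
  rIn := 1 / (n + 1)
  rOut := 2 / (n + 1)
  rIn_pos := by positivity
  rIn_lt_rOut := by gcongr; norm_num

theorem tendsto_bumpSeq_rOut : Tendsto (fun n => (bumpSeq n).rOut) atTop (𝓝 0) := by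
  have := (tendsto_one_div_add_atTop_nhds_zero_nat (𝕜 := ℝ)).const_mul 2
  simpa [bumpSeq, div_eq_mul_inv] using this

/-- Convolution with a shrinking bump function. -/
noncomputable def mollify (n : ℕ) (F : R3 → ℝ) : R3 → ℝ :=
  ((bumpSeq n).normed volume ⋆[ContinuousLinearMap.lsmul ℝ ℝ, volume] F)

theorem integrable_bumpSeq (n : ℕ) : Integrable ((bumpSeq n).normed (volume : Measure R3)) :=
  (bumpSeq n).integrable_normed

theorem integrable_mollify (n : ℕ) {F : R3 → ℝ} (hF : Integrable F) :
    Integrable (mollify n F) :=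
  (integrable_bumpSeq n).integrable_convolution _ hF

theorem ae_tendsto_mollify {F : R3 → ℝ} (hF : Integrable F) :
    ∀ᵐ x, Tendsto (fun n => mollify n F x) atTop (𝓝 (F x)) :=
  -- The ratio of outer to inner radius is 2 for every n; a bounded ratio is what Lebesgue
  -- differentiation needs.
  ContDiffBump.ae_convolution_tendsto_right_of_locallyIntegrable (K := 2) tendsto_bumpSeq_rOut
    (Eventually.of_forall fun n => by simp [bumpSeq, div_eq_mul_inv]) hF.locallyIntegrable

theorem integral_mollify (n : ℕ) {F : R3 → ℝ} (hF : Integrable F) :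
    ∫ x, mollify n F x = ∫ x, F x := by
  rw [mollify, integral_convolution _ (integrable_bumpSeq n) hF]
  simp [ContDiffBump.integral_normed]

theorem mollify_nonneg (n : ℕ) {F : R3 → ℝ} (hF : ∀ x, 0 ≤ F x) (x : R3) :
    0 ≤ mollify n F x := by
  rw [mollify, convolution_def]
  refine integral_nonneg fun t => ?_
  simp only [ContinuousLinearMap.lsmul_apply, smul_eq_mul]
  exact mul_nonneg ((bumpSeq n).nonneg_normed t) (hF _)

theorem mollify_sub (n : ℕ) {F G : R3 → ℝ} (hF : Integrable F) (hG : Integrable G) (x : R3) :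
    mollify n (F - G) x = mollify n F x - mollify n G x := by
  have hx : ∀ {H : R3 → ℝ}, Integrable H → ConvolutionExistsAt ((bumpSeq n).normed volume) H x
      (ContinuousLinearMap.lsmul ℝ ℝ) volume := fun {H} hH =>
    (bumpSeq n).hasCompactSupport_normed.convolutionExists_left _
      ((bumpSeq n).contDiff_normed (n := 0)).continuous hH.locallyIntegrable x
  simp only [mollify, convolution_def]
  rw [← integral_sub (hx hF) (hx hG)]
  congr 1 with t
  simp [mul_sub]

/-- Mollification preserves positivity and the integral and converges a.e., so Scheffé's lemma
applies to the positive and the negative part separately. -/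
theorem tendsto_integral_abs_mollify_sub {F : R3 → ℝ} (hF : Integrable F) :
    Tendsto (fun n => ∫ x, |mollify n F x - F x|) atTop (𝓝 0) := by
  set P : R3 → ℝ := fun x => max (F x) 0
  set N : R3 → ℝ := fun x => max (-F x) 0
  have hP : Integrable P := hF.pos_part
  have hN : Integrable N := hF.neg_part
  have key : ∀ {G : R3 → ℝ}, Integrable G → (∀ x, 0 ≤ G x) →
      Tendsto (fun n => ∫ x, |mollify n G x - G x|) atTop (𝓝 0) := fun hG hG0 =>
    tendsto_integral_abs_sub_of_nonneg (fun n => integrable_mollify n hG) hG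
      (fun n => mollify_nonneg n hG0) (ae_tendsto_mollify hG) (fun n => integral_mollify n hG)
  have hFPN : F = P - N := by
    ext x
    simp only [P, N, Pi.sub_apply]
    rcases le_total (F x) 0 with h | h
    · rw [max_eq_right h, max_eq_left (by linarith)]; ring
    · rw [max_eq_left h, max_eq_right (by linarith)]; ring
  refine squeeze_zero (fun n => integral_nonneg fun x => abs_nonneg _) (fun n => ?_)
    (by simpa using (key hP fun x => le_max_right _ _).add (key hN fun x => le_max_right _ _))
  have hi1 := ((integrable_mollify n hP).sub hP).abs
  have hi2 := ((integrable_mollify n hN).sub hN).abs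
  simp only [Pi.sub_apply] at hi1 hi2
  rw [← integral_add hi1 hi2]
  refine integral_mono (((integrable_mollify n hF).sub hF).abs) (hi1.add hi2) fun x => ?_
  have h1 : mollify n F x = mollify n P x - mollify n N x := by
    conv_lhs => rw [hFPN]
    exact mollify_sub n hP hN x
  have h2 : F x = P x - N x := congrFun hFPN x
  change |_| ≤ |_| + |_|
  rw [h1, h2, show mollify n P x - mollify n N x - (P x - N x)
    = (mollify n P x - P x) - (mollify n N x - N x) by ring]
  exact abs_sub _ _

theorem contDiff_mollify (n : ℕ) {F : R3 → ℝ} (hF : Integrable F) :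
    ContDiff ℝ ∞ (mollify n F) :=
  (bumpSeq n).hasCompactSupport_normed.contDiff_convolution_left _
    (bumpSeq n).contDiff_normed hF.locallyIntegrable

theorem mollify_eq_swap (n : ℕ) (F : R3 → ℝ) (x : R3) :
    mollify n F x = ∫ y, F y * (bumpSeq n).normed volume (x - y) := by
  rw [mollify, convolution_eq_swap]
  simp [mul_comm]

/-- The derivative falls on the kernel, and y ↦ ρ(x - y) is a legitimate test function; its
reflected argument gives a sign that cancels the one in the weak derivative. -/
theorem fderiv_mollify (n : ℕ) {i : Fin 3} {F D : R3 → ℝ} (hF : Integrable F)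
    (h : IsWeakPartial ⊤ i F D) (x : R3) :
    fderiv ℝ (mollify n F) x (EuclideanSpace.single i 1) = mollify n D x := by
  set ρ := (bumpSeq n).normed (volume : Measure R3)
  have hρ : ContDiff ℝ ∞ ρ := (bumpSeq n).contDiff_normed
  have hρc : HasCompactSupport ρ := (bumpSeq n).hasCompactSupport_normed
  have h1 := (hρc.hasFDerivAt_convolution_left (ContinuousLinearMap.lsmul ℝ ℝ)
    (hρ.of_le (by simp)) hF.locallyIntegrable x).fderiv
  change fderiv ℝ (ρ ⋆[ContinuousLinearMap.lsmul ℝ ℝ, volume] F) x _ = _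
  rw [h1, convolution_eq_swap, mollify_eq_swap]
  have hint : Integrable (fun t => (ContinuousLinearMap.precompL R3
      (ContinuousLinearMap.lsmul ℝ ℝ) (fderiv ℝ ρ (x - t))) (F t)) := by
    have := (hρc.fderiv ℝ).convolutionExists_left
      (ContinuousLinearMap.precompL R3 (ContinuousLinearMap.lsmul ℝ ℝ : ℝ →L[ℝ] ℝ →L[ℝ] ℝ))
      (hρ.continuous_fderiv (by simp)) hF.locallyIntegrable x
    exact this.integrable_swap
  rw [ContinuousLinearMap.integral_apply hint]
  simp only [ContinuousLinearMap.precompL_apply, ContinuousLinearMap.lsmul_apply, smul_eq_mul]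
  set φ : R3 → ℝ := fun y => ρ (x - y)
  have hφ : ContDiff ℝ ∞ φ := hρ.comp (contDiff_const.sub contDiff_id)
  have hφc : HasCompactSupport φ := hρc.comp_homeomorph (Homeomorph.subLeft x)
  have hder : ∀ y, fderiv ℝ φ y (EuclideanSpace.single i 1)
      = -(fderiv ℝ ρ (x - y) (EuclideanSpace.single i 1)) := by
    intro y
    have h2 : HasFDerivAt φ ((fderiv ℝ ρ (x - y)).comp (-ContinuousLinearMap.id ℝ R3)) y :=
      HasFDerivAt.comp y ((hρ.differentiable (by simp)) (x - y)).hasFDerivAt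
        ((hasFDerivAt_id y).const_sub x)
    rw [h2.fderiv]
    simp
  have h3 := h.integral_mul_fderiv hφ hφc (by simp)
  simp only [hder, mul_neg, integral_neg, neg_inj] at h3
  rw [← h3]
  congr 1 with y
  ring

/-! ### Cutoffs and smooth approximation on open sets -/

theorem integrable_mul_of_tsupport_subset {Ω : Set R3} {f χ : R3 → ℝ}
    (hf : LocallyIntegrableOn f Ω) (hχ : Continuous χ) (hc : HasCompactSupport χ)
    (hs : tsupport χ ⊆ Ω) : Integrable (fun x => f x * χ x) := by
  have h1 : IntegrableOn (fun x => f x * χ x) (tsupport χ) :=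
    ((hf.mono_set hs).integrableOn_isCompact hc).mul_continuousOn hχ.continuousOn hc
  refine (integrableOn_iff_integrable_of_support_subset fun x hx => ?_).1 h1
  exact subset_tsupport _ (right_ne_zero_of_mul (Function.mem_support.1 hx))

/-- A product with a cutoff function has global weak derivatives, by the Leibniz rule. -/
theorem IsWeakPartial.mul_cutoff {Ω : TopologicalSpace.Opens R3} {i : Fin 3} {f g χ : R3 → ℝ}
    (h : IsWeakPartial Ω i f g) (hχ : ContDiff ℝ ∞ χ) (hc : HasCompactSupport χ)
    (hs : tsupport χ ⊆ Ω) :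
    Integrable (fun x => f x * χ x) ∧
    Integrable (fun x => g x * χ x + f x * fderiv ℝ χ x (EuclideanSpace.single i 1)) ∧
    IsWeakPartial ⊤ i (fun x => f x * χ x)
      (fun x => g x * χ x + f x * fderiv ℝ χ x (EuclideanSpace.single i 1)) := by
  set e : R3 := EuclideanSpace.single i 1
  have hχ' : Continuous fun x => fderiv ℝ χ x e :=
    (hχ.continuous_fderiv (by simp)).clm_apply continuous_const
  have hs' : tsupport (fun x => fderiv ℝ χ x e) ⊆ tsupport χ := tsupport_fderiv_apply_subset ℝ e
  have hc' : HasCompactSupport fun x => fderiv ℝ χ x e := hc.mono' (subset_closure.trans hs')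
  have h1 := integrable_mul_of_tsupport_subset h.1 hχ.continuous hc hs
  have h2 := integrable_mul_of_tsupport_subset h.2.1 hχ.continuous hc hs
  have h3 := integrable_mul_of_tsupport_subset h.1 hχ' hc' (hs'.trans hs)
  refine ⟨h1, h2.add h3, h1.locallyIntegrable.locallyIntegrableOn _,
    (h2.add h3).locallyIntegrable.locallyIntegrableOn _, fun φ => ?_⟩
  have hφ : ContDiff ℝ ∞ φ := φ.contDiff
  have hφ' : Continuous fun x => fderiv ℝ φ x e :=
    (hφ.continuous_fderiv (by simp)).clm_apply continuous_const
  -- The weak derivative is tested on χ φ, which is supported in Ω although φ need not be.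
  have h4 := h.integral_mul_fderiv (hχ.mul hφ) hc.mul_right
    ((closure_mono (Function.support_mul_subset_left _ _)).trans hs)
  have hder : ∀ x, fderiv ℝ (fun y => χ y * φ y) x e = χ x * fderiv ℝ φ x e + φ x * fderiv ℝ χ x e := by
    intro x
    rw [fderiv_fun_mul (hχ.differentiable (by simp) x) (hφ.differentiable (by simp) x)]
    simp
  have hsup : ∀ {ψ : R3 → ℝ}, tsupport (fun x => χ x * ψ x) ⊆ tsupport χ := fun {ψ} =>
    closure_mono (Function.support_mul_subset_left _ _)
  have hsup' : ∀ {ψ : R3 → ℝ}, tsupport (fun x => fderiv ℝ χ x e * ψ x) ⊆ tsupport χ := fun {ψ} =>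
    (closure_mono (Function.support_mul_subset_left _ _)).trans hs'
  have i1 := integrable_mul_of_tsupport_subset h.1 (hχ.continuous.mul hφ') hc.mul_right
    (hsup.trans hs)
  have i2 := integrable_mul_of_tsupport_subset h.1 (hχ'.mul hφ.continuous) hc'.mul_right
    (hsup'.trans hs)
  have i3 := integrable_mul_of_tsupport_subset h.2.1 (hχ.continuous.mul hφ.continuous)
    hc.mul_right (hsup.trans hs)
  simp only [Pi.mul_apply] at i1 i2 i3
  have e1 : ∫ x, f x * fderiv ℝ (fun y => χ y * φ y) x e
      = (∫ x, f x * (χ x * fderiv ℝ φ x e)) + ∫ x, f x * (fderiv ℝ χ x e * φ x) := by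
    rw [← integral_add i1 i2]
    congr 1 with x
    rw [hder]; ring
  have e2 : ∫ x, (g x * χ x + f x * fderiv ℝ χ x e) * φ x
      = (∫ x, g x * (χ x * φ x)) + ∫ x, f x * (fderiv ℝ χ x e * φ x) := by
    rw [← integral_add i3 i2]
    congr 1 with x
    ring
  rw [e1] at h4
  rw [e2]
  simp only [mul_assoc]
  linarith

theorem exists_cutoff {K Ω : Set R3} (hK : IsCompact K) (hΩ : IsOpen Ω) (hKΩ : K ⊆ Ω) :
    ∃ χ : R3 → ℝ, ContDiff ℝ ∞ χ ∧ HasCompactSupport χ ∧ tsupport χ ⊆ Ω ∧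
      ∀ᶠ x in 𝓝ˢ K, χ x = 1 := by
  obtain ⟨L, hL, hKL, hLΩ⟩ := exists_compact_between hK hΩ hKΩ
  obtain ⟨χ, h1, h2, -⟩ := exists_contMDiffMap_one_nhds_of_subset_interior (n := ⊤)
    (modelWithCornersSelf ℝ R3) hK.isClosed hKL
  have hs : tsupport χ ⊆ L := closure_minimal
    (fun x hx => by_contra fun h => hx (h2 x h)) hL.isClosed
  exact ⟨χ, χ.contMDiff.contDiff, HasCompactSupport.of_support_subset_isCompact hL
    (subset_closure.trans hs), hs.trans hLΩ, h1⟩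

theorem exists_open_exhaustion (Ω : TopologicalSpace.Opens R3) :
    ∃ K : ℕ → Set R3, (∀ n, IsCompact (K n)) ∧ (∀ n, K n ⊆ Ω) ∧ Monotone K ∧
      ∀ L : Set R3, IsCompact L → L ⊆ Ω → ∃ n, L ⊆ K n := by
  have : LocallyCompactSpace Ω := Ω.isOpen.locallyCompactSpace
  let K := CompactExhaustion.choice Ω
  refine ⟨fun n => Subtype.val '' K n, fun n => (K.isCompact n).image continuous_subtype_val,
    fun n => by rintro _ ⟨x, -, rfl⟩; exact x.2,
    fun m n h => image_mono (K.subset h), fun L hL hLΩ => ?_⟩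
  have hc : IsCompact ((Subtype.val : Ω → R3) ⁻¹' L) :=
    Topology.IsInducing.subtypeVal.isCompact_preimage' hL (by simpa using hLΩ)
  obtain ⟨n, hn⟩ := K.exists_superset_of_isCompact hc
  exact ⟨n, fun x hx => ⟨⟨x, hLΩ hx⟩, hn hx, rfl⟩⟩

theorem tsum_ne_top_of_eventually_le {a b : ℕ → ENNReal} (ha : ∀ n, a n ≠ ⊤) {N : ℕ}
    (hab : ∀ n, N ≤ n → a n ≤ b n) (hb : ∑' n, b n ≠ ⊤) : ∑' n, a n ≠ ⊤ := by
  have h1 : ∀ n, a n ≤ b n + (if n ∈ Finset.range N then a n else 0) := by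
    intro n
    by_cases h : n ∈ Finset.range N
    · simp [h]
    · simpa [h] using hab n (by simpa using h)
  refine ne_top_of_le_ne_top ?_ (ENNReal.tsum_le_tsum h1)
  rw [ENNReal.tsum_add, tsum_eq_sum (f := fun n => if n ∈ Finset.range N then a n else 0)
    (s := Finset.range N) (fun n hn => if_neg hn)]
  refine ENNReal.add_ne_top.2 ⟨hb, ENNReal.sum_ne_top.2 fun n hn => ?_⟩
  rw [if_pos hn]
  exact ha n

/-- Functions with weak first derivatives on an open set are approximated by smooth functions,
in `L¹` of every compact subset, together with their derivatives, at a summable rate. -/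
theorem exists_smooth_approx {Ω : TopologicalSpace.Opens R3} {g : R3 → ℝ} {D : Fin 3 → R3 → ℝ}
    (h : ∀ j, IsWeakPartial Ω j g (D j)) :
    ∃ G : ℕ → R3 → ℝ, (∀ n, ContDiff ℝ ∞ (G n)) ∧ ∀ K : Set R3, IsCompact K → K ⊆ Ω →
      (∑' n, ∫⁻ x in K, ‖G n x - g x‖ₑ ≠ ⊤) ∧
      ∀ j, ∑' n, ∫⁻ x in K, ‖fderiv ℝ (G n) x (EuclideanSpace.single j 1) - D j x‖ₑ ≠ ⊤ := by
  obtain ⟨K, hK, hKΩ, hmono, hex⟩ := exists_open_exhaustion Ω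
  choose χ hχ hχc hχs hχ1 using fun n => exists_cutoff (hK n) Ω.isOpen (hKΩ n)
  set F : ℕ → R3 → ℝ := fun n x => g x * χ n x
  set D' : ℕ → Fin 3 → R3 → ℝ := fun n j x =>
    D j x * χ n x + g x * fderiv ℝ (χ n) x (EuclideanSpace.single j 1)
  have hF : ∀ n, Integrable (F n) := fun n => ((h 0).mul_cutoff (hχ n) (hχc n) (hχs n)).1
  have hD' : ∀ n j, Integrable (D' n j) := fun n j =>
    ((h j).mul_cutoff (hχ n) (hχc n) (hχs n)).2.1
  have hW : ∀ n j, IsWeakPartial ⊤ j (F n) (D' n j) := fun n j =>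
    ((h j).mul_cutoff (hχ n) (hχc n) (hχs n)).2.2
  -- The mollification parameter is taken so fine that the n-th errors are below 2⁻ⁿ; summability
  -- gives a.e. convergence later without passing to subsequences.
  have hm : ∀ n : ℕ, ∃ m, (∫ x, |mollify m (F n) x - F n x|) < (1 / 2) ^ n ∧
      ∀ j, (∫ x, |mollify m (D' n j) x - D' n j x|) < (1 / 2) ^ n := by
    intro n
    have hpos : (0 : ℝ) < (1 / 2) ^ n := by positivity
    exact (((tendsto_integral_abs_mollify_sub (hF n)).eventually_lt_const hpos).and
      (eventually_all.2 fun j =>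
        (tendsto_integral_abs_mollify_sub (hD' n j)).eventually_lt_const hpos)).exists
  choose m hm1 hm2 using hm
  have hFK : ∀ n, ∀ x ∈ K n, F n x = g x := fun n x hx => by
    simp only [F]
    rw [(hχ1 n).self_of_nhdsSet x hx, mul_one]
  have hDK : ∀ n j, ∀ x ∈ K n, D' n j x = D j x := fun n j x hx => by
    have h1 : χ n =ᶠ[𝓝 x] fun _ => (1 : ℝ) := (hχ1 n).filter_mono (nhds_le_nhdsSet hx)
    simp only [D']
    rw [h1.fderiv_eq, h1.self_of_nhds]
    simp
  have hgeo : ∑' n : ℕ, ENNReal.ofReal ((1 / 2) ^ n) ≠ ⊤ :=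
    (summable_geometric_two).tsum_ofReal_ne_top
  -- A compact L lies in K n from some N on, where the cutoff is 1 and the errors are geometric. The
  -- finitely many earlier terms only have to be finite.
  have main : ∀ {A B : ℕ → R3 → ℝ} {b : R3 → ℝ}, (∀ n, Integrable (A n)) →
      (∀ n, Integrable (B n)) → LocallyIntegrableOn b (Ω : Set R3) →
      (∀ n, ∀ x ∈ K n, B n x = b x) → (∀ n, (∫ x, |A n x - B n x|) < (1 / 2) ^ n) →
      ∀ L : Set R3, IsCompact L → L ⊆ Ω → ∑' n, ∫⁻ x in L, ‖A n x - b x‖ₑ ≠ ⊤ := by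
    intro A B b hA hB hb hBb hAB L hL hLΩ
    obtain ⟨N, hN⟩ := hex L hL hLΩ
    refine tsum_ne_top_of_eventually_le (N := N) (fun n => ?_) (fun n hn => ?_) hgeo
    · exact ((hA n).integrableOn.sub ((hb.mono_set hLΩ).integrableOn_isCompact hL)).2.ne
    · calc ∫⁻ x in L, ‖A n x - b x‖ₑ = ∫⁻ x in L, ‖A n x - B n x‖ₑ := by
            refine setLIntegral_congr_fun hL.measurableSet fun x hx => ?_
            simp only [hBb n x (hmono hn (hN hx))]
        _ ≤ ∫⁻ x, ‖A n x - B n x‖ₑ := setLIntegral_le_lintegral _ _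
        _ = ENNReal.ofReal (∫ x, |A n x - B n x|) :=
            (ofReal_integral_norm_eq_lintegral_enorm ((hA n).sub (hB n))).symm
        _ ≤ _ := ENNReal.ofReal_le_ofReal (hAB n).le
  refine ⟨fun n => mollify (m n) (F n), fun n => contDiff_mollify _ (hF n), fun L hL hLΩ => ⟨?_, ?_⟩⟩
  · exact main (fun n => integrable_mollify _ (hF n)) hF (h 0).1 hFK hm1 L hL hLΩ
  · intro j
    simp_rw [fun n x => fderiv_mollify (m n) (hF n) (hW n j) x]
    exact main (fun n => integrable_mollify _ (hD' n j)) (fun n => hD' n j) (h j).2.1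
      (fun n => hDK n j) (fun n => hm2 n j) L hL hLΩ

/-! ### Representatives that are primitives along lines -/

/-- The plane of parameters of a surface. -/
abbrev R2 : Type := EuclideanSpace ℝ (Fin 2)

theorem clm_apply_eq_sum (L : R3 →L[ℝ] ℝ) (v : R3) :
    L v = ∑ j, L (EuclideanSpace.single j 1) * v j := by
  conv_lhs => rw [← (EuclideanSpace.basisFun (Fin 3) ℝ).sum_repr v]
  simp [mul_comm]

/-- The sum of the a n has finite integral, hence is finite a.e., and the terms of a convergent
series tend to zero. -/
theorem ae_tendsto_zero_of_tsum_lintegral {α : Type*} [MeasurableSpace α] {μ : Measure α}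
    {a : ℕ → α → ENNReal} (hm : ∀ n, AEMeasurable (a n) μ) (h : ∑' n, ∫⁻ x, a n x ∂μ ≠ ⊤) :
    ∀ᵐ x ∂μ, Tendsto (fun n => a n x) atTop (𝓝 0) := by
  rw [← lintegral_tsum hm] at h
  filter_upwards [ae_lt_top' (AEMeasurable.tsum hm) h] with x hx
  exact ENNReal.tendsto_atTop_zero_of_tsum_ne_top hx.ne

/-- If the derivatives converge in `L¹` of an interval and the functions converge at one point,
then they converge everywhere on the interval, to a primitive of the limit. -/
theorem tendsto_of_tendsto_lintegral_deriv {γ γ' : ℕ → ℝ → ℝ} {κ : ℝ → ℝ} {a b c t₀ : ℝ}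
    (hγ : ∀ n t, HasDerivAt (γ n) (γ' n t) t) (hγ' : ∀ n, Continuous (γ' n))
    (hκ : IntegrableOn κ (Icc a b))
    (hlim : Tendsto (fun n => ∫⁻ t in Icc a b, ‖γ' n t - κ t‖ₑ) atTop (𝓝 0))
    (ht₀ : t₀ ∈ Icc a b) (hc : Tendsto (fun n => γ n t₀) atTop (𝓝 c)) {t : ℝ}
    (ht : t ∈ Icc a b) :
    Tendsto (fun n => γ n t) atTop (𝓝 (c + ∫ s in t₀..t, κ s)) := by
  have hsub : uIcc t₀ t ⊆ Icc a b := uIcc_subset_Icc ht₀ ht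
  have hκi : IntervalIntegrable κ volume t₀ t :=
    (hκ.mono_set hsub).intervalIntegrable
  have hγi : ∀ n, IntervalIntegrable (γ' n) volume t₀ t := fun n => (hγ' n).intervalIntegrable _ _
  have h1 : ∀ n, γ n t = γ n t₀ + ∫ s in t₀..t, γ' n s := fun n => by
    rw [intervalIntegral.integral_eq_sub_of_hasDerivAt (fun x _ => hγ n x) (hγi n)]
    ring
  simp_rw [h1]
  refine hc.add ?_
  rw [tendsto_iff_norm_sub_tendsto_zero]
  have h2 : Tendsto (fun n => (∫⁻ t in Icc a b, ‖γ' n t - κ t‖ₑ).toReal) atTop (𝓝 0) := by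
    exact (ENNReal.tendsto_toReal ENNReal.zero_ne_top).comp hlim
  refine squeeze_zero (fun n => norm_nonneg _) (fun n => ?_) h2
  have hi : IntegrableOn (fun s => γ' n s - κ s) (Icc a b) :=
    ((hγ' n).continuousOn.integrableOn_Icc).sub hκ
  rw [← intervalIntegral.integral_sub (hγi n) hκi, ← integral_norm_eq_lintegral_enorm
    hi.aestronglyMeasurable]
  refine (intervalIntegral.norm_integral_le_integral_norm_uIoc).trans ?_
  exact setIntegral_mono_set hi.norm (Eventually.of_forall fun _ => norm_nonneg _)
    (LE.le.eventuallyLE (uIoc_subset_uIcc.trans hsub))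

theorem hasDerivAt_comp_line {G : R3 → ℝ} (hG : ContDiff ℝ ∞ G) (x v : R3) (t : ℝ) :
    HasDerivAt (fun s : ℝ => G (x + s • v))
      (∑ j, fderiv ℝ G (x + t • v) (EuclideanSpace.single j 1) * v j) t := by
  have h1 : HasDerivAt (fun s : ℝ => x + s • v) v t := by
    simpa using ((hasDerivAt_id t).smul_const v).const_add x
  have h2 := ((hG.differentiable (by simp)) (x + t • v)).hasFDerivAt.comp_hasDerivAt t h1
  rwa [clm_apply_eq_sum] at h2

/-- A function with weak first derivatives has a representative that is a primitive of the
directional derivative along almost every line of a nondegenerate family of segments. -/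
theorem exists_absolutelyContinuous_representative {Ω : TopologicalSpace.Opens R3} {g : R3 → ℝ}
    {D : Fin 3 → R3 → ℝ} (h : ∀ j, IsWeakPartial Ω j g (D j)) :
    ∃ u : R3 → ℝ, (∀ᵐ y, y ∈ Ω → u y = g y) ∧
      ∀ (f N : R2 → R3) (A : Set R2) (a b : ℝ) (K : Set R3) (C : ENNReal), Measurable f →
        Measurable N → (∀ p, ‖N p‖ ≤ 1) → a < b → IsCompact K → K ⊆ Ω → C ≠ ⊤ →
        Measure.map (fun q : R2 × ℝ => f q.1 + q.2 • N q.1)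
          ((volume : Measure (R2 × ℝ)).restrict (A ×ˢ Icc a b)) ≤ C • volume.restrict K →
        ∀ᵐ p ∂(volume.restrict A),
          IntegrableOn (fun t => ∑ j, D j (f p + t • N p) * N p j) (Icc a b) ∧
          (∀ t ∈ Icc a b, u (f p + t • N p)
            = u (f p + a • N p) + ∫ s in a..t, ∑ j, D j (f p + s • N p) * N p j) ∧
          ∀ᵐ t ∂(volume.restrict (Icc a b)), u (f p + t • N p) = g (f p + t • N p) := by
  obtain ⟨G, hG, hGK⟩ := exists_smooth_approx h
  have hconv : ∀ K : Set R3, IsCompact K → K ⊆ Ω →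
      ∀ᵐ y ∂(volume.restrict K), Tendsto (fun n => G n y) atTop (𝓝 (g y)) := by
    intro K hK hKΩ
    have hgm := (((h 0).1.mono_set hKΩ).integrableOn_isCompact hK).aestronglyMeasurable
    filter_upwards [ae_tendsto_zero_of_tsum_lintegral (fun n =>
      ((hG n).continuous.aestronglyMeasurable.sub hgm).enorm) (hGK K hK hKΩ).1] with y hy
    exact tendsto_iff_edist_tendsto_0.2 (by simpa [edist_eq_enorm_sub] using hy)
  -- The representative is the pointwise limit of the smooth approximations, with an irrelevant
  -- default value where they diverge. It is fixed before any family of segments, so one function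
  -- serves all of them.
  refine ⟨fun y => limUnder atTop (fun n => G n y), ?_, ?_⟩
  · obtain ⟨K, hK, hKΩ, -, hex⟩ := exists_open_exhaustion Ω
    have h1 : ∀ᵐ y, ∀ n, y ∈ K n → Tendsto (fun n => G n y) atTop (𝓝 (g y)) :=
      ae_all_iff.2 fun n => (ae_restrict_iff' (hK n).measurableSet).1 (hconv _ (hK n) (hKΩ n))
    filter_upwards [h1] with y hy hyΩ
    obtain ⟨n, hn⟩ := hex {y} isCompact_singleton (by simpa using hyΩ)
    exact (hy n (hn rfl)).limUnder_eq
  · intro f N A a b K C hf hN hN1 hab hK hKΩ hC hmap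
    set Φ : R2 × ℝ → R3 := fun q => f q.1 + q.2 • N q.1
    have hΦ : Measurable Φ := by fun_prop
    have hprod : (volume : Measure (R2 × ℝ)).restrict (A ×ˢ Icc a b)
        = (volume.restrict A).prod (volume.restrict (Icc a b)) := by
      rw [Measure.prod_restrict, Measure.volume_eq_prod]
    rw [hprod] at hmap
    set μ := ((volume : Measure R2).restrict A).prod ((volume : Measure ℝ).restrict (Icc a b))
    have hint : ∀ j, Integrable (fun q => D j (Φ q)) μ := fun j =>
      (((((h j).2.1.mono_set hKΩ).integrableOn_isCompact hK).smul_measure hC).mono_measure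
        hmap).comp_measurable hΦ
    have hGc : ∀ n j, Continuous fun y => fderiv ℝ (G n) y (EuclideanSpace.single j 1) :=
      fun n j => ((hG n).continuous_fderiv (by simp)).clm_apply continuous_const
    have hmeas : ∀ n j, AEMeasurable (fun q => ‖fderiv ℝ (G n) (Φ q) (EuclideanSpace.single j 1)
        - D j (Φ q)‖ₑ) μ := fun n j =>
      (((hGc n j).measurable.comp hΦ).aestronglyMeasurable.sub
        (hint j).aestronglyMeasurable).enorm
    have hslice : ∀ j, ∀ᵐ p ∂(volume.restrict A), Tendsto (fun n => ∫⁻ t in Icc a b,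
        ‖fderiv ℝ (G n) (Φ (p, t)) (EuclideanSpace.single j 1) - D j (Φ (p, t))‖ₑ)
        atTop (𝓝 0) := by
      intro j
      refine ae_tendsto_zero_of_tsum_lintegral (fun n => (hmeas n j).lintegral_prod_right') ?_
      -- The bound on the pushforward turns summable errors on K into summable errors over the
      -- family of segments; Tonelli then gives L¹ convergence on almost every segment.
      have hle : ∀ n, ∫⁻ p in A, ∫⁻ t in Icc a b, ‖fderiv ℝ (G n) (Φ (p, t))
          (EuclideanSpace.single j 1) - D j (Φ (p, t))‖ₑ ≤ C * ∫⁻ y in K,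
          ‖fderiv ℝ (G n) y (EuclideanSpace.single j 1) - D j y‖ₑ := by
        intro n
        rw [← lintegral_prod _ (hmeas n j)]
        have hm : AEMeasurable (fun y => ‖fderiv ℝ (G n) y (EuclideanSpace.single j 1)
            - D j y‖ₑ) (Measure.map Φ μ) := by
          refine AEMeasurable.mono_ac ?_ (Measure.absolutelyContinuous_of_le hmap)
          refine AEMeasurable.smul_measure ?_ _
          exact ((hGc n j).aestronglyMeasurable.sub
            (((h j).2.1.mono_set hKΩ).integrableOn_isCompact hK).aestronglyMeasurable).enorm
        rw [← lintegral_map' hm hΦ.aemeasurable]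
        refine (lintegral_mono' hmap le_rfl).trans_eq ?_
        rw [lintegral_smul_measure, smul_eq_mul]
      refine ne_top_of_le_ne_top ?_ (ENNReal.tsum_le_tsum hle)
      rw [ENNReal.tsum_mul_left]
      exact ENNReal.mul_ne_top hC ((hGK K hK hKΩ).2 j)
    have hae : ∀ᵐ p ∂(volume.restrict A), ∀ᵐ t ∂(volume.restrict (Icc a b)),
        Tendsto (fun n => G n (Φ (p, t))) atTop (𝓝 (g (Φ (p, t)))) := by
      refine Measure.ae_ae_of_ae_prod (μ := volume.restrict A) (ν := volume.restrict (Icc a b))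
        (p := fun q => Tendsto (fun n => G n (Φ q)) atTop (𝓝 (g (Φ q)))) ?_
      refine ae_of_ae_map (p := fun y => Tendsto (fun n => G n y) atTop (𝓝 (g y)))
        hΦ.aemeasurable ?_
      exact (Measure.absolutelyContinuous_of_le hmap).trans
        (Measure.smul_absolutelyContinuous) |>.ae_le (hconv K hK hKΩ)
    filter_upwards [ae_all_iff.2 hslice, hae, ae_all_iff.2 fun j => (hint j).prod_right_ae]
      with p hp1 hp2 hp3
    have hNj : ∀ j, ‖N p j‖ ≤ 1 := fun j => (PiLp.norm_apply_le (N p) j).trans (hN1 p)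
    have hκ : IntegrableOn (fun t => ∑ j, D j (f p + t • N p) * N p j) (Icc a b) :=
      integrable_finsetSum _ fun j _ => (hp3 j).mul_const _
    have hlim : Tendsto (fun n => ∫⁻ t in Icc a b,
        ‖(∑ j, fderiv ℝ (G n) (f p + t • N p) (EuclideanSpace.single j 1) * N p j)
          - ∑ j, D j (f p + t • N p) * N p j‖ₑ) atTop (𝓝 0) := by
      have hsum := tendsto_finsetSum Finset.univ (fun j (_ : j ∈ Finset.univ) => hp1 j)
      simp only [Finset.sum_const_zero] at hsum
      refine tendsto_of_tendsto_of_tendsto_of_le_of_le tendsto_const_nhds hsum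
        (fun n => zero_le) (fun n => ?_)
      have hme : ∀ j ∈ (Finset.univ : Finset (Fin 3)), AEMeasurable (fun t => ‖fderiv ℝ (G n)
          (Φ (p, t)) (EuclideanSpace.single j 1) - D j (Φ (p, t))‖ₑ)
          (volume.restrict (Icc a b)) := fun j _ =>
        (((hGc n j).measurable.comp (hΦ.comp measurable_prodMk_left)).aestronglyMeasurable.sub
          (hp3 j).aestronglyMeasurable).enorm
      rw [← lintegral_finsetSum' _ hme]
      refine lintegral_mono fun t => ?_
      rw [← Finset.sum_sub_distrib]
      refine (enorm_sum_le _ _).trans (Finset.sum_le_sum fun j _ => ?_)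
      rw [← sub_mul, enorm_mul]
      refine mul_le_of_le_one_right' ?_
      rw [← ofReal_norm]
      exact ENNReal.ofReal_le_one.2 (hNj j)
    -- Positive length supplies a point t₀ of the segment at which the approximations converge;
    -- convergence of the derivatives in L¹ carries this to every point of the segment.
    have hne : (volume.restrict (Icc a b)) ≠ 0 := by
      rw [Ne, Measure.restrict_eq_zero, Real.volume_Icc]
      simpa using hab
    have : NeBot (ae (volume.restrict (Icc a b))) := ae_neBot.2 hne
    obtain ⟨t₀, hp2t, ht₀⟩ := (hp2.and (ae_restrict_mem measurableSet_Icc)).exists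
    have hl : ∀ t ∈ Icc a b, Tendsto (fun n => G n (f p + t • N p)) atTop
        (𝓝 (g (Φ (p, t₀)) + ∫ s in t₀..t, ∑ j, D j (f p + s • N p) * N p j)) := fun t ht =>
      tendsto_of_tendsto_lintegral_deriv (fun n t => hasDerivAt_comp_line (hG n) _ _ t)
        (fun n => continuous_finsetSum _ fun j _ => ((hGc n j).comp (by fun_prop)).mul
          continuous_const) hκ hlim ht₀ hp2t ht
    refine ⟨hκ, fun t ht => ?_, ?_⟩
    · have ha : a ∈ Icc a b := ⟨le_rfl, hab.le⟩
      rw [(hl t ht).limUnder_eq, (hl a ha).limUnder_eq, add_assoc,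
        intervalIntegral.integral_add_adjacent_intervals]
      · exact (hκ.mono_set (uIcc_subset_Icc ht₀ ha)).intervalIntegrable
      · exact (hκ.mono_set (uIcc_subset_Icc ha ht)).intervalIntegrable
    · filter_upwards [hp2] with t ht
      exact ht.limUnder_eq

/-! ### The area formula for parametrized surfaces -/

/-- The hypothesis says that f factors through g on S by a K-Lipschitz map. Comparing f and g
directly, rather than assuming one Lipschitz, lets a nonlinear map be compared with its
linearization in both directions. -/
theorem hausdorffMeasure_image_le_of_dist_le {α X Y : Type*} [MetricSpace X] [MeasurableSpace X]
    [BorelSpace X] [MetricSpace Y] [MeasurableSpace Y] [BorelSpace Y] {f : α → X} {g : α → Y}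
    {S : Set α} {K : ℝ≥0} (h : ∀ x ∈ S, ∀ y ∈ S, dist (f x) (f y) ≤ K * dist (g x) (g y)) :
    (Measure.euclideanHausdorffMeasure 2 : Measure X) (f '' S)
      ≤ (K : ENNReal) ^ 2 * (Measure.euclideanHausdorffMeasure 2 : Measure Y) (g '' S) := by
  rcases S.eq_empty_or_nonempty with rfl | ⟨x₀, -⟩
  · simp
  have : Nonempty α := ⟨x₀⟩
  set k : Y → X := fun y => f (Function.invFunOn g S y)
  have hk : ∀ x ∈ S, k (g x) = f x := fun x hx => by
    have h1 := Function.invFunOn_mem ⟨x, hx, rfl⟩ (f := g) (b := g x)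
    have h2 := Function.invFunOn_eq ⟨x, hx, rfl⟩ (f := g) (b := g x)
    have h3 := h _ h1 x hx
    rw [h2, dist_self, mul_zero] at h3
    exact dist_le_zero.1 h3
  have hlip : LipschitzOnWith K k (g '' S) := by
    refine LipschitzOnWith.of_dist_le_mul ?_
    rintro _ ⟨x, hx, rfl⟩ _ ⟨y, hy, rfl⟩
    rw [hk x hx, hk y hy]
    exact h x hx y hy
  have himg : k '' (g '' S) = f '' S := by
    rw [image_image]
    exact image_congr hk
  have := hlip.hausdorffMeasure_image_le (d := 2) (by norm_num)
  rw [himg] at this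
  simp only [Measure.euclideanHausdorffMeasure_def, Measure.smul_apply, Nat.cast_ofNat]
  rw [mul_smul_comm]
  gcongr
  simpa using this

theorem le_of_forall_one_lt_sq_mul {x y : ENNReal} (h : ∀ K : ℝ≥0, 1 < K → x ≤ (K : ENNReal) ^ 2 * y) :
    x ≤ y := by
  have h1 : Tendsto (fun K : ℝ≥0 => (K : ENNReal) ^ 2 * y) (𝓝[>] 1) (𝓝 (((1 : ℝ≥0) : ENNReal) ^ 2 * y)) := by
    refine ENNReal.Tendsto.mul_const ?_ (Or.inl (by simp))
    exact (ENNReal.Tendsto.pow (ENNReal.tendsto_coe.2 tendsto_id)).mono_left nhdsWithin_le_nhds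
  simp only [ENNReal.coe_one, one_pow, one_mul] at h1
  exact ge_of_tendsto h1 (eventually_nhdsWithin_of_forall h)

/-- Near a point, a function with an injective strict derivative is close to its linearization,
up to a factor close to one. -/
theorem eventually_dist_le_of_hasStrictFDerivAt {f : R2 → R3} {L : R2 →L[ℝ] R3} {p : R2}
    (hf : HasStrictFDerivAt f L p) (hL : Function.Injective L) {K : ℝ≥0} (hK : 1 < K) :
    ∃ r > 0, ∀ x ∈ Metric.ball p r, ∀ y ∈ Metric.ball p r,
      dist (f x) (f y) ≤ K * dist (L x) (L y) ∧ dist (L x) (L y) ≤ K * dist (f x) (f y) := by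
  obtain ⟨C, hC, hanti⟩ := (L : R2 →ₗ[ℝ] R3).exists_antilipschitzWith (LinearMap.ker_eq_bot.2 hL)
  have hK' : (1 : ℝ) < K := by exact_mod_cast hK
  have hC' : (0 : ℝ) < C := by exact_mod_cast hC
  -- This ε serves both inequalities: 1 - ε = K⁻¹ exactly, and 1 + ε ≤ K because K + K⁻¹ ≥ 2.
  set ε : ℝ := 1 - (K : ℝ)⁻¹
  have hε : 0 < ε := sub_pos.2 (inv_lt_one_of_one_lt₀ hK')
  have hε1 : 1 + ε ≤ K := by
    have h2 : (K : ℝ) + (K : ℝ)⁻¹ - 2 = ((K : ℝ) - 1) ^ 2 / K := by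
      field_simp
      ring
    have : 0 ≤ ((K : ℝ) - 1) ^ 2 / K := by positivity
    simp only [ε]; linarith
  -- Dividing by the expansion constant C of L makes the error small relative to ‖L (x - y)‖ instead
  -- of ‖x - y‖.
  have hb := hf.isLittleO.bound (c := ε / C) (by positivity)
  rw [nhds_prod_eq, (Metric.nhds_basis_ball (x := p)).prod_self.eventually_iff] at hb
  obtain ⟨r, hr, hb⟩ := hb
  refine ⟨r, hr, fun x hx y hy => ?_⟩
  have h1 := hb (show (x, y) ∈ Metric.ball p r ×ˢ Metric.ball p r from ⟨hx, hy⟩)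
  simp only at h1
  have h2 : ‖x - y‖ ≤ C * ‖L x - L y‖ := by
    simpa [dist_eq_norm] using hanti.le_mul_dist x y
  have h3 : ‖f x - f y - L (x - y)‖ ≤ ε * ‖L x - L y‖ := by
    refine h1.trans ?_
    rw [div_mul_eq_mul_div, div_le_iff₀ hC', mul_assoc]
    refine mul_le_mul_of_nonneg_left ?_ hε.le
    linarith
  rw [map_sub] at h3
  rw [dist_eq_norm, dist_eq_norm]
  have h4 : ‖f x - f y‖ ≤ ‖L x - L y‖ + ‖f x - f y - (L x - L y)‖ := norm_le_insert' _ _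
  have h5 : ‖L x - L y‖ ≤ ‖f x - f y‖ + ‖f x - f y - (L x - L y)‖ := norm_le_insert _ _
  constructor
  · calc ‖f x - f y‖ ≤ (1 + ε) * ‖L x - L y‖ := by linarith
      _ ≤ K * ‖L x - L y‖ := mul_le_mul_of_nonneg_right hε1 (norm_nonneg _)
  · have h6 : (K : ℝ)⁻¹ * ‖L x - L y‖ ≤ ‖f x - f y‖ := by
      have : (K : ℝ)⁻¹ = 1 - ε := by simp [ε]
      rw [this]; linarith
    rwa [inv_mul_le_iff₀ (by linarith)] at h6

/-- The area formula for an injectively parametrized surface. -/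
theorem map_euclideanHausdorffMeasure_image {f : R2 → R3} {π : R3 → R2} (hπ : Measurable π)
    {A : Set R2} (hA : IsOpen A) (hA' : volume A ≠ ⊤) (hleft : ∀ p ∈ A, π (f p) = p)
    {Df : R2 → R2 →L[ℝ] R3} (hDf : ∀ p ∈ A, HasStrictFDerivAt f (Df p) p)
    (hinj : ∀ p ∈ A, Function.Injective (Df p)) {C : ℝ≥0} (hC : LipschitzOnWith C f A) :
    Measure.map π ((Measure.euclideanHausdorffMeasure 2 : Measure R3).restrict (f '' A))
      = (volume.restrict A).withDensity
        fun p => ENNReal.ofReal (LinearMap.normDet (Df p : R2 →ₗ[ℝ] R3)) := by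
  set ν := Measure.map π ((Measure.euclideanHausdorffMeasure 2 : Measure R3).restrict (f '' A))
    with hν_def
  set w : R2 → ENNReal := fun p => ENNReal.ofReal (LinearMap.normDet (Df p : R2 →ₗ[ℝ] R3))
  have hν : ∀ S, MeasurableSet S → ν S = (Measure.euclideanHausdorffMeasure 2 : Measure R3)
      (f '' (S ∩ A)) := by
    intro S hS
    rw [hν_def, Measure.map_apply hπ hS, Measure.restrict_apply (hπ hS)]
    congr 1
    ext y
    constructor
    · rintro ⟨h1, p, hp, rfl⟩
      rw [mem_preimage, hleft p hp] at h1
      exact ⟨p, ⟨h1, hp⟩, rfl⟩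
    · rintro ⟨p, ⟨h1, hp⟩, rfl⟩
      exact ⟨by rwa [mem_preimage, hleft p hp], p, hp, rfl⟩
  have hνle : ∀ S, MeasurableSet S → ν S ≤ (C : ENNReal) ^ 2 * volume (S ∩ A) := by
    intro S hS
    rw [hν S hS, ← EuclideanSpace.euclideanHausdorffMeasure_eq_volume 2]
    have := hausdorffMeasure_image_le_of_dist_le (f := f) (g := (id : R2 → R2)) (S := S ∩ A)
      (K := C) fun x hx y hy => hC.dist_le_mul x hx.2 y hy.2
    simpa using this
  have hνfin : IsFiniteMeasure ν := ⟨by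
    refine (hνle univ MeasurableSet.univ).trans_lt ?_
    rw [univ_inter]
    exact ENNReal.mul_lt_top (by simp) (lt_top_iff_ne_top.2 hA')⟩
  have hac : ν ≪ volume := by
    refine Measure.AbsolutelyContinuous.mk fun S hS h0 => ?_
    refine le_antisymm ((hνle S hS).trans ?_) zero_le
    rw [measure_mono_null inter_subset_left h0, mul_zero]
  -- The density of ν is a limit of ratios on shrinking balls. On a small ball f is within a factor
  -- K of its linearization, so the ratio is within K² of the area factor of the linear map; then K
  -- → 1.
  have hon : ∀ᵐ p, p ∈ A → ν.rnDeriv volume p = w p := by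
    filter_upwards [Besicovitch.ae_tendsto_rnDeriv ν volume] with p hp hpA
    have hball : ∀ r, volume.restrict A (Metric.closedBall p r) ≤ volume (Metric.closedBall p r) :=
      fun r => Measure.restrict_apply_le _ _
    have key : ∀ K : ℝ≥0, 1 < K → ∀ᶠ r in 𝓝[>] (0 : ℝ),
        ν (Metric.closedBall p r) / volume (Metric.closedBall p r) ≤ (K : ENNReal) ^ 2 * w p ∧
        w p ≤ (K : ENNReal) ^ 2 * (ν (Metric.closedBall p r) / volume (Metric.closedBall p r)) := by
      intro K hK
      obtain ⟨r₀, hr₀, hb⟩ := eventually_dist_le_of_hasStrictFDerivAt (hDf p hpA) (hinj p hpA) hK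
      obtain ⟨r₁, hr₁, hb₁⟩ := Metric.isOpen_iff.1 hA p hpA
      have hmem : Ioo (0 : ℝ) (min r₀ r₁) ∈ 𝓝[>] (0 : ℝ) := Ioo_mem_nhdsGT (lt_min hr₀ hr₁)
      filter_upwards [hmem] with r hr
      have hsub0 : Metric.closedBall p r ⊆ Metric.ball p r₀ :=
        Metric.closedBall_subset_ball (hr.2.trans_le (min_le_left _ _))
      have hsub1 : Metric.closedBall p r ∩ A = Metric.closedBall p r :=
        inter_eq_left.2 ((Metric.closedBall_subset_ball (hr.2.trans_le (min_le_right _ _))).trans hb₁)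
      have hlin := (Df p : R2 →ₗ[ℝ] R3).euclideanHausdorffMeasure_image_eq_normDet_mul_volume
        (Metric.closedBall p r)
      rw [finrank_euclideanSpace_fin] at hlin
      have hv0 : volume (Metric.closedBall p r) ≠ 0 := (Metric.measure_closedBall_pos _ _ hr.1).ne'
      have hvt : volume (Metric.closedBall p r) ≠ ⊤ := measure_closedBall_lt_top.ne
      rw [hν _ Metric.isClosed_closedBall.measurableSet, hsub1]
      constructor
      · rw [ENNReal.div_le_iff hv0 hvt, mul_assoc]
        rw [show w p * volume (Metric.closedBall p r) = _ from hlin.symm]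
        exact hausdorffMeasure_image_le_of_dist_le fun x hx y hy =>
          (hb x (hsub0 hx) y (hsub0 hy)).1
      · rw [← mul_div_assoc, ENNReal.le_div_iff_mul_le (Or.inl hv0) (Or.inl hvt)]
        rw [show w p * volume (Metric.closedBall p r) = _ from hlin.symm]
        exact hausdorffMeasure_image_le_of_dist_le fun x hx y hy =>
          (hb x (hsub0 hx) y (hsub0 hy)).2
    refine le_antisymm ?_ ?_
    · exact le_of_forall_one_lt_sq_mul fun K hK =>
        le_of_tendsto hp ((key K hK).mono fun r h => h.1)
    · refine le_of_forall_one_lt_sq_mul fun K hK => ?_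
      exact ge_of_tendsto (ENNReal.Tendsto.const_mul hp (Or.inr (by simp)))
        ((key K hK).mono fun r h => h.2)
  have hoff : ∀ᵐ p, p ∉ A → ν.rnDeriv volume p = 0 := by
    have h0 : ∫⁻ p in Aᶜ, ν.rnDeriv volume p = 0 := by
      rw [Measure.setLIntegral_rnDeriv hac]
      refine le_antisymm ((hνle _ hA.measurableSet.compl).trans ?_) zero_le
      simp
    rw [lintegral_eq_zero_iff (Measure.measurable_rnDeriv _ _)] at h0
    exact (ae_restrict_iff' hA.measurableSet.compl).1 h0
  rw [← Measure.withDensity_rnDeriv_eq ν volume hac, ← withDensity_indicator hA.measurableSet]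
  refine withDensity_congr_ae ?_
  filter_upwards [hon, hoff] with p h1 h2
  by_cases hp : p ∈ A
  · rw [indicator_of_mem hp, h1 hp]
  · rw [indicator_of_notMem hp, h2 hp]

/-! ### Jacobians in normal coordinates -/

/-- The space of normal coordinates and the ambient space, identified isometrically. -/
noncomputable def prodIsometry : WithLp 2 (R2 × ℝ) ≃ₗᵢ[ℝ] R3 :=
  ((stdOrthonormalBasis ℝ (WithLp 2 (R2 × ℝ))).reindex
    (finCongr (by rw [(WithLp.linearEquiv 2 ℝ (R2 × ℝ)).finrank_eq]; simp))).repr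

/-- A volume preserving identification of the normal coordinates with the ambient space. -/
noncomputable def prodEquiv : (R2 × ℝ) ≃L[ℝ] R3 :=
  (WithLp.prodContinuousLinearEquiv 2 ℝ R2 ℝ).symm.trans prodIsometry.toContinuousLinearEquiv

theorem measurePreserving_prodEquiv : MeasurePreserving prodEquiv := by
  have h1 : MeasurePreserving (WithLp.toLp 2 : R2 × ℝ → WithLp 2 (R2 × ℝ)) :=
    WithLp.volume_preserving_toLp R2 ℝ
  exact prodIsometry.measurePreserving.comp h1

/-- An isometric embedding of the plane onto the orthogonal complement of a unit vector. -/
theorem exists_linearIsometry_orthogonal {n : R3} (hn : ‖n‖ = 1) :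
    ∃ (j : R2 →ₗᵢ[ℝ] R3) (π : R3 →L[ℝ] R2), (∀ q, inner ℝ (j q) n = 0) ∧ (∀ q, π (j q) = q) ∧
      ∀ v, v = j (π v) + inner ℝ v n • n := by
  have hn0 : n ≠ 0 := by rintro rfl; simp at hn
  have : Fact (Module.finrank ℝ R3 = 2 + 1) := ⟨by simp⟩
  set e := (OrthonormalBasis.fromOrthogonalSpanSingleton (𝕜 := ℝ) 2 hn0).repr
  refine ⟨(ℝ ∙ n)ᗮ.subtypeₗᵢ.comp e.symm.toLinearIsometry,
    (e.toContinuousLinearEquiv : _ →L[ℝ] R2) ∘L (ℝ ∙ n)ᗮ.orthogonalProjectionOnto, ?_, ?_, ?_⟩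
  · intro q
    have := (e.symm q).2
    rw [Submodule.mem_orthogonal_singleton_iff_inner_left] at this
    simpa using this
  · intro q
    simp
  · intro v
    have h1 := Submodule.starProjection_add_starProjection_orthogonal (K := ℝ ∙ n) v
    rw [Submodule.starProjection_unit_singleton ℝ hn] at h1
    conv_lhs => rw [← h1]
    simp [real_inner_comm, add_comm]

/-- The Jacobian of normal coordinates on the surface is the area density of the surface. -/
theorem abs_det_eq_normDet {L : R2 →L[ℝ] R3} {n : R3} (hn : ‖n‖ = 1)
    (hL : ∀ q, inner ℝ (L q) n = 0) {T : (R2 × ℝ) →L[ℝ] R3} (hT : ∀ q s, T (q, s) = L q + s • n) :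
    |((prodEquiv.symm : R3 →L[ℝ] R2 × ℝ) ∘L T).det| = LinearMap.normDet (L : R2 →ₗ[ℝ] R3) := by
  obtain ⟨j, π, hj, hπj, hdec⟩ := exists_linearIsometry_orthogonal hn
  set M : R2 →ₗ[ℝ] R2 := (π : R3 →ₗ[ℝ] R2) ∘ₗ (L : R2 →ₗ[ℝ] R3)
  have hjM : ∀ q, j (M q) = L q := fun q => by
    have := hdec (L q)
    rw [hL q, zero_smul, add_zero] at this
    exact this.symm
  have h1 : LinearMap.normDet (L : R2 →ₗ[ℝ] R3) = |LinearMap.det M| := by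
    have : (L : R2 →ₗ[ℝ] R3) = j.toLinearMap ∘ₗ M := by
      ext1 q
      exact (hjM q).symm
    rw [this, LinearMap.normDet_comp_of_finrank_eq _ _ rfl, j.normDet_eq_one, one_mul,
      LinearMap.normDet_eq_abs_det]
  -- The unit normal completes the isometry j of the plane to an isometry (q, s) ↦ j q + s n. It
  -- contributes determinant ±1, and T differs from it only by the block map M × id.
  let Q : WithLp 2 (R2 × ℝ) →ₗᵢ[ℝ] R3 :=
    { toLinearMap := (j.toLinearMap ∘ₗ LinearMap.fst ℝ R2 ℝ
        + (LinearMap.snd ℝ R2 ℝ).smulRight n) ∘ₗ (WithLp.linearEquiv 2 ℝ (R2 × ℝ)).toLinearMap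
      norm_map' := by
        intro x
        have h2 : ‖j x.fst + x.snd • n‖ ^ 2 = ‖x‖ ^ 2 := by
          rw [norm_add_sq_real, inner_smul_right, hj, WithLp.prod_norm_sq_eq_of_L2, norm_smul, hn]
          simp
        exact (sq_eq_sq₀ (norm_nonneg _) (norm_nonneg _)).1 h2 }
  set S : WithLp 2 (R2 × ℝ) →ₗ[ℝ] WithLp 2 (R2 × ℝ) :=
    (prodIsometry.symm.toLinearIsometry.comp Q).toLinearMap
  have hS : |LinearMap.det S| = 1 := by
    rw [← LinearMap.normDet_eq_abs_det]
    exact LinearIsometry.normDet_eq_one _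
  set c := WithLp.linearEquiv 2 ℝ (R2 × ℝ)
  have hcomp : (((prodEquiv.symm : R3 →L[ℝ] R2 × ℝ) ∘L T : (R2 × ℝ) →L[ℝ] R2 × ℝ) :
      (R2 × ℝ) →ₗ[ℝ] R2 × ℝ) =
      (c.toLinearMap ∘ₗ S ∘ₗ c.symm.toLinearMap) ∘ₗ LinearMap.prodMap M LinearMap.id := by
    refine LinearMap.ext fun ⟨q, s⟩ => ?_
    have h3 : T (q, s) = j (M q) + s • n := by rw [hT, hjM]
    change prodEquiv.symm (T (q, s)) = _
    rw [h3]
    rfl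
  rw [ContinuousLinearMap.det, hcomp, LinearMap.det_comp, LinearMap.det_conj, LinearMap.det_prodMap,
    LinearMap.det_id, mul_one, abs_mul, hS, one_mul, h1]

/-! ### Inverse functions and level surfaces -/

theorem exists_continuousLinearEquiv_of_injective {E F : Type*} [NormedAddCommGroup E]
    [NormedSpace ℝ E] [FiniteDimensional ℝ E] [NormedAddCommGroup F] [NormedSpace ℝ F]
    [FiniteDimensional ℝ F] (h : Module.finrank ℝ E = Module.finrank ℝ F) (L : E →L[ℝ] F)
    (hL : ∀ v, L v = 0 → v = 0) : ∃ e : E ≃L[ℝ] F, (e : E →L[ℝ] F) = L := by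
  have hinj : Function.Injective (L : E →ₗ[ℝ] F) :=
    (injective_iff_map_eq_zero (L : E →ₗ[ℝ] F)).2 hL
  refine ⟨(LinearMap.linearEquivOfInjective (L : E →ₗ[ℝ] F) hinj h).toContinuousLinearEquiv, ?_⟩
  ext v
  rfl

/-- The inverse function theorem, with smoothness of the inverse on a whole neighborhood. -/
theorem exists_openPartialHomeomorph_of_contDiffOn {E F : Type*} [NormedAddCommGroup E]
    [NormedSpace ℝ E] [CompleteSpace E] [NormedAddCommGroup F] [NormedSpace ℝ F]
    {Θ : E → F} {O : Set E} {a : E} (hO : IsOpen O) (ha : a ∈ O) (hΘ : ContDiffOn ℝ ∞ Θ O)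
    {e : E ≃L[ℝ] F} (he : HasFDerivAt Θ (e : E →L[ℝ] F) a) :
    ∃ ψ : OpenPartialHomeomorph E F, (∀ x, ψ x = Θ x) ∧ a ∈ ψ.source ∧ ψ.source ⊆ O ∧
      (∀ x ∈ ψ.source, ∃ e : E ≃L[ℝ] F, HasFDerivAt Θ (e : E →L[ℝ] F) x) ∧
      ∀ y ∈ ψ.target, ContDiffAt ℝ ∞ ψ.symm y := by
  have hat : ∀ x ∈ O, ContDiffAt ℝ ∞ Θ x := fun x hx => hΘ.contDiffAt (hO.mem_nhds hx)
  -- Invertible maps form an open set, so the source can be shrunk to points with invertible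
  -- derivative; this makes the local inverse smooth at every point of the target, not only at one.
  have hS : IsOpen (O ∩ fderiv ℝ Θ ⁻¹' range ((↑) : (E ≃L[ℝ] F) → E →L[ℝ] F)) :=
    (hΘ.continuousOn_fderiv_of_isOpen hO (by simp)).isOpen_inter_preimage hO
      ContinuousLinearEquiv.isOpen
  set S := O ∩ fderiv ℝ Θ ⁻¹' range ((↑) : (E ≃L[ℝ] F) → E →L[ℝ] F)
  set ψ₀ := (hat a ha).toOpenPartialHomeomorph Θ he (by simp)
  have hψ₀ : ∀ x, ψ₀ x = Θ x := fun x => rfl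
  have hder : ∀ x ∈ S, ∃ e : E ≃L[ℝ] F, HasFDerivAt Θ (e : E →L[ℝ] F) x := by
    rintro x ⟨hx, e, hxe⟩
    refine ⟨e, ?_⟩
    rw [hxe]
    exact ((hat x hx).differentiableAt (by simp)).hasFDerivAt
  refine ⟨ψ₀.restrOpen S hS, fun x => rfl, ?_, ?_, ?_, ?_⟩
  · rw [OpenPartialHomeomorph.restrOpen_source]
    exact ⟨(hat a ha).mem_toOpenPartialHomeomorph_source he _, ha, e, he.fderiv.symm⟩
  · rw [OpenPartialHomeomorph.restrOpen_source]
    exact fun x hx => hx.2.1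
  · rw [OpenPartialHomeomorph.restrOpen_source]
    exact fun x hx => hder x hx.2
  · intro y hy
    have hx := (ψ₀.restrOpen S hS).map_target hy
    rw [OpenPartialHomeomorph.restrOpen_source] at hx
    obtain ⟨e', he'⟩ := hder _ hx.2
    exact (ψ₀.restrOpen S hS).contDiffAt_symm hy he' (hat _ hx.2.1)

/-- The gradient of a smooth function, in coordinates. -/
noncomputable def gradVec (ρ : R3 → ℝ) (y : R3) : R3 :=
  WithLp.toLp 2 fun i => fderiv ℝ ρ y (EuclideanSpace.single i 1)

theorem inner_gradVec (ρ : R3 → ℝ) (y v : R3) : inner ℝ (gradVec ρ y) v = fderiv ℝ ρ y v := by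
  rw [clm_apply_eq_sum, PiLp.inner_apply]
  simp [gradVec, mul_comm]

theorem contDiffOn_gradVec {ρ : R3 → ℝ} {V : Set R3} (hV : IsOpen V) (hρ : ContDiffOn ℝ ∞ ρ V) :
    ContDiffOn ℝ ∞ (gradVec ρ) V := by
  rw [contDiffOn_euclidean]
  intro i
  exact (hρ.fderiv_of_isOpen hV (by simp)).clm_apply contDiffOn_const

theorem gradVec_ne_zero {ρ : R3 → ℝ} {y : R3} (h : fderiv ℝ ρ y ≠ 0) : gradVec ρ y ≠ 0 := by
  intro h0
  apply h
  ext v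
  rw [← inner_gradVec, h0, inner_zero_left]
  rfl

/-- A regular level set is locally a parametrized surface with a unit normal field. -/
theorem exists_surface_parametrization {V : Set R3} (hV : IsOpen V) {ρ : R3 → ℝ}
    (hρ : ContDiffOn ℝ ∞ ρ V) (hρ' : ∀ y ∈ V, fderiv ℝ ρ y ≠ 0) {a : R3} (ha : a ∈ V)
    (hρa : ρ a = 0) :
    ∃ (B : Set R2) (f N : R2 → R3) (π : R3 →L[ℝ] R2), IsOpen B ∧ π a ∈ B ∧ f (π a) = a ∧
      Measurable f ∧ Measurable N ∧ (∀ p, ‖N p‖ ≤ 1) ∧ ContDiffOn ℝ ∞ f B ∧ ContDiffOn ℝ ∞ N B ∧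
      ∀ p ∈ B, f p ∈ V ∧ ρ (f p) = 0 ∧ π (f p) = p ∧ ‖N p‖ = 1 ∧
        ∃ c : ℝ, 0 < c ∧ gradVec ρ (f p) = c • N p := by
  classical
  set ν : R3 → R3 := fun y => ‖gradVec ρ y‖⁻¹ • gradVec ρ y
  have hg0 : ∀ y ∈ V, ‖gradVec ρ y‖ ≠ 0 := fun y hy => norm_ne_zero_iff.2 (gradVec_ne_zero (hρ' y hy))
  have hν : ContDiffOn ℝ ∞ ν V := by
    have h1 := contDiffOn_gradVec hV hρ
    exact ((h1.norm ℝ fun y hy => gradVec_ne_zero (hρ' y hy)).inv hg0).smul h1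
  have hν1 : ∀ y ∈ V, ‖ν y‖ = 1 := fun y hy => by
    simp only [ν, norm_smul, norm_inv, norm_norm]
    exact inv_mul_cancel₀ (hg0 y hy)
  have hνg : ∀ y ∈ V, gradVec ρ y = ‖gradVec ρ y‖ • ν y := fun y hy => by
    simp only [ν]
    rw [smul_inv_smul₀ (hg0 y hy)]
  obtain ⟨j, π, hj, hπj, hdec⟩ := exists_linearIsometry_orthogonal (hν1 a ha)
  -- Tangential projection together with ρ straightens the level set. A vector in the kernel of the
  -- derivative at a has no tangential part and is orthogonal to the normal, hence is zero.
  set Θ : R3 → R2 × ℝ := fun y => (π y, ρ y)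
  have hΘ : ContDiffOn ℝ ∞ Θ V := π.contDiff.contDiffOn.prodMk hρ
  have hρd : HasFDerivAt ρ (fderiv ℝ ρ a) a :=
    ((hρ.contDiffAt (hV.mem_nhds ha)).differentiableAt (by simp)).hasFDerivAt
  have hΘd : HasFDerivAt Θ (π.prod (fderiv ℝ ρ a)) a := π.hasFDerivAt.prodMk hρd
  obtain ⟨e, he⟩ := exists_continuousLinearEquiv_of_injective (by simp) (π.prod (fderiv ℝ ρ a))
    (fun v hv => by
      obtain ⟨h1, h2⟩ := Prod.mk_inj.1 (show (π v, fderiv ℝ ρ a v) = (0, 0) from hv)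
      rw [← inner_gradVec, hνg a ha, inner_smul_left, real_inner_comm] at h2
      have h3 : inner ℝ v (ν a) = 0 := by
        rcases mul_eq_zero.1 h2 with h | h
        · exact absurd (by simpa using h) (hg0 a ha)
        · exact h
      rw [hdec v, h1, h3]
      simp)
  rw [← he] at hΘd
  obtain ⟨ψ, hψ, haψ, hψV, -, hψs⟩ := exists_openPartialHomeomorph_of_contDiffOn hV ha hΘ hΘd
  set B : Set R2 := (fun p => ((p, 0) : R2 × ℝ)) ⁻¹' ψ.target
  have hB : IsOpen B := ψ.open_target.preimage (by fun_prop)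
  have hΘa : Θ a = (π a, 0) := by simp [Θ, hρa]
  have haB : π a ∈ B := by
    change (π a, 0) ∈ ψ.target
    rw [← hΘa, ← hψ]
    exact ψ.map_source haψ
  set f₀ : R2 → R3 := fun p => ψ.symm (p, 0)
  have hf₀V : ∀ p ∈ B, f₀ p ∈ V := fun p hp => hψV (ψ.map_target hp)
  have hf₀ : ContDiffOn ℝ ∞ f₀ B := fun p hp => by
    have h1 : ContDiffAt ℝ ∞ (fun p : R2 => ((p, 0) : R2 × ℝ)) p :=
      contDiffAt_id.prodMk contDiffAt_const
    exact (ContDiffAt.comp p (hψs _ hp) h1).contDiffWithinAt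
  have hΘf : ∀ p ∈ B, Θ (f₀ p) = (p, 0) := fun p hp => by rw [← hψ]; exact ψ.right_inv hp
  have hN₀ : ContDiffOn ℝ ∞ (fun p => ν (f₀ p)) B := hν.comp hf₀ hf₀V
  -- Extension by zero makes f and N measurable on the whole plane and keeps ‖N‖ ≤ 1 there, as the
  -- lemma on lines requires.
  have hfi : ∀ p ∈ B, B.indicator f₀ p = f₀ p := fun p hp => indicator_of_mem hp _
  have hNi : ∀ p ∈ B, B.indicator (fun p => ν (f₀ p)) p = ν (f₀ p) := fun p hp =>
    indicator_of_mem hp _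
  have hmeas : ∀ {k : R2 → R3}, ContinuousOn k B → Measurable (B.indicator k) := fun {k} hk => by
    rw [← piecewise_eq_indicator]
    exact hk.measurable_piecewise continuousOn_const hB.measurableSet
  refine ⟨B, B.indicator f₀, B.indicator fun p => ν (f₀ p), π, hB, haB, ?_,
    hmeas hf₀.continuousOn, hmeas hN₀.continuousOn, fun p => ?_, hf₀.congr hfi, hN₀.congr hNi,
    fun p hp => ?_⟩
  · rw [hfi _ haB]
    change ψ.symm (π a, 0) = a
    rw [← hΘa, ← hψ, ψ.left_inv haψ]
  · by_cases hp : p ∈ B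
    · rw [hNi p hp, hν1 _ (hf₀V p hp)]
    · rw [indicator_of_notMem hp]
      simp
  · rw [hfi p hp, hNi p hp]
    obtain ⟨h1, h2⟩ := Prod.mk_inj.1 (hΘf p hp)
    exact ⟨hf₀V p hp, h2, h1, hν1 _ (hf₀V p hp), ‖gradVec ρ (f₀ p)‖, norm_pos_iff.2
      (gradVec_ne_zero (hρ' _ (hf₀V p hp))), hνg _ (hf₀V p hp)⟩

/-- Change of variables for maps from normal coordinates to the ambient space. -/
theorem map_withDensity_abs_det_prodEquiv {Φ : R2 × ℝ → R3} {Φ' : R2 × ℝ → (R2 × ℝ) →L[ℝ] R3}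
    {S : Set (R2 × ℝ)} (hS : MeasurableSet S) (hΦ : Measurable Φ)
    (hΦ' : ∀ q ∈ S, HasFDerivAt Φ (Φ' q) q) (hinj : InjOn Φ S) :
    Measure.map Φ ((volume.restrict S).withDensity fun q =>
      ENNReal.ofReal |((prodEquiv.symm : R3 →L[ℝ] R2 × ℝ) ∘L Φ' q).det|)
      = volume.restrict (Φ '' S) := by
  have : (volume : Measure (R2 × ℝ)).IsAddHaarMeasure := by
    rw [Measure.volume_eq_prod]
    infer_instance
  -- The change of variables concerns maps of one space to itself; the volume preserving `prodEquiv`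
  -- brings the target back to the coordinate space.
  have h1 := map_withDensity_abs_det_fderiv_eq_addHaar (volume : Measure (R2 × ℝ))
    (f := fun q => prodEquiv.symm (Φ q))
    (f' := fun q => (prodEquiv.symm : R3 →L[ℝ] R2 × ℝ) ∘L Φ' q) hS.nullMeasurableSet
    (fun q hq => ((prodEquiv.symm : R3 →L[ℝ] R2 × ℝ).hasFDerivAt.comp q
      (hΦ' q hq)).hasFDerivWithinAt)
    (fun x hx y hy hxy => hinj hx hy (prodEquiv.symm.injective hxy))
  have hm : Measurable fun q => prodEquiv.symm (Φ q) :=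
    prodEquiv.symm.continuous.measurable.comp hΦ
  have h2 : Measure.map prodEquiv (volume.restrict ((fun q => prodEquiv.symm (Φ q)) '' S))
      = volume.restrict (Φ '' S) := by
    have h3 := (measurePreserving_prodEquiv.restrict_preimage_emb
      prodEquiv.toHomeomorph.measurableEmbedding (Φ '' S)).map_eq
    rwa [show prodEquiv ⁻¹' (Φ '' S) = (fun q => prodEquiv.symm (Φ q)) '' S by
      rw [← ContinuousLinearEquiv.image_symm_eq_preimage, image_image]] at h3
  rw [← h2, ← h1, Measure.map_map prodEquiv.continuous.measurable hm]
  congr 1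
  ext1 q
  simp

/-! ### Normal coordinate charts at the boundary -/

/-- Normal coordinates near a point of a smooth boundary: `(p, t) ↦ f p + t • N p`, where `f`
parametrizes the boundary and `N` is the outer unit normal. -/
structure BoundaryChart (E : Set R3) where
  f : R2 → R3
  N : R2 → R3
  A : Set R2
  τ : ℝ
  J : R2 × ℝ → ℝ
  d : R3 → ℝ
  π : R3 → R2
  isOpen_A : IsOpen A
  τ_pos : 0 < τ
  measurable_f : Measurable f
  measurable_N : Measurable N
  measurable_π : Measurable π
  π_f : ∀ p ∈ A, π (f p) = p
  norm_N_le : ∀ p, ‖N p‖ ≤ 1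
  isOpen_image : IsOpen ((fun q : R2 × ℝ => f q.1 + q.2 • N q.1) '' (A ×ˢ Ioo (-τ) τ))
  mem_frontier_iff : ∀ p ∈ A, ∀ t ∈ Ioo (-τ) τ, f p + t • N p ∈ frontier E ↔ t = 0
  -- A segment that avoids t = 0 must stay in a compact set off ∂E, since the derivatives of the
  -- gradient are controlled only there.
  exists_isCompact : ∀ a b, -τ ≤ a → b ≤ τ → ∃ K : Set R3, IsCompact K ∧
    (∀ p ∈ A, ∀ t ∈ Icc a b, f p + t • N p ∈ K) ∧ (0 ∉ Icc a b → K ⊆ (frontier E)ᶜ)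
  continuousOn_J : ContinuousOn J (A ×ˢ Ioo (-τ) τ)
  exists_bounds_J : ∃ c C : ℝ, 0 < c ∧ ∀ q ∈ A ×ˢ Ioo (-τ) τ, c ≤ J q ∧ J q ≤ C
  map_eq : Measure.map (fun q : R2 × ℝ => f q.1 + q.2 • N q.1)
    ((volume.restrict (A ×ˢ Ioo (-τ) τ)).withDensity fun q => ENNReal.ofReal (J q))
      = volume.restrict ((fun q : R2 × ℝ => f q.1 + q.2 • N q.1) '' (A ×ˢ Ioo (-τ) τ))
  d_apply : ∀ p ∈ A, ∀ t ∈ Ioo (-τ) τ, d (f p + t • N p) = t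
  contDiffAt_d : ∀ p ∈ A, ∀ t ∈ Ioo (-τ) τ, ContDiffAt ℝ ∞ d (f p + t • N p)
  fderiv_d : ∀ p ∈ A, ∀ t ∈ Ioo (-τ) τ, ∀ i,
    fderiv ℝ d (f p + t • N p) (EuclideanSpace.single i 1) = N p i
  surface_eq : (surfaceMeasure E).restrict
      ((fun q : R2 × ℝ => f q.1 + q.2 • N q.1) '' (A ×ˢ Ioo (-τ) τ))
    = Measure.map f ((volume.restrict A).withDensity fun p => ENNReal.ofReal (J (p, 0)))
  outerNormal_eq : ∀ p ∈ A, ∀ n, IsOuterNormal E (f p) n → n = N p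
  innerNormal_eq : ∀ p ∈ A, ∀ n, IsInnerNormal E (f p) n → n = -N p

/-- A unit orthogonal vector of a parametrized surface is orthogonal to the tangent plane. -/
theorem IsUnitOrthogonal.inner_fderiv_eq_zero {S : Set R3} {f : R2 → R3} {L : R2 →L[ℝ] R3}
    {p : R2} {n : R3} (h : IsUnitOrthogonal S (f p) n) (hf : HasFDerivAt f L p)
    (hS : ∀ᶠ q in 𝓝 p, f q ∈ S) (q : R2) : inner ℝ (L q) n = 0 := by
  have h1 : (fun y => inner ℝ (y - f p) n) =o[𝓝[S \ {f p}] (f p)] fun y => ‖y - f p‖ := by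
    refine (Asymptotics.isLittleO_iff_tendsto' ?_).2 h.2
    filter_upwards [self_mem_nhdsWithin] with y hy h0
    exact absurd (sub_eq_zero.1 (norm_eq_zero.1 h0)) hy.2
  have h2 : (fun y => inner ℝ (y - f p) n) =o[𝓝[S] (f p)] fun y => ‖y - f p‖ := by
    refine (h1.insert (by simp)).mono (nhdsWithin_mono _ ?_)
    intro y hy
    by_cases h : y = f p
    · exact Or.inl h
    · exact Or.inr ⟨hy, h⟩
  have h3 : Tendsto f (𝓝 p) (𝓝[S] (f p)) :=
    tendsto_nhdsWithin_iff.2 ⟨hf.continuousAt, hS⟩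
  have h4 := (h2.comp_tendsto h3).trans_isBigO (hf.isBigO_sub.norm_left)
  have h5 : HasFDerivAt (fun q => inner ℝ (f q) n) (0 : R2 →L[ℝ] ℝ) p := by
    refine HasFDerivAt.of_isLittleO ?_
    refine h4.congr_left fun q => ?_
    simp [inner_sub_left]
  have h6 : HasFDerivAt (fun q => inner ℝ (f q) n) ((innerSL ℝ n).comp L) p := by
    have := (innerSL ℝ n).hasFDerivAt.comp p hf
    refine this.congr_of_eventuallyEq (Eventually.of_forall fun q => ?_)
    simp [real_inner_comm]
  have h7 := congrArg (fun M : R2 →L[ℝ] ℝ => M q) (h6.unique h5)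
  simpa [real_inner_comm] using h7

-- The normal N is orthogonal to the tangent vectors Df q and, having unit length, to its own
-- derivatives DN q. Hence the inner product of DΦ(q, s) with N is s. This makes DΦ invertible at t
-- = 0 and identifies the gradient of the coordinate t with N. The sign of ρ along the normals then
-- locates E.
set_option maxHeartbeats 1000000 in
theorem exists_boundaryChart {E : Set R3} (hE : IsCompact E) (hEs : HasSmoothBoundary E) {a : R3}
    (ha : a ∈ frontier E) : ∃ c : BoundaryChart E,
      a ∈ (fun q : R2 × ℝ => c.f q.1 + q.2 • c.N q.1) '' (c.A ×ˢ Ioo (-c.τ) c.τ) := by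
  obtain ⟨V, hV, haV, ρ, hρ, hρ', hEρ⟩ := hEs a ha
  have hρc : ContinuousOn ρ V := hρ.continuousOn
  have hfr0 : ∀ y ∈ V, y ∈ frontier E → ρ y = 0 := by
    intro y hy hyE
    have hyE' : y ∈ E := hE.isClosed.frontier_subset hyE
    by_contra h0
    have hlt : ρ y < 0 := lt_of_le_of_ne ((hEρ y hy).1 hyE') h0
    have hn : ∀ᶠ z in 𝓝 y, z ∈ E := by
      filter_upwards [hV.mem_nhds hy, (hρc.continuousAt (hV.mem_nhds hy)).eventually_lt_const hlt]
        with z hz hz'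
      exact (hEρ z hz).2 hz'.le
    exact hyE.2 (mem_interior_iff_mem_nhds.2 hn)
  obtain ⟨B, f, N, π, hB, haB, hfa, hfm, hNm, hN1, hf, hN, hBp⟩ :=
    exists_surface_parametrization hV hρ hρ' haV (hfr0 a haV ha)
  set Φ : R2 × ℝ → R3 := fun q => f q.1 + q.2 • N q.1 with hΦdef
  have hΦm : Measurable Φ := by fun_prop
  have hfst : MapsTo Prod.fst (B ×ˢ (univ : Set ℝ)) B := fun q hq => hq.1
  have hΦs : ContDiffOn ℝ ∞ Φ (B ×ˢ univ) :=
    (hf.comp contDiff_fst.contDiffOn hfst).add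
      (contDiff_snd.contDiffOn.smul (hN.comp contDiff_fst.contDiffOn hfst))
  have hBu : IsOpen (B ×ˢ (univ : Set ℝ)) := hB.prod isOpen_univ
  have hfd : ∀ p ∈ B, HasFDerivAt f (fderiv ℝ f p) p := fun p hp =>
    ((hf.contDiffAt (hB.mem_nhds hp)).differentiableAt (by simp)).hasFDerivAt
  have hNd : ∀ p ∈ B, HasFDerivAt N (fderiv ℝ N p) p := fun p hp =>
    ((hN.contDiffAt (hB.mem_nhds hp)).differentiableAt (by simp)).hasFDerivAt
  -- the differential of the normal coordinates
  have hΦd : ∀ p ∈ B, ∀ t, HasFDerivAt Φ (fderiv ℝ Φ (p, t)) (p, t) := fun p hp t =>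
    ((hΦs.contDiffAt (hBu.mem_nhds ⟨hp, mem_univ t⟩)).differentiableAt (by simp)).hasFDerivAt
  have hΦ' : ∀ p ∈ B, ∀ t q s, fderiv ℝ Φ (p, t) (q, s)
      = fderiv ℝ f p q + t • fderiv ℝ N p q + s • N p := by
    intro p hp t q s
    have h1 : HasFDerivAt (fun x : R2 × ℝ => f x.1) ((fderiv ℝ f p).comp
      (ContinuousLinearMap.fst ℝ R2 ℝ)) (p, t) := (hfd p hp).comp (p, t) hasFDerivAt_fst
    have h2 : HasFDerivAt (fun x : R2 × ℝ => N x.1) ((fderiv ℝ N p).comp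
      (ContinuousLinearMap.fst ℝ R2 ℝ)) (p, t) := (hNd p hp).comp (p, t) hasFDerivAt_fst
    have h3 : HasFDerivAt Φ _ (p, t) := h1.add (hasFDerivAt_snd.smul h2)
    rw [h3.fderiv]
    simp [add_assoc]
  have hgN : ∀ p ∈ B, ∀ q, inner ℝ (fderiv ℝ f p q) (N p) = 0 := by
    intro p hp q
    obtain ⟨c, hc, hgc⟩ := (hBp p hp).2.2.2.2
    have h1 : HasFDerivAt (fun x => ρ (f x)) ((fderiv ℝ ρ (f p)).comp (fderiv ℝ f p)) p :=
      HasFDerivAt.comp p ((hρ.contDiffAt (hV.mem_nhds (hBp p hp).1)).differentiableAt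
        (by simp)).hasFDerivAt (hfd p hp)
    have h2 : HasFDerivAt (fun x => ρ (f x)) (0 : R2 →L[ℝ] ℝ) p := by
      refine (hasFDerivAt_const (0 : ℝ) p).congr_of_eventuallyEq ?_
      filter_upwards [hB.mem_nhds hp] with x hx using (hBp x hx).2.1
    have h3 := congrArg (fun M : R2 →L[ℝ] ℝ => M q) (h1.unique h2)
    simp only [ContinuousLinearMap.comp_apply, zero_apply] at h3
    rw [← inner_gradVec, hgc, inner_smul_left, real_inner_comm] at h3
    rcases mul_eq_zero.1 h3 with h | h
    · exact absurd (by simpa using h) hc.ne'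
    · exact h
  have hNN : ∀ p ∈ B, ∀ q, inner ℝ (fderiv ℝ N p q) (N p) = 0 := by
    intro p hp q
    have h1 := (hNd p hp).inner ℝ (hNd p hp)
    have h2 : HasFDerivAt (fun x => inner ℝ (N x) (N x)) (0 : R2 →L[ℝ] ℝ) p := by
      refine (hasFDerivAt_const (1 : ℝ) p).congr_of_eventuallyEq ?_
      filter_upwards [hB.mem_nhds hp] with x hx
      rw [real_inner_self_eq_norm_sq, (hBp x hx).2.2.2.1, one_pow]
    have h3 := congrArg (fun M : R2 →L[ℝ] ℝ => M q) (h1.unique h2)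
    simp [real_inner_comm] at h3
    rw [real_inner_comm] at h3
    exact h3
  have hTN : ∀ p ∈ B, ∀ t q s, inner ℝ (fderiv ℝ Φ (p, t) (q, s)) (N p) = s := by
    intro p hp t q s
    rw [hΦ' p hp, inner_add_left, inner_add_left, inner_smul_left, inner_smul_left, hgN p hp,
      hNN p hp, real_inner_self_eq_norm_sq, (hBp p hp).2.2.2.1]
    simp
  have hπf : ∀ p ∈ B, ∀ q, π (fderiv ℝ f p q) = q := by
    intro p hp q
    have h1 : HasFDerivAt (fun x => π (f x)) (π.comp (fderiv ℝ f p)) p :=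
      π.hasFDerivAt.comp p (hfd p hp)
    have h2 : HasFDerivAt (fun x => π (f x)) (ContinuousLinearMap.id ℝ R2) p := by
      refine (hasFDerivAt_id p).congr_of_eventuallyEq ?_
      filter_upwards [hB.mem_nhds hp] with x hx using (hBp x hx).2.2.1
    exact congrArg (fun M : R2 →L[ℝ] R2 => M q) (h1.unique h2)
  -- inverse function theorem for the normal coordinates
  set p₀ := π a with hp₀
  set O₁ := (B ×ˢ (univ : Set ℝ)) ∩ Φ ⁻¹' V
  have hO₁ : IsOpen O₁ := hΦs.continuousOn.isOpen_inter_preimage hBu hV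
  -- On this set ρ increases strictly along normals, so that E becomes {t ≤ 0}.
  set O := O₁ ∩ (fun q : R2 × ℝ => fderiv ℝ ρ (Φ q) (N q.1)) ⁻¹' Ioi 0
  have hk : ContinuousOn (fun q : R2 × ℝ => fderiv ℝ ρ (Φ q) (N q.1)) O₁ := by
    have h1 : ContinuousOn (fun q : R2 × ℝ => fderiv ℝ ρ (Φ q)) O₁ :=
      (hρ.continuousOn_fderiv_of_isOpen hV (by simp)).comp (hΦs.continuousOn.mono inter_subset_left)
        fun q hq => hq.2
    exact h1.clm_apply (hN.continuousOn.comp continuousOn_fst fun q hq => hq.1.1)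
  have hO : IsOpen O := hk.isOpen_inter_preimage hO₁ isOpen_Ioi
  have hΦ0 : ∀ p, Φ (p, 0) = f p := fun p => by simp [Φ]
  have hp₀O : (p₀, (0 : ℝ)) ∈ O := by
    refine ⟨⟨⟨haB, mem_univ _⟩, ?_⟩, ?_⟩
    · rw [mem_preimage, hΦ0, hfa]
      exact haV
    · obtain ⟨c, hc, hgc⟩ := (hBp p₀ haB).2.2.2.2
      rw [mem_preimage, hΦ0, mem_Ioi, ← inner_gradVec, hgc, inner_smul_left,
        real_inner_self_eq_norm_sq, (hBp p₀ haB).2.2.2.1]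
      simpa using hc
  obtain ⟨e, he⟩ := exists_continuousLinearEquiv_of_injective (by simp) (fderiv ℝ Φ (p₀, 0))
    (by
      rintro ⟨q, s⟩ h0
      have hs : s = 0 := by rw [← hTN p₀ haB 0 q s, h0, inner_zero_left]
      subst hs
      rw [hΦ' p₀ haB, zero_smul, zero_smul, add_zero, add_zero] at h0
      have := hπf p₀ haB q
      rw [h0, map_zero] at this
      rw [← this]
      rfl)
  have hΦd0 := hΦd p₀ haB 0
  rw [← he] at hΦd0
  obtain ⟨ψ, hψ, hψp₀, hψO, hψe, hψs⟩ := exists_openPartialHomeomorph_of_contDiffOn hO hp₀O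
    (hΦs.mono fun q hq => hq.1.1) hΦd0
  -- A closed box inside the domain is kept: its compactness gives the bounds on J and the compact
  -- images of segments.
  obtain ⟨r, hr, hball⟩ := Metric.nhds_basis_closedBall.mem_iff.1 (ψ.open_source.mem_nhds hψp₀)
  set A := Metric.ball p₀ r
  have hcl : Metric.closedBall p₀ r ×ˢ Icc (-r) r ⊆ ψ.source := by
    refine Subset.trans ?_ hball
    rw [← closedBall_prod_same, Real.closedBall_eq_Icc, zero_sub, zero_add]
  have hAB : Metric.closedBall p₀ r ⊆ B := fun p hp =>
    (hψO (hcl (mk_mem_prod hp (show (0 : ℝ) ∈ Icc (-r) r from ⟨by linarith, hr.le⟩)))).1.1.1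
  have hAcl : A ⊆ Metric.closedBall p₀ r := Metric.ball_subset_closedBall
  have hAB' : A ⊆ B := hAcl.trans hAB
  set D := A ×ˢ Ioo (-r) r
  have hDcl : D ⊆ Metric.closedBall p₀ r ×ˢ Icc (-r) r := prod_mono hAcl Ioo_subset_Icc_self
  have hDsrc : D ⊆ ψ.source := hDcl.trans hcl
  have hDopen : IsOpen D := Metric.isOpen_ball.prod isOpen_Ioo
  have hΦinj : InjOn Φ ψ.source := fun x hx y hy hxy => ψ.injOn hx hy (by rwa [hψ, hψ])
  -- the sign of the defining function
  have hsign : ∀ p ∈ Metric.closedBall p₀ r, StrictMonoOn (fun t => ρ (Φ (p, t))) (Icc (-r) r) := by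
    intro p hp
    have hder : ∀ t ∈ Icc (-r) r, HasDerivAt (fun t => ρ (Φ (p, t)))
        (fderiv ℝ ρ (Φ (p, t)) (N p)) t := by
      intro t ht
      have hq := (hψO (hcl (mk_mem_prod hp ht))).1.2
      have h1 : HasDerivAt (fun s : ℝ => Φ (p, s)) (N p) t :=
        (((hasDerivAt_id t).smul_const (N p)).const_add (f p)).congr_deriv (one_smul _ _)
      exact ((hρ.contDiffAt (hV.mem_nhds hq)).differentiableAt
        (by simp)).hasFDerivAt.comp_hasDerivAt t h1
    refine strictMonoOn_of_deriv_pos (convex_Icc _ _)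
      (fun t ht => (hder t ht).continuousAt.continuousWithinAt) fun t ht => ?_
    rw [interior_Icc] at ht
    rw [(hder t (Ioo_subset_Icc_self ht)).deriv]
    exact (hψO (hcl (mk_mem_prod hp (Ioo_subset_Icc_self ht)))).2
  have h0mem : (0 : ℝ) ∈ Icc (-r) r := ⟨by linarith, hr.le⟩
  have hρ0 : ∀ p ∈ B, ρ (Φ (p, 0)) = 0 := fun p hp => by rw [hΦ0]; exact (hBp p hp).2.1
  have hin : ∀ p ∈ Metric.closedBall p₀ r, ∀ t ∈ Icc (-r) r, Φ (p, t) ∈ E ↔ t ≤ 0 := by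
    intro p hp t ht
    rw [hEρ _ (hψO (hcl (mk_mem_prod hp ht))).1.2]
    have h1 := (hsign p hp).le_iff_le ht h0mem
    simp only [hρ0 p (hAB hp)] at h1
    exact h1
  have hnotfr : ∀ p ∈ Metric.closedBall p₀ r, ∀ t ∈ Icc (-r) r, t ≠ 0 → Φ (p, t) ∉ frontier E := by
    intro p hp t ht ht0 hfr
    have h1 := hfr0 _ (hψO (hcl (mk_mem_prod hp ht))).1.2 hfr
    rw [← hρ0 p (hAB hp)] at h1
    exact ht0 ((hsign p hp).injOn ht h0mem h1)
  have hfr : ∀ p ∈ A, f p ∈ frontier E := by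
    intro p hp
    refine ⟨subset_closure ?_, fun hint => ?_⟩
    · rw [← hΦ0]
      exact (hin p (hAcl hp) 0 h0mem).2 le_rfl
    -- Points with small t > 0 are outside E and tend to f p.
    · have h1 : Tendsto (fun t : ℝ => Φ (p, t)) (𝓝[>] 0) (𝓝 (f p)) := by
        have : Continuous fun t : ℝ => Φ (p, t) :=
          Continuous.add (f := fun _ => f p) (g := fun t : ℝ => t • N p) continuous_const
            (continuous_id.smul continuous_const)
        simpa [hΦ0] using (this.tendsto 0).mono_left nhdsWithin_le_nhds
      obtain ⟨t, ht1, ht2⟩ := ((h1.eventually (mem_interior_iff_mem_nhds.1 hint)).and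
        (Ioc_mem_nhdsGT hr)).exists
      have := (hin p (hAcl hp) t ⟨by linarith [ht2.1], ht2.2⟩).1 ht1
      linarith [ht2.1]
  -- the Jacobian
  set J : R2 × ℝ → ℝ := fun q => |((prodEquiv.symm : R3 →L[ℝ] R2 × ℝ) ∘L fderiv ℝ Φ q).det|
  have hJc : ContinuousOn J ψ.source := by
    have h1 : ContinuousOn (fderiv ℝ Φ) ψ.source :=
      (hΦs.continuousOn_fderiv_of_isOpen hBu (by simp)).mono fun q hq => (hψO hq).1.1
    exact (ContinuousLinearMap.continuous_det.comp_continuousOn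
      (continuousOn_const.clm_comp h1)).abs
  have hJ0 : ∀ q ∈ ψ.source, J q ≠ 0 := by
    intro q hq
    obtain ⟨e', he'⟩ := hψe q hq
    simp only [J, he'.fderiv]
    have h1 := (e'.trans prodEquiv.symm).toLinearEquiv.isUnit_det'
    exact abs_ne_zero.2 h1.ne_zero
  have hcpt : IsCompact (Metric.closedBall p₀ r ×ˢ Icc (-r) r) :=
    (isCompact_closedBall _ _).prod isCompact_Icc
  have hΦcl : ContinuousOn Φ (Metric.closedBall p₀ r ×ˢ Icc (-r) r) :=
    hΦs.continuousOn.mono fun q hq => ⟨hAB hq.1, mem_univ _⟩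
  have hdet : ∀ p ∈ A, J (p, 0) = LinearMap.normDet (fderiv ℝ f p : R2 →ₗ[ℝ] R3) := by
    intro p hp
    refine abs_det_eq_normDet (hBp p (hAB' hp)).2.2.2.1 (hgN p (hAB' hp)) fun q s => ?_
    rw [hΦ' p (hAB' hp), zero_smul, add_zero]
  have hW : IsOpen (Φ '' D) := by
    have := ψ.isOpen_image_of_subset_source hDopen hDsrc
    rwa [show (ψ '' D) = Φ '' D from image_congr fun q _ => hψ q] at this
  have hWfr : Φ '' D ∩ frontier E = f '' A := by
    ext y
    constructor
    · rintro ⟨⟨⟨p, t⟩, ⟨hp, ht⟩, rfl⟩, h2⟩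
      have ht0 : t = 0 := by_contra fun h0 =>
        hnotfr p (hAcl hp) t (Ioo_subset_Icc_self ht) h0 h2
      subst ht0
      exact ⟨p, hp, (hΦ0 p).symm⟩
    · rintro ⟨p, hp, rfl⟩
      exact ⟨⟨(p, 0), ⟨hp, by simpa using hr⟩, hΦ0 p⟩, hfr p hp⟩
  have hψΦ : ∀ q ∈ ψ.source, ψ.symm (Φ q) = q := fun q hq => by rw [← hψ, ψ.left_inv hq]
  have hsd : ∀ q ∈ ψ.source, ContDiffAt ℝ ∞ (fun y => (ψ.symm y).2) (Φ q) := fun q hq =>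
    contDiffAt_snd.comp _ (hψs _ (by rw [← hψ]; exact ψ.map_source hq))
  -- orthogonal vectors
  have hnormal : ∀ p ∈ A, ∀ n, IsUnitOrthogonal (frontier E) (f p) n → n = N p ∨ n = -N p := by
    intro p hp n hn
    have hB' := hAB' hp
    have h1 := hn.inner_fderiv_eq_zero (hfd p hB')
      (by filter_upwards [Metric.isOpen_ball.mem_nhds hp] with q hq using hfr q hq)
    obtain ⟨e', he'⟩ := hψe (p, 0) (hcl (mk_mem_prod (hAcl hp) h0mem))
    set c := inner ℝ (N p) n
    -- The difference is orthogonal to the range of DΦ at (p, 0), which is the whole space and so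
    -- contains it.
    have h2 : n - c • N p = 0 := by
      obtain ⟨⟨q, s⟩, hqs⟩ := e'.surjective (n - c • N p)
      have h3 : fderiv ℝ Φ (p, 0) (q, s) = n - c • N p := by
        rw [he'.fderiv]
        exact hqs
      have h4 : inner ℝ (fderiv ℝ Φ (p, 0) (q, s)) (n - c • N p) = 0 := by
        rw [inner_sub_right, inner_smul_right, hTN p hB', hΦ' p hB', zero_smul, add_zero,
          inner_add_left, h1, inner_smul_left]
        simp only [c, conj_trivial]
        ring
      rw [h3] at h4
      exact inner_self_eq_zero.1 h4
    have h5 : n = c • N p := sub_eq_zero.1 h2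
    have h6 : |c| = 1 := by
      have := hn.1
      rwa [h5, norm_smul, (hBp p hB').2.2.2.1, mul_one, Real.norm_eq_abs] at this
    rcases eq_or_eq_neg_of_abs_eq h6 with h | h
    · left; rw [h5, h, one_smul]
    · right; rw [h5, h, neg_one_smul]
  have hseg : ∀ (x v : R3) (s R : ℝ), ‖v‖ = 1 → 0 < s → s < R → x + s • v ∈ Metric.ball (x + R • v) R := by
    intro x v s R hv hs hsR
    rw [Metric.mem_ball, dist_eq_norm, add_sub_add_left_eq_sub, ← sub_smul, norm_smul, hv, mul_one,
      Real.norm_eq_abs, abs_lt]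
    constructor <;> linarith
  have hmapeq : Measure.map Φ ((volume.restrict D).withDensity fun q => ENNReal.ofReal (J q))
      = volume.restrict (Φ '' D) :=
    map_withDensity_abs_det_prodEquiv hDopen.measurableSet hΦm
      (fun q hq => hΦd q.1 (hAB' hq.1) q.2) (hΦinj.mono hDsrc)
  have hsd' : ∀ p ∈ A, ∀ t ∈ Ioo (-r) r,
      ContDiffAt ℝ ∞ (fun y => (ψ.symm y).2) (f p + t • N p) := by
    intro p hp t ht
    have h1 := hsd (p, t) (hDsrc (mk_mem_prod hp ht))
    rwa [show Φ (p, t) = f p + t • N p from rfl] at h1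
  refine ⟨{
    f := f, N := N, A := A, τ := r, J := J, d := fun y => (ψ.symm y).2, π := π
    isOpen_A := Metric.isOpen_ball
    τ_pos := hr
    measurable_f := hfm
    measurable_N := hNm
    measurable_π := π.continuous.measurable
    π_f := fun p hp => (hBp p (hAB' hp)).2.2.1
    norm_N_le := hN1
    isOpen_image := hW
    mem_frontier_iff := ?_
    exists_isCompact := ?_
    continuousOn_J := hJc.mono hDsrc
    exists_bounds_J := ?_
    map_eq := hmapeq
    d_apply := fun p hp t ht => congrArg Prod.snd (hψΦ (p, t) (hDsrc (mk_mem_prod hp ht)))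
    contDiffAt_d := hsd'
    fderiv_d := ?_
    surface_eq := ?_
    outerNormal_eq := ?_
    innerNormal_eq := ?_ }, (p₀, 0), ⟨Metric.mem_ball_self hr, by simpa using hr⟩, ?_⟩
  · intro p hp t ht
    refine ⟨fun h => by_contra fun h0 => hnotfr p (hAcl hp) t (Ioo_subset_Icc_self ht) h0 h, ?_⟩
    rintro rfl
    simpa using hfr p hp
  · intro b c hb hc
    have hsub : Icc b c ⊆ Icc (-r) r := Icc_subset_Icc hb hc
    refine ⟨Φ '' (Metric.closedBall p₀ r ×ˢ Icc b c), ((isCompact_closedBall _ _).prod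
      isCompact_Icc).image_of_continuousOn (hΦcl.mono (prod_mono le_rfl hsub)),
      fun p hp t ht => ⟨(p, t), ⟨hAcl hp, ht⟩, rfl⟩, fun h0 => ?_⟩
    rintro _ ⟨⟨p, t⟩, ⟨hp, ht⟩, rfl⟩
    exact hnotfr p hp t (hsub ht) fun h => h0 (h ▸ ht)
  · have hne : (Metric.closedBall p₀ r ×ˢ Icc (-r) r).Nonempty :=
      ⟨(p₀, 0), Metric.mem_closedBall_self hr.le, h0mem⟩
    obtain ⟨q₁, hq₁, hmin⟩ := hcpt.exists_isMinOn hne (hJc.mono hcl)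
    obtain ⟨q₂, hq₂, hmax⟩ := hcpt.exists_isMaxOn hne (hJc.mono hcl)
    exact ⟨J q₁, J q₂, lt_of_le_of_ne (abs_nonneg _) (hJ0 q₁ (hcl hq₁)).symm,
      fun q hq => ⟨hmin (hDcl hq), hmax (hDcl hq)⟩⟩
  · intro p hp t ht i
    have hq : (p, t) ∈ ψ.source := hDsrc ⟨hp, ht⟩
    have h1 := ((hsd (p, t) hq).differentiableAt (by simp)).hasFDerivAt
    have h2 := h1.comp (p, t) (hΦd p (hAB' hp) t)
    have h3 : HasFDerivAt ((fun y => (ψ.symm y).2) ∘ Φ) (ContinuousLinearMap.snd ℝ R2 ℝ) (p, t) := by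
      refine hasFDerivAt_snd.congr_of_eventuallyEq ?_
      filter_upwards [ψ.open_source.mem_nhds hq] with q hq
      simp [hψΦ q hq]
    obtain ⟨e', he'⟩ := hψe (p, t) hq
    -- The derivative of d sends DΦ(q, s) to s, since d ∘ Φ is the second coordinate; and s is the
    -- inner product of this basis vector with N, its i-th component.
    obtain ⟨⟨q, s⟩, hqs⟩ := e'.surjective (EuclideanSpace.single i 1)
    have h4 : fderiv ℝ Φ (p, t) (q, s) = EuclideanSpace.single i 1 := by
      rw [he'.fderiv]
      exact hqs
    have h5 := congrArg (fun M : (R2 × ℝ) →L[ℝ] ℝ => M (q, s)) (h2.unique h3)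
    simp only [ContinuousLinearMap.comp_apply, ContinuousLinearMap.coe_snd', h4] at h5
    have h6 := hTN p (hAB' hp) t q s
    rw [h4] at h6
    change fderiv ℝ (fun y => (ψ.symm y).2) (Φ (p, t)) (EuclideanSpace.single i 1) = _
    rw [h5, ← h6]
    simp [EuclideanSpace.inner_single_left]
  · obtain ⟨C, hC⟩ : ∃ C : ℝ≥0, LipschitzOnWith C f A := by
      have hfc : ContinuousOn (fderiv ℝ f) (Metric.closedBall p₀ r) :=
        (hf.continuousOn_fderiv_of_isOpen hB (by simp)).mono hAB
      obtain ⟨C, hC⟩ := (isCompact_closedBall p₀ r).exists_bound_of_continuousOn hfc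
      refine ⟨C.toNNReal, Convex.lipschitzOnWith_of_nnnorm_fderiv_le
        (fun p hp => (hfd p (hAB' hp)).differentiableAt) (fun p hp => ?_) (convex_ball _ _)⟩
      exact NNReal.le_toNNReal_of_coe_le (hC p (hAcl hp))
    have h1 := map_euclideanHausdorffMeasure_image (f := f) (A := A) π.continuous.measurable Metric.isOpen_ball
      Metric.isBounded_ball.measure_lt_top.ne (fun p hp => (hBp p (hAB' hp)).2.2.1)
      (Df := fderiv ℝ f) (fun p hp => (hf.contDiffAt (hB.mem_nhds (hAB' hp))).hasStrictFDerivAt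
        (by simp)) (fun p hp x y hxy => by
          rw [← hπf p (hAB' hp) x, hxy, hπf p (hAB' hp) y]) hC
    have h2 : (volume.restrict A).withDensity (fun p => ENNReal.ofReal (J (p, 0)))
        = (volume.restrict A).withDensity
          fun p => ENNReal.ofReal (LinearMap.normDet (fderiv ℝ f p : R2 →ₗ[ℝ] R3)) := by
      refine withDensity_congr_ae ?_
      filter_upwards [ae_restrict_mem Metric.isOpen_ball.measurableSet] with p hp
      rw [hdet p hp]
    have hmeasA : MeasurableSet (f '' A) := by
      rw [← hWfr]
      exact hW.measurableSet.inter isClosed_frontier.measurableSet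
    rw [surfaceMeasure, Measure.restrict_restrict hW.measurableSet, hWfr, h2, ← h1,
      Measure.map_map hfm π.continuous.measurable]
    symm
    calc Measure.map (f ∘ π) ((Measure.euclideanHausdorffMeasure 2).restrict (f '' A))
        = Measure.map id ((Measure.euclideanHausdorffMeasure 2).restrict (f '' A)) := by
          refine Measure.map_congr ?_
          filter_upwards [ae_restrict_mem hmeasA] with y hy
          obtain ⟨p, hp, rfl⟩ := hy
          simp [(hBp p (hAB' hp)).2.2.1]
      _ = _ := Measure.map_id
  · intro p hp n hn
    refine (hnormal p hp n hn.1).resolve_right fun h => ?_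
    obtain ⟨R, hR, hdisj⟩ := hn.2
    -- At this distance the point f p + s n is inside both the chart and the ball of radius R
    -- tangent at f p. If n were -N, it would lie in E as well.
    set s := min r R / 2
    have hs : 0 < s := half_pos (lt_min hr hR)
    have hsr : s < r := (half_lt_self (lt_min hr hR)).trans_le (min_le_left _ _)
    have hsR : s < R := (half_lt_self (lt_min hr hR)).trans_le (min_le_right _ _)
    have h1 : Φ (p, -s) ∈ E := (hin p (hAcl hp) (-s) ⟨by linarith, by linarith⟩).2 (by linarith)
    have h2 : Φ (p, -s) = f p + s • n := by simp [Φ, h]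
    have h3 := hseg (f p) n s R hn.1.1 hs hsR
    rw [h2] at h1
    exact eq_empty_iff_forall_notMem.1 hdisj _ ⟨h3, h1⟩
  · intro p hp n hn
    refine (hnormal p hp n hn.1).resolve_left fun h => ?_
    obtain ⟨R, hR, hsub⟩ := hn.2
    set s := min r R / 2
    have hs : 0 < s := half_pos (lt_min hr hR)
    have hsr : s < r := (half_lt_self (lt_min hr hR)).trans_le (min_le_left _ _)
    have hsR : s < R := (half_lt_self (lt_min hr hR)).trans_le (min_le_right _ _)
    have h3 := hsub (hseg (f p) n s R hn.1.1 hs hsR)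
    rw [h] at h3
    have := (hin p (hAcl hp) s ⟨by linarith, by linarith⟩).1 h3
    linarith
  · rw [← hfa]
    simp

/-! ### Transfer of null sets and integrability to normal segments -/

namespace BoundaryChart

variable {E : Set R3} (c : BoundaryChart E)

/-- The point with given normal coordinates. -/
def pt (q : R2 × ℝ) : R3 := c.f q.1 + q.2 • c.N q.1

/-- The domain of the normal coordinates. -/
def dom : Set (R2 × ℝ) := c.A ×ˢ Ioo (-c.τ) c.τ

/-- The range of the normal coordinates. -/
def W : Set R3 := c.pt '' c.dom

theorem measurable_pt : Measurable c.pt := by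
  have h1 := c.measurable_f
  have h2 := c.measurable_N
  unfold pt
  fun_prop

theorem pt_zero (p : R2) : c.pt (p, 0) = c.f p := by simp [pt]

theorem isOpen_dom : IsOpen c.dom := c.isOpen_A.prod isOpen_Ioo

theorem isOpen_W : IsOpen c.W := c.isOpen_image

theorem zero_mem : (0 : ℝ) ∈ Ioo (-c.τ) c.τ := ⟨by linarith [c.τ_pos], c.τ_pos⟩

theorem map_pt_withDensity :
    Measure.map c.pt ((volume.restrict c.dom).withDensity fun q => ENNReal.ofReal (c.J q))
      = volume.restrict c.W := c.map_eq

theorem aemeasurable_J : AEMeasurable c.J (volume.restrict c.dom) :=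
  c.continuousOn_J.aemeasurable c.isOpen_dom.measurableSet

/-- J is bounded below by a positive constant, and the measure with density J is pushed to volume on
the range. -/
theorem exists_map_le : ∃ C : ENNReal, C ≠ ⊤ ∧
    Measure.map c.pt (volume.restrict c.dom) ≤ C • volume.restrict c.W := by
  obtain ⟨b, _, hb, hJ⟩ := c.exists_bounds_J
  have hb0 : ENNReal.ofReal b ≠ 0 := by simpa using hb
  refine ⟨(ENNReal.ofReal b)⁻¹, ENNReal.inv_ne_top.2 hb0, ?_⟩
  have h1 : ENNReal.ofReal b • volume.restrict c.dom
      ≤ (volume.restrict c.dom).withDensity fun q => ENNReal.ofReal (c.J q) := by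
    rw [← withDensity_const]
    refine withDensity_mono ?_
    filter_upwards [ae_restrict_mem c.isOpen_dom.measurableSet] with q hq
    exact ENNReal.ofReal_le_ofReal (hJ q hq).1
  have h2 : ENNReal.ofReal b • Measure.map c.pt (volume.restrict c.dom)
      ≤ volume.restrict c.W := by
    rw [← c.map_pt_withDensity, ← Measure.map_smul]
    exact Measure.map_mono h1 c.measurable_pt
  calc Measure.map c.pt (volume.restrict c.dom)
      = (ENNReal.ofReal b)⁻¹ • ENNReal.ofReal b • Measure.map c.pt (volume.restrict c.dom) := by
        rw [smul_smul, ENNReal.inv_mul_cancel hb0 ENNReal.ofReal_ne_top, one_smul]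
    _ ≤ _ := by gcongr

theorem prod_Icc_ae_eq_dom : (c.A ×ˢ Icc (-c.τ) c.τ : Set (R2 × ℝ)) =ᵐ[volume] c.dom := by
  rw [Measure.volume_eq_prod]
  exact Measure.set_prod_ae_eq (ae_eq_refl _) Ioo_ae_eq_Icc.symm

/-- The bound in the form required for the lemma on lines. Closed segments up to ±τ are allowed
because the end slices are null. -/
theorem exists_map_box_le : ∃ C : ENNReal, C ≠ ⊤ ∧ ∀ a b, -c.τ ≤ a → b ≤ c.τ →
    ∃ K : Set R3, IsCompact K ∧ (0 ∉ Icc a b → K ⊆ (frontier E)ᶜ) ∧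
      Measure.map c.pt (volume.restrict (c.A ×ˢ Icc a b)) ≤ C • volume.restrict K := by
  obtain ⟨C, hC, hle⟩ := c.exists_map_le
  refine ⟨C, hC, fun a b ha hb => ?_⟩
  obtain ⟨K, hK, hmem, hKE⟩ := c.exists_isCompact a b ha hb
  refine ⟨K, hK, hKE, Measure.le_iff.2 fun S hS => ?_⟩
  have hSK : MeasurableSet (S ∩ K) := hS.inter hK.measurableSet
  have hA := c.isOpen_A.measurableSet
  calc Measure.map c.pt (volume.restrict (c.A ×ˢ Icc a b)) S
      = volume (c.pt ⁻¹' S ∩ c.A ×ˢ Icc a b) := by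
        rw [Measure.map_apply c.measurable_pt hS, Measure.restrict_apply (c.measurable_pt hS)]
    _ ≤ volume (c.pt ⁻¹' (S ∩ K) ∩ c.A ×ˢ Icc (-c.τ) c.τ) := by
        refine measure_mono ?_
        rintro ⟨p, t⟩ ⟨h1, h2⟩
        exact ⟨⟨h1, hmem p h2.1 t h2.2⟩, h2.1, Icc_subset_Icc ha hb h2.2⟩
    _ = volume (c.pt ⁻¹' (S ∩ K) ∩ c.dom) :=
        measure_congr ((ae_eq_refl _).inter c.prod_Icc_ae_eq_dom)
    _ = Measure.map c.pt (volume.restrict c.dom) (S ∩ K) := by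
        rw [Measure.map_apply c.measurable_pt hSK, Measure.restrict_apply (c.measurable_pt hSK)]
    _ ≤ C * volume.restrict c.W (S ∩ K) := hle _
    _ ≤ C * volume (S ∩ K) := by gcongr; exact Measure.restrict_le_self
    _ = (C • volume.restrict K) S := by
        rw [Measure.smul_apply, Measure.restrict_apply hS, smul_eq_mul]

theorem volume_restrict_prod (S : Set ℝ) : (volume : Measure (R2 × ℝ)).restrict (c.A ×ˢ S)
    = (volume.restrict c.A).prod (volume.restrict S) := by
  rw [Measure.prod_restrict, Measure.volume_eq_prod]

theorem ae_pt_of_ae {P : R3 → Prop} (h : ∀ᵐ y, P y) :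
    ∀ᵐ p ∂(volume.restrict c.A), ∀ᵐ t ∂(volume.restrict (Icc (-c.τ) c.τ)), P (c.pt (p, t)) := by
  obtain ⟨C, -, hC⟩ := c.exists_map_box_le
  obtain ⟨K, -, -, hK⟩ := hC _ _ le_rfl le_rfl
  rw [volume_restrict_prod] at hK
  refine Measure.ae_ae_of_ae_prod (p := fun q => P (c.pt q)) ?_
  refine ae_of_ae_map c.measurable_pt.aemeasurable ?_
  exact ((Measure.absolutelyContinuous_of_le hK).trans
    (Measure.smul_absolutelyContinuous.trans Measure.restrict_le_self.absolutelyContinuous)).ae_le h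

theorem integrable_comp_pt {g : R3 → ℝ} (hg : LocallyIntegrable g) :
    Integrable (fun q => g (c.pt q))
      ((volume.restrict c.A).prod (volume.restrict (Icc (-c.τ) c.τ))) := by
  obtain ⟨C, hC', hC⟩ := c.exists_map_box_le
  obtain ⟨K, hKc, -, hK⟩ := hC _ _ le_rfl le_rfl
  rw [volume_restrict_prod] at hK
  exact (((hg.integrableOn_isCompact hKc).smul_measure hC').mono_measure hK).comp_measurable
    c.measurable_pt

theorem abs_N_le (p : R2) (j : Fin 3) : |c.N p j| ≤ 1 :=
  (PiLp.norm_apply_le (c.N p) j).trans (c.norm_N_le p)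

theorem measurable_N_apply (j : Fin 3) : Measurable fun p => c.N p j :=
  (EuclideanSpace.proj (𝕜 := ℝ) j).continuous.measurable.comp c.measurable_N

theorem integrable_comp_pt_mul {g : R3 → ℝ} (hg : LocallyIntegrable g) (j : Fin 3) :
    Integrable (fun q : R2 × ℝ => g (c.pt q) * c.N q.1 j)
      ((volume.restrict c.A).prod (volume.restrict (Icc (-c.τ) c.τ))) :=
  (c.integrable_comp_pt hg).mul_bdd (c := 1)
    ((c.measurable_N_apply j).comp measurable_fst).aestronglyMeasurable
    (Eventually.of_forall fun q => c.abs_N_le q.1 j)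

end BoundaryChart

/-! ### One-sided traces along normals -/

/-- A function that is a primitive on a set of positive measure extends continuously, with a bound
by `L¹` norms. -/
theorem exists_continuous_extension {τ : ℝ} (hτ : 0 < τ) {S : Set ℝ} (hS : MeasurableSet S)
    (hSτ : S ⊆ Icc (-τ) τ) (hvol : volume S = ENNReal.ofReal τ) {v g κ : ℝ → ℝ}
    (hκ : IntegrableOn κ (Icc (-τ) τ)) (hg : IntegrableOn g (Icc (-τ) τ))
    (hv : ∀ s ∈ S, ∀ t ∈ S, v t = v s + ∫ r in s..t, κ r) (hvg : ∀ᵐ t, t ∈ S → v t = g t) :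
    ∃ H : ℝ → ℝ, Continuous H ∧ (∀ᵐ t, t ∈ S → g t = H t) ∧
      ∀ t ∈ Icc (-τ) τ, |H t| ≤ τ⁻¹ * (∫ s in Icc (-τ) τ, |g s|) + ∫ s in Icc (-τ) τ, |κ s| := by
  have hne : S.Nonempty := by
    rw [nonempty_iff_ne_empty]
    rintro rfl
    simp at hvol
    linarith
  obtain ⟨s₀, hs₀⟩ := hne
  -- Cut off outside the interval, κ is integrable on the whole line and its primitive is continuous
  -- everywhere, in particular at the endpoint 0 missing from S.
  set κ' := (Icc (-τ) τ).indicator κ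
  have hκ' : Integrable κ' := (integrable_indicator_iff measurableSet_Icc).2 hκ
  have heq : ∀ s ∈ Icc (-τ) τ, ∀ t ∈ Icc (-τ) τ, ∫ r in s..t, κ r = ∫ r in s..t, κ' r := by
    intro s hs t ht
    refine intervalIntegral.integral_congr fun r hr => ?_
    exact (indicator_of_mem (uIcc_subset_Icc hs ht hr) κ).symm
  set H : ℝ → ℝ := fun t => v s₀ + ∫ r in s₀..t, κ' r
  have hH : ∀ t ∈ S, H t = v t := fun t ht => by
    rw [hv s₀ hs₀ t ht, heq _ (hSτ hs₀) _ (hSτ ht)]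
  refine ⟨H, continuous_const.add
    (intervalIntegral.continuous_primitive (fun a b => hκ'.intervalIntegrable) s₀), ?_, ?_⟩
  · filter_upwards [hvg] with t ht htS
    rw [hH t htS, ht htS]
  · intro t ht
    set I := ∫ s in Icc (-τ) τ, |κ s|
    have hdiff : ∀ s, |H t| ≤ |H s| + I := by
      intro s
      have h1 : H t - H s = ∫ r in s..t, κ' r := by
        have := intervalIntegral.integral_interval_sub_left
          (hκ'.intervalIntegrable (a := s₀) (b := t)) (hκ'.intervalIntegrable (b := s))
        simp only [H]
        linarith
      have h2 : |∫ r in s..t, κ' r| ≤ I := by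
        rw [← Real.norm_eq_abs]
        refine (intervalIntegral.norm_integral_le_integral_norm_uIoc).trans ?_
        refine (setIntegral_le_integral hκ'.norm (Eventually.of_forall fun _ => norm_nonneg _)).trans_eq ?_
        change _ = ∫ s in Icc (-τ) τ, |κ s|
        rw [← integral_indicator measurableSet_Icc]
        congr 1 with r
        simp only [κ', norm_indicator_eq_indicator_norm, Real.norm_eq_abs]
      have h3 := abs_sub_abs_le_abs_sub (H t) (H s)
      rw [h1] at h3
      linarith
    have hgS : IntegrableOn (fun s => |g s|) S := (hg.mono_set hSτ).abs
    have hfin : volume S ≠ ⊤ := by simp [hvol]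
    have hreal : volume.real S = τ := by
      rw [Measure.real, hvol, ENNReal.toReal_ofReal hτ.le]
    -- The inequality |H t| ≤ |H s| + I is averaged over s in S, where H = g almost everywhere; S
    -- has measure τ, whence the factor τ⁻¹.
    have h4 : ∫ s in S, |H t| ≤ ∫ s in S, (|g s| + I) := by
      refine integral_mono_ae (integrableOn_const hfin)
        (hgS.add (integrableOn_const hfin)) ?_
      rw [EventuallyLE, ae_restrict_iff' hS]
      filter_upwards [hvg] with s hs hsS
      have := hdiff s
      rwa [hH s hsS, hs hsS] at this
    rw [integral_add hgS (integrableOn_const hfin), setIntegral_const, setIntegral_const, hreal,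
      smul_eq_mul, smul_eq_mul] at h4
    have h5 : ∫ s in S, |g s| ≤ ∫ s in Icc (-τ) τ, |g s| :=
      setIntegral_mono_set hg.abs (Eventually.of_forall fun _ => abs_nonneg _)
        (LE.le.eventuallyLE hSτ)
    have h6 : τ * |H t| ≤ τ * (τ⁻¹ * (∫ s in Icc (-τ) τ, |g s|) + I) := by
      rw [mul_add, mul_inv_cancel_left₀ hτ.ne']
      linarith
    exact le_of_mul_le_mul_left h6 hτ

namespace BoundaryChart

variable {E : Set R3} (c : BoundaryChart E)

/-- The bound for the values of a function on a normal segment. -/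
noncomputable def traceBound (g : R3 → ℝ) (D : Fin 3 → R3 → ℝ) (p : R2) : ℝ :=
  c.τ⁻¹ * (∫ t in Icc (-c.τ) c.τ, |g (c.pt (p, t))|)
    + ∫ t in Icc (-c.τ) c.τ, |∑ j, D j (c.pt (p, t)) * c.N p j|

theorem integrableOn_traceBound {g : R3 → ℝ} {D : Fin 3 → R3 → ℝ} (hg : LocallyIntegrable g)
    (hD : ∀ j, Integrable (D j)) : IntegrableOn (c.traceBound g D) c.A := by
  have h1 := (c.integrable_comp_pt hg).abs.integral_prod_left
  have h2 : Integrable (fun q : R2 × ℝ => |∑ j, D j (c.pt q) * c.N q.1 j|)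
      ((volume.restrict c.A).prod (volume.restrict (Icc (-c.τ) c.τ))) :=
    (integrable_finsetSum _ fun j _ => c.integrable_comp_pt_mul (hD j).locallyIntegrable j).abs
  exact (h1.const_mul _).add h2.integral_prod_left

/-- One-sided continuity along almost every normal segment. -/
theorem ae_exists_continuous_extension {g : R3 → ℝ} {D : Fin 3 → R3 → ℝ}
    (hg : LocallyIntegrable g) (hD : ∀ j, Integrable (D j))
    (hw : ∀ j, IsWeakPartial (offBoundary E) j g (D j)) {S : Set ℝ} (hS : MeasurableSet S)
    (hSτ : S ⊆ Icc (-c.τ) c.τ) (hvol : volume S = ENNReal.ofReal c.τ) {a b : ℕ → ℝ}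
    (hab : ∀ n, a n < b n) (ha : ∀ n, -c.τ ≤ a n) (hb : ∀ n, b n ≤ c.τ)
    (h0 : ∀ n, 0 ∉ Icc (a n) (b n)) (hSab : ∀ s ∈ S, ∀ t ∈ S, ∃ n, s ∈ Icc (a n) (b n) ∧ t ∈ Icc (a n) (b n)) :
    ∀ᵐ p ∂(volume.restrict c.A), ∃ H : ℝ → ℝ, Continuous H ∧
      (∀ᵐ t, t ∈ S → g (c.pt (p, t)) = H t) ∧
      ∀ t ∈ Icc (-c.τ) c.τ, |H t| ≤ c.traceBound g D p := by
  obtain ⟨u, -, hu⟩ := exists_absolutelyContinuous_representative hw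
  obtain ⟨C, hC', hC⟩ := c.exists_map_box_le
  have h1 : ∀ᵐ p ∂(volume.restrict c.A), ∀ n,
      IntegrableOn (fun t => ∑ j, D j (c.f p + t • c.N p) * c.N p j) (Icc (a n) (b n)) ∧
      (∀ t ∈ Icc (a n) (b n), u (c.f p + t • c.N p)
        = u (c.f p + a n • c.N p) + ∫ s in (a n)..t, ∑ j, D j (c.f p + s • c.N p) * c.N p j) ∧
      ∀ᵐ t ∂(volume.restrict (Icc (a n) (b n))),
        u (c.f p + t • c.N p) = g (c.f p + t • c.N p) := by
    refine ae_all_iff.2 fun n => ?_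
    obtain ⟨K, hK, hKE, hmap⟩ := hC (a n) (b n) (ha n) (hb n)
    exact hu c.f c.N c.A (a n) (b n) K C c.measurable_f c.measurable_N c.norm_N_le (hab n) hK
      (hKE (h0 n)) hC' hmap
  have h2 : Integrable (fun q : R2 × ℝ => ∑ j, D j (c.pt q) * c.N q.1 j)
      ((volume.restrict c.A).prod (volume.restrict (Icc (-c.τ) c.τ))) :=
    integrable_finsetSum _ fun j _ => c.integrable_comp_pt_mul (hD j).locallyIntegrable j
  filter_upwards [h1, h2.prod_right_ae, (c.integrable_comp_pt hg).prod_right_ae] with p hp1 hp2 hp3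
  refine exists_continuous_extension c.τ_pos hS hSτ hvol (v := fun t => u (c.pt (p, t))) hp2 hp3
    (fun s hs t ht => ?_) ?_
  · obtain ⟨n, hsn, htn⟩ := hSab s hs t ht
    obtain ⟨hi, hp, -⟩ := hp1 n
    have han : a n ∈ Icc (a n) (b n) := ⟨le_rfl, (hab n).le⟩
    change u (c.f p + t • c.N p) = u (c.f p + s • c.N p) + ∫ r in s..t, ∑ j,
      D j (c.f p + r • c.N p) * c.N p j
    rw [hp t htn, hp s hsn, add_assoc, intervalIntegral.integral_add_adjacent_intervals]
    · exact (hi.mono_set (uIcc_subset_Icc han hsn)).intervalIntegrable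
    · exact (hi.mono_set (uIcc_subset_Icc hsn htn)).intervalIntegrable
  · have h3 : ∀ᵐ t, ∀ n, t ∈ Icc (a n) (b n) →
        u (c.f p + t • c.N p) = g (c.f p + t • c.N p) :=
      ae_all_iff.2 fun n => (ae_restrict_iff' measurableSet_Icc).1 (hp1 n).2.2
    filter_upwards [h3] with t ht htS
    obtain ⟨n, hn, -⟩ := hSab t htS t htS
    exact ht n hn

/-- Weak derivatives are available only off the boundary, so each open side is exhausted by
countably many segments that avoid 0. Integrability of the derivative up to t = 0 then extends the
function to the boundary. -/
theorem ae_exists_one_sided_extensions {g : R3 → ℝ} {D : Fin 3 → R3 → ℝ}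
    (hg : LocallyIntegrable g) (hD : ∀ j, Integrable (D j))
    (hw : ∀ j, IsWeakPartial (offBoundary E) j g (D j)) :
    ∀ᵐ p ∂(volume.restrict c.A), ∃ H₁ H₂ : ℝ → ℝ, Continuous H₁ ∧ Continuous H₂ ∧
      (∀ᵐ t, t ∈ Ioc 0 c.τ → g (c.pt (p, t)) = H₁ t) ∧
      (∀ᵐ t, t ∈ Ico (-c.τ) 0 → g (c.pt (p, t)) = H₂ t) ∧
      ∀ t ∈ Icc (-c.τ) c.τ, |H₁ t| ≤ c.traceBound g D p ∧ |H₂ t| ≤ c.traceBound g D p := by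
  have hτ := c.τ_pos
  -- The shift by 2 keeps the first segment nondegenerate.
  have hδ : ∀ n : ℕ, 0 < c.τ / (n + 2) ∧ c.τ / (n + 2) < c.τ := fun n => by
    have : (0 : ℝ) < n + 2 := by positivity
    refine ⟨by positivity, ?_⟩
    rw [div_lt_iff₀ this]
    nlinarith
  have hex : ∀ s > (0 : ℝ), ∃ n : ℕ, c.τ / (n + 2) ≤ s := by
    intro s hs
    obtain ⟨n, hn⟩ := exists_nat_gt (c.τ / s)
    refine ⟨n, ?_⟩
    rw [div_lt_iff₀ hs] at hn
    rw [div_le_iff₀ (by positivity)]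
    nlinarith
  have h1 := c.ae_exists_continuous_extension hg hD hw (S := Ioc 0 c.τ) measurableSet_Ioc
    (fun t ht => ⟨by linarith [ht.1], ht.2⟩) (by simp) (a := fun n => c.τ / (n + 2))
    (b := fun _ => c.τ) (fun n => (hδ n).2) (fun n => by linarith [(hδ n).1]) (fun n => le_rfl)
    (fun n h => by linarith [(hδ n).1, h.1]) (fun s hs t ht => by
      obtain ⟨n, hn⟩ := hex (min s t) (lt_min hs.1 ht.1)
      exact ⟨n, ⟨hn.trans (min_le_left _ _), hs.2⟩, ⟨hn.trans (min_le_right _ _), ht.2⟩⟩)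
  have h2 := c.ae_exists_continuous_extension hg hD hw (S := Ico (-c.τ) 0) measurableSet_Ico
    (fun t ht => ⟨ht.1, by linarith [ht.2]⟩) (by simp) (a := fun _ => -c.τ)
    (b := fun n => -(c.τ / (n + 2))) (fun n => by linarith [(hδ n).2]) (fun n => le_rfl)
    (fun n => by linarith [(hδ n).1]) (fun n h => by linarith [(hδ n).1, h.2])
    (fun s hs t ht => by
      obtain ⟨n, hn⟩ := hex (min (-s) (-t)) (lt_min (by linarith [hs.2]) (by linarith [ht.2]))
      exact ⟨n, ⟨hs.1, by linarith [min_le_left (-s) (-t)]⟩,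
        ⟨ht.1, by linarith [min_le_right (-s) (-t)]⟩⟩)
  filter_upwards [h1, h2] with p ⟨H₁, hc₁, he₁, hb₁⟩ ⟨H₂, hc₂, he₂, hb₂⟩
  exact ⟨H₁, H₂, hc₁, hc₂, he₁, he₂, fun t ht => ⟨hb₁ t ht, hb₂ t ht⟩⟩

/-- The normal component of a vector field in normal coordinates. -/
noncomputable def normalComp (G : R3 → R3) (q : R2 × ℝ) : ℝ := ∑ i, G (c.pt q) i * c.N q.1 i

theorem integrable_normalComp {G : R3 → R3} (hG : ∀ i, LocallyIntegrable fun x => G x i) :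
    Integrable (c.normalComp G)
      ((volume.restrict c.A).prod (volume.restrict (Icc (-c.τ) c.τ))) :=
  integrable_finsetSum _ fun i _ => c.integrable_comp_pt_mul (hG i) i

/-- N is constant along a normal segment, so G · N is there a fixed linear combination of the
components of G, with coefficients at most 1 in absolute value. -/
theorem ae_exists_normalComp_extensions {G : R3 → R3} {D : Fin 3 → Fin 3 → R3 → ℝ}
    (hG : ∀ i, LocallyIntegrable fun x => G x i) (hD : ∀ i j, Integrable (D i j))
    (hw : ∀ i j, IsWeakPartial (offBoundary E) j (fun x => G x i) (D i j)) :
    ∃ M : R2 → ℝ, IntegrableOn M c.A ∧ ∀ᵐ p ∂(volume.restrict c.A), ∃ H₁ H₂ : ℝ → ℝ,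
      Continuous H₁ ∧ Continuous H₂ ∧
      (∀ᵐ t, t ∈ Ioc 0 c.τ → c.normalComp G (p, t) = H₁ t) ∧
      (∀ᵐ t, t ∈ Ico (-c.τ) 0 → c.normalComp G (p, t) = H₂ t) ∧
      ∀ t ∈ Icc (-c.τ) c.τ, |H₁ t| ≤ M p ∧ |H₂ t| ≤ M p := by
  refine ⟨fun p => ∑ i, c.traceBound (fun x => G x i) (D i) p,
    integrable_finsetSum _ fun i _ => c.integrableOn_traceBound (hG i) (hD i), ?_⟩
  filter_upwards [ae_all_iff.2 fun i => c.ae_exists_one_sided_extensions (hG i) (hD i) (hw i)]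
    with p hp
  choose H₁ H₂ hc₁ hc₂ he₁ he₂ hb using hp
  have hbound : ∀ {x : Fin 3 → ℝ}, (∀ i, |x i| ≤ c.traceBound (fun x => G x i) (D i) p) →
      |∑ i, x i * c.N p i| ≤ ∑ i, c.traceBound (fun x => G x i) (D i) p := by
    intro x hx
    refine (Finset.abs_sum_le_sum_abs _ _).trans (Finset.sum_le_sum fun i _ => ?_)
    rw [abs_mul]
    exact (mul_le_of_le_one_right (abs_nonneg _) (c.abs_N_le p i)).trans (hx i)
  refine ⟨fun t => ∑ i, H₁ i t * c.N p i, fun t => ∑ i, H₂ i t * c.N p i,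
    continuous_finsetSum _ fun i _ => (hc₁ i).mul continuous_const,
    continuous_finsetSum _ fun i _ => (hc₂ i).mul continuous_const, ?_, ?_, fun t ht =>
      ⟨hbound fun i => (hb i t ht).1, hbound fun i => (hb i t ht).2⟩⟩
  · filter_upwards [ae_all_iff.2 he₁] with t ht htS
    exact Finset.sum_congr rfl fun i _ => by rw [ht i htS]
  · filter_upwards [ae_all_iff.2 he₂] with t ht htS
    exact Finset.sum_congr rfl fun i _ => by rw [ht i htS]

end BoundaryChart

/-! ### One-sided derivatives of primitives and their uniqueness -/

theorem tendsto_div_of_primitive {τ : ℝ} (hτ : 0 < τ) {v κ H : ℝ → ℝ} (hH : Continuous H)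
    (hκ : ∀ᵐ t, t ∈ Ioc 0 τ → κ t = H t)
    (hv : ∀ t ∈ Icc 0 τ, v t = v 0 + ∫ s in (0 : ℝ)..t, κ s) :
    Tendsto (fun t => (v t - v 0) / t) (𝓝[>] 0) (𝓝 (H 0)) := by
  have h1 : HasDerivAt (fun t => ∫ s in (0 : ℝ)..t, H s) (H 0) 0 :=
    intervalIntegral.integral_hasDerivAt_right (hH.intervalIntegrable _ _)
      hH.aestronglyMeasurable.stronglyMeasurableAtFilter hH.continuousAt
  have h2 := (hasDerivAt_iff_tendsto_slope_zero.1 h1).mono_left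
    (nhdsWithin_mono (0 : ℝ) fun t (ht : t ∈ Ioi (0 : ℝ)) => (mem_Ioi.1 ht).ne')
  refine h2.congr' ?_
  filter_upwards [Ioc_mem_nhdsGT hτ] with t ht
  have h3 : ∫ s in (0 : ℝ)..t, κ s = ∫ s in (0 : ℝ)..t, H s := by
    refine intervalIntegral.integral_congr_ae ?_
    filter_upwards [hκ] with s hs hst
    rw [uIoc_of_le ht.1.le] at hst
    exact hs ⟨hst.1, hst.2.trans ht.2⟩
  rw [hv t ⟨ht.1.le, ht.2⟩, h3]
  simp [div_eq_inv_mul]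

/-- Limits along almost every small t > 0 are unique, since every interval (0, ε) has positive
measure. -/
theorem neBot_nhdsGT_inf_ae : (𝓝[>] (0 : ℝ) ⊓ ae volume).NeBot := by
  refine inf_neBot_iff.2 fun s hs s' hs' => ?_
  obtain ⟨ε, hε, hs⟩ := mem_nhdsGT_iff_exists_Ioo_subset.1 hs
  have h0 : volume (Ioo 0 ε ∩ s') ≠ 0 := by
    rw [measure_inter_conull hs']
    simpa using hε
  exact (nonempty_of_measure_ne_zero h0).mono (inter_subset_inter_left _ hs)

/-- A one-sided derivative is determined by the values almost everywhere. -/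
theorem oneSided_deriv_unique {τ : ℝ} (hτ : 0 < τ) {v w : ℝ → ℝ} {a b : ℝ}
    (h : ∀ᵐ t, t ∈ Ioc 0 τ → v t = w t)
    (hv : Tendsto (fun t => (v t - v 0) / t) (𝓝[>] 0) (𝓝 a))
    (hw : Tendsto (fun t => (w t - w 0) / t) (𝓝[>] 0) (𝓝 b)) : a = b := by
  have := neBot_nhdsGT_inf_ae
  have hl : (𝓝[>] (0 : ℝ) ⊓ ae volume) ≤ 𝓝[>] 0 := inf_le_left
  have heq : ∀ᶠ t in 𝓝[>] (0 : ℝ) ⊓ ae volume, v t = w t := by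
    have h1 : ∀ᶠ t in 𝓝[>] (0 : ℝ) ⊓ ae volume, t ∈ Ioc 0 τ := hl (Ioc_mem_nhdsGT hτ)
    have h2 : ∀ᶠ t in 𝓝[>] (0 : ℝ) ⊓ ae volume, t ∈ Ioc 0 τ → v t = w t :=
      (inf_le_right : _ ≤ ae volume) h
    filter_upwards [h1, h2] with t ht1 ht2 using ht2 ht1
  -- A one-sided derivative forces one-sided continuity, so even the value at the single point 0 is
  -- determined by the values at almost every t > 0.
  have hlim : ∀ {x : ℝ → ℝ} {d : ℝ}, Tendsto (fun t => (x t - x 0) / t) (𝓝[>] 0) (𝓝 d) →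
      Tendsto x (𝓝[>] 0) (𝓝 (x 0)) := by
    intro x d hx
    have hid : Tendsto (fun t : ℝ => t) (𝓝[>] 0) (𝓝 0) := nhdsWithin_le_nhds
    have := (hx.mul hid).add_const (x 0)
    rw [mul_zero, zero_add] at this
    refine this.congr' ?_
    filter_upwards [self_mem_nhdsWithin] with t ht
    rw [div_mul_cancel₀ _ (mem_Ioi.1 ht).ne']
    ring
  have h0 : v 0 = w 0 :=
    tendsto_nhds_unique (((hlim hv).mono_left hl).congr' heq) ((hlim hw).mono_left hl)
  refine tendsto_nhds_unique ((hv.mono_left hl).congr' ?_) (hw.mono_left hl)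
  filter_upwards [heq] with t ht
  rw [ht, h0]

/-! ### Collar cutoffs and concentration at the boundary -/

/-- Concentration of rescaled weights at a jump. -/
theorem tendsto_integral_rescaled_mul {τ C M : ℝ} (hτ : 0 < τ) (hC : 0 ≤ C) {w B κ H₁ H₂ : ℝ → ℝ}
    (hw : Integrable w) (hB : ContinuousOn B (Ioo (-τ) τ)) (hBC : ∀ t ∈ Ioo (-τ) τ, |B t| ≤ C)
    (h₁ : Continuous H₁) (h₂ : Continuous H₂)
    (he₁ : ∀ᵐ t, t ∈ Ioc 0 τ → κ t = H₁ t) (he₂ : ∀ᵐ t, t ∈ Ico (-τ) 0 → κ t = H₂ t)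
    (hM : ∀ t ∈ Icc (-τ) τ, |H₁ t| ≤ M ∧ |H₂ t| ≤ M) {δ : ℕ → ℝ} (hδ : ∀ n, 0 < δ n)
    (hδ0 : Tendsto δ atTop (𝓝 0)) :
    Tendsto (fun n => ∫ t in Ioo (-τ) τ, w (t / δ n) / δ n * (B t * κ t)) atTop
      (𝓝 (B 0 * ∫ s, w s * if 0 < s then H₁ 0 else H₂ 0)) ∧
    ∀ n, |∫ t in Ioo (-τ) τ, w (t / δ n) / δ n * (B t * κ t)| ≤ (∫ s, |w s|) * (C * M) := by
  have hM0 : 0 ≤ M := (abs_nonneg _).trans (hM 0 ⟨by linarith, hτ.le⟩).1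
  set k : ℝ → ℝ := (Ioo (-τ) τ).indicator fun t => B t * if 0 < t then H₁ t else H₂ t
  have hk : ∀ t, |k t| ≤ C * M := by
    intro t
    by_cases ht : t ∈ Ioo (-τ) τ
    · simp only [k, indicator_of_mem ht, abs_mul]
      refine mul_le_mul (hBC t ht) ?_ (abs_nonneg _) hC
      split_ifs
      exacts [(hM t (Ioo_subset_Icc_self ht)).1, (hM t (Ioo_subset_Icc_self ht)).2]
    · simp only [k, indicator_of_notMem ht, abs_zero]
      positivity
  have hkm : Measurable k := by
    have hH : Measurable fun t => if 0 < t then H₁ t else H₂ t :=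
      Measurable.ite measurableSet_Ioi h₁.measurable h₂.measurable
    have : k = fun t => (Ioo (-τ) τ).indicator B t * if 0 < t then H₁ t else H₂ t := by
      funext t
      simp only [k, indicator]
      split_ifs <;> simp
    rw [this]
    refine Measurable.mul ?_ hH
    have := hB.measurable_piecewise (g := fun _ => (0 : ℝ)) continuousOn_const measurableSet_Ioo
    convert this using 1
    exact (piecewise_eq_indicator).symm
  -- Substitution of t = δ s moves the scaling from the weight into k, which is bounded and has
  -- one-sided limits at 0; dominated convergence then applies.
  have heq : ∀ n, ∫ t in Ioo (-τ) τ, w (t / δ n) / δ n * (B t * κ t)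
      = ∫ s, w s * k (δ n * s) := by
    intro n
    have hn := hδ n
    have h1 : ∫ t in Ioo (-τ) τ, w (t / δ n) / δ n * (B t * κ t)
        = ∫ t, (w (t / δ n) / δ n) * k t := by
      rw [← integral_indicator measurableSet_Ioo]
      refine integral_congr_ae ?_
      have h0 : ∀ᵐ t : ℝ, t ≠ 0 := by simp [ae_iff, measure_singleton]
      filter_upwards [he₁, he₂, h0] with t ht1 ht2 ht0
      by_cases ht : t ∈ Ioo (-τ) τ
      · simp only [k, indicator_of_mem ht]
        split_ifs with hpos
        · rw [ht1 ⟨hpos, ht.2.le⟩]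
        · rw [ht2 ⟨ht.1.le, lt_of_le_of_ne (not_lt.1 hpos) ht0⟩]
      · simp only [k, indicator_of_notMem ht, mul_zero]
    have h2 := Measure.integral_comp_mul_left (fun t => (w (t / δ n) / δ n) * k t) (δ n)
    rw [h1]
    have h3 : ∀ s, w (δ n * s / δ n) / δ n * k (δ n * s) = (δ n)⁻¹ * (w s * k (δ n * s)) := by
      intro s
      rw [mul_div_cancel_left₀ _ hn.ne']
      ring
    simp only [h3, integral_const_mul] at h2
    rw [abs_of_pos (inv_pos.2 hn), smul_eq_mul] at h2
    exact (mul_left_cancel₀ (inv_pos.2 hn).ne' h2).symm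
  simp only [heq]
  have hbound : ∀ n s, ‖w s * k (δ n * s)‖ ≤ |w s| * (C * M) := fun n s => by
    rw [Real.norm_eq_abs, abs_mul]
    exact mul_le_mul_of_nonneg_left (hk _) (abs_nonneg _)
  refine ⟨?_, fun n => ?_⟩
  · rw [← integral_const_mul]
    refine tendsto_integral_of_dominated_convergence (fun s => |w s| * (C * M))
      (fun n => hw.1.mul (hkm.comp (measurable_const_mul (δ n))).aestronglyMeasurable)
      (hw.abs.mul_const _) (fun n => Eventually.of_forall (hbound n)) ?_
    refine Eventually.of_forall fun s => ?_
    have h1 : Tendsto (fun n => δ n * s) atTop (𝓝 0) := by simpa using hδ0.mul_const s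
    have h0 : (0 : ℝ) ∈ Ioo (-τ) τ := ⟨by linarith, hτ⟩
    have hB0 : Tendsto (fun n => B (δ n * s)) atTop (𝓝 (B 0)) :=
      ((hB.continuousAt (Ioo_mem_nhds h0.1 h0.2)).tendsto).comp h1
    have h2 : Tendsto (fun n => B (δ n * s) * if 0 < s then H₁ (δ n * s) else H₂ (δ n * s)) atTop
        (𝓝 (B 0 * if 0 < s then H₁ 0 else H₂ 0)) := by
      refine hB0.mul ?_
      split_ifs
      exacts [(h₁.tendsto 0).comp h1, (h₂.tendsto 0).comp h1]
    have h3 := h2.const_mul (w s)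
    rw [show B 0 * (w s * if 0 < s then H₁ 0 else H₂ 0)
      = w s * (B 0 * if 0 < s then H₁ 0 else H₂ 0) by ring]
    refine h3.congr' ?_
    filter_upwards [h1 (Ioo_mem_nhds h0.1 h0.2)] with n hn
    simp only [k, indicator_of_mem (show δ n * s ∈ Ioo (-τ) τ from hn),
      mul_pos_iff_of_pos_left (hδ n)]
  · rw [← integral_mul_const, ← Real.norm_eq_abs]
    exact norm_integral_le_of_norm_le (hw.abs.mul_const _) (Eventually.of_forall (hbound n))

/-- A smooth even function that vanishes near `0` and is `1` away from `0`. -/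
noncomputable def collar (t : ℝ) : ℝ := Real.smoothTransition (t ^ 2 - 1)

theorem contDiff_collar : ContDiff ℝ ∞ collar :=
  Real.smoothTransition.contDiff.comp ((contDiff_id.pow 2).sub contDiff_const)

theorem collar_eq_zero {t : ℝ} (ht : |t| ≤ 1) : collar t = 0 :=
  Real.smoothTransition.zero_of_nonpos (by nlinarith [abs_nonneg t, sq_abs t])

theorem collar_eq_one {t : ℝ} (ht : 2 ≤ |t|) : collar t = 1 :=
  Real.smoothTransition.one_of_one_le (by nlinarith [abs_nonneg t, sq_abs t])

theorem abs_collar_le (t : ℝ) : |collar t| ≤ 1 := by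
  rw [collar, abs_of_nonneg (Real.smoothTransition.nonneg _)]
  exact Real.smoothTransition.le_one _

theorem hasDerivAt_collar (t : ℝ) : HasDerivAt collar (deriv collar t) t :=
  (contDiff_collar.differentiable (by simp) t).hasDerivAt

theorem continuous_deriv_collar : Continuous (deriv collar) :=
  contDiff_collar.continuous_deriv (by simp)

theorem hasCompactSupport_deriv_collar : HasCompactSupport (deriv collar) := by
  refine HasCompactSupport.of_support_subset_isCompact (isCompact_Icc (a := (-2 : ℝ)) (b := 2)) ?_
  intro t ht
  by_contra h
  refine ht ?_
  have h2 : 2 < |t| := by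
    by_contra h'
    exact h (abs_le.1 (not_lt.1 h'))
  have : collar =ᶠ[𝓝 t] fun _ => 1 := by
    filter_upwards [(isOpen_lt continuous_const continuous_abs).mem_nhds h2] with s hs
    exact collar_eq_one (le_of_lt hs)
  rw [this.deriv_eq]
  simp

theorem integrable_deriv_collar : Integrable (deriv collar) :=
  continuous_deriv_collar.integrable_of_hasCompactSupport hasCompactSupport_deriv_collar

/-- The collar function falls from 1 to 0 on the left and rises from 0 to 1 on the right, so its
derivative has mass -1 and 1 on the two half-lines and measures a jump. -/
theorem integral_deriv_collar_mul (a b : ℝ) :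
    ∫ s, deriv collar s * (if 0 < s then a else b) = a - b := by
  have hi := integrable_deriv_collar
  have h1 : Tendsto collar atTop (𝓝 1) := by
    refine tendsto_const_nhds.congr' ?_
    filter_upwards [eventually_ge_atTop 2] with t ht
    exact (collar_eq_one (ht.trans (le_abs_self t))).symm
  have h2 : Tendsto collar atBot (𝓝 1) := by
    refine tendsto_const_nhds.congr' ?_
    filter_upwards [eventually_le_atBot (-2)] with t ht
    exact (collar_eq_one (by rw [abs_of_neg (by linarith)]; linarith)).symm
  have h3 : ∫ s in Ioi (0 : ℝ), deriv collar s = 1 := by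
    rw [integral_Ioi_of_hasDerivAt_of_tendsto' (fun t _ => hasDerivAt_collar t) hi.integrableOn h1,
      collar_eq_zero (by simp), sub_zero]
  have h4 : ∫ s in Iic (0 : ℝ), deriv collar s = -1 := by
    rw [integral_Iic_of_hasDerivAt_of_tendsto' (fun t _ => hasDerivAt_collar t) hi.integrableOn h2,
      collar_eq_zero (by simp), zero_sub]
  have h5 : Integrable fun s : ℝ => deriv collar s * (if 0 < s then a else b) := by
    refine hi.mul_bdd (c := max |a| |b|)
      (Measurable.ite measurableSet_Ioi measurable_const measurable_const).aestronglyMeasurable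
      (Eventually.of_forall fun s => ?_)
    split_ifs
    exacts [le_max_left _ _, le_max_right _ _]
  rw [← integral_add_compl measurableSet_Ioi h5 (s := Ioi 0), compl_Ioi]
  have h6 : ∫ s in Ioi (0 : ℝ), deriv collar s * (if 0 < s then a else b) = a := by
    rw [setIntegral_congr_fun (g := fun s => deriv collar s * a) measurableSet_Ioi
      fun s hs => by simp [mem_Ioi.1 hs], integral_mul_const, h3, one_mul]
  have h7 : ∫ s in Iic (0 : ℝ), deriv collar s * (if 0 < s then a else b) = -b := by
    rw [setIntegral_congr_fun (g := fun s => deriv collar s * b) measurableSet_Iic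
      fun s hs => by simp [mem_Iic.1 hs], integral_mul_const, h4, neg_one_mul]
  rw [h6, h7, sub_eq_add_neg]

/-! ### Surface and volume integrals in a chart -/

namespace BoundaryChart

variable {E : Set R3} (c : BoundaryChart E)

theorem f_mem_frontier {p : R2} (hp : p ∈ c.A) : c.f p ∈ frontier E := by
  have := (c.mem_frontier_iff p hp 0 c.zero_mem).2 rfl
  simpa using this

theorem eq_f_of_mem {x : R3} (hx : x ∈ c.W) (hx' : x ∈ frontier E) : c.f (c.π x) = x := by
  obtain ⟨⟨p, t⟩, ⟨hp, ht⟩, rfl⟩ := hx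
  obtain rfl : t = 0 := (c.mem_frontier_iff p hp t ht).1 hx'
  rw [c.pt_zero, c.π_f p hp]

theorem J_pos {q : R2 × ℝ} (hq : q ∈ c.dom) : 0 < c.J q := by
  obtain ⟨b, _, hb, hJ⟩ := c.exists_bounds_J
  exact hb.trans_le (hJ q hq).1

theorem mem_dom_zero {p : R2} (hp : p ∈ c.A) : ((p, 0) : R2 × ℝ) ∈ c.dom := ⟨hp, c.zero_mem⟩

theorem continuousOn_J_zero : ContinuousOn (fun p => c.J (p, 0)) c.A :=
  c.continuousOn_J.comp (by fun_prop) fun _ hp => c.mem_dom_zero hp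

theorem aemeasurable_J_zero : AEMeasurable (fun p => c.J (p, 0)) (volume.restrict c.A) :=
  c.continuousOn_J_zero.aemeasurable c.isOpen_A.measurableSet

theorem surfaceMeasure_restrict : (surfaceMeasure E).restrict c.W
    = Measure.map c.f ((volume.restrict c.A).withDensity fun p => ENNReal.ofReal (c.J (p, 0))) :=
  c.surface_eq

/-- Positivity of J is what makes a surface null set pull back to a null set of parameters. -/
theorem ae_f_of_ae {P : R3 → Prop} (h : ∀ᵐ x ∂(surfaceMeasure E), P x) :
    ∀ᵐ p ∂(volume.restrict c.A), P (c.f p) := by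
  have h1 : ∀ᵐ x ∂((surfaceMeasure E).restrict c.W), P x := ae_restrict_of_ae h
  rw [c.surfaceMeasure_restrict] at h1
  refine (withDensity_absolutelyContinuous' c.aemeasurable_J_zero.ennreal_ofReal ?_).ae_le
    (ae_of_ae_map c.measurable_f.aemeasurable h1)
  filter_upwards [ae_restrict_mem c.isOpen_A.measurableSet] with p hp
  simpa using c.J_pos (c.mem_dom_zero hp)

theorem map_π_absolutelyContinuous :
    Measure.map c.π ((surfaceMeasure E).restrict c.W) ≪ volume.restrict c.A := by
  have hac := withDensity_absolutelyContinuous (volume.restrict c.A)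
    fun p => ENNReal.ofReal (c.J (p, 0))
  rw [c.surfaceMeasure_restrict, Measure.map_map c.measurable_π c.measurable_f]
  have : c.π ∘ c.f =ᵐ[(volume.restrict c.A).withDensity fun p => ENNReal.ofReal (c.J (p, 0))]
      id := by
    refine hac.ae_le ?_
    filter_upwards [ae_restrict_mem c.isOpen_A.measurableSet] with p hp using c.π_f p hp
  rw [Measure.map_congr this, Measure.map_id]
  exact hac

theorem ae_f_π : ∀ᵐ x ∂((surfaceMeasure E).restrict c.W), c.f (c.π x) = x := by
  have h1 : ∀ᵐ x ∂((surfaceMeasure E).restrict c.W), x ∈ frontier E :=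
    ae_restrict_of_ae (ae_restrict_mem isClosed_frontier.measurableSet)
  filter_upwards [h1, ae_restrict_mem c.isOpen_W.measurableSet] with x hx hxW
  exact c.eq_f_of_mem hxW hx

/-- The property P need not be measurable, so it is carried through the measurable left inverse π
instead of the pushforward by f. -/
theorem ae_of_ae_f {P : R3 → Prop} (h : ∀ᵐ p ∂(volume.restrict c.A), P (c.f p)) :
    ∀ᵐ x ∂((surfaceMeasure E).restrict c.W), P x := by
  have h1 := ae_of_ae_map c.measurable_π.aemeasurable (c.map_π_absolutelyContinuous.ae_le h)
  filter_upwards [h1, c.ae_f_π] with x hx hx'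
  rwa [hx'] at hx

theorem aestronglyMeasurable_of_comp_f {g : R3 → ℝ}
    (hg : AEStronglyMeasurable (fun p => g (c.f p)) (volume.restrict c.A)) :
    AEStronglyMeasurable g ((surfaceMeasure E).restrict c.W) := by
  have h1 : AEStronglyMeasurable (fun x => g (c.f (c.π x))) ((surfaceMeasure E).restrict c.W) :=
    hg.comp_quasiMeasurePreserving ⟨c.measurable_π, c.map_π_absolutelyContinuous⟩
  refine h1.congr ?_
  filter_upwards [c.ae_f_π] with x hx
  rw [hx]

theorem toReal_J_zero : ∀ᵐ p ∂(volume.restrict c.A),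
    (ENNReal.ofReal (c.J (p, 0))).toReal = c.J (p, 0) := by
  filter_upwards [ae_restrict_mem c.isOpen_A.measurableSet] with p hp
  exact ENNReal.toReal_ofReal (c.J_pos (c.mem_dom_zero hp)).le

theorem integrable_surface {g : R3 → ℝ} (hg : IntegrableOn (fun p => g (c.f p)) c.A) :
    IntegrableOn g c.W (surfaceMeasure E) := by
  obtain ⟨b, C, -, hJ⟩ := c.exists_bounds_J
  have hm := c.aestronglyMeasurable_of_comp_f hg.1
  rw [IntegrableOn, c.surfaceMeasure_restrict] at *
  rw [integrable_map_measure hm c.measurable_f.aemeasurable,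
    integrable_withDensity_iff_integrable_smul₀' c.aemeasurable_J_zero.ennreal_ofReal
      (Eventually.of_forall fun _ => ENNReal.ofReal_lt_top)]
  have h1 : Integrable (fun p => c.J (p, 0) * g (c.f p)) (volume.restrict c.A) := by
    refine Integrable.bdd_mul (c := C) hg c.aemeasurable_J_zero.aestronglyMeasurable ?_
    filter_upwards [ae_restrict_mem c.isOpen_A.measurableSet] with p hp
    rw [Real.norm_eq_abs, abs_of_pos (c.J_pos (c.mem_dom_zero hp))]
    exact (hJ _ (c.mem_dom_zero hp)).2
  refine h1.congr ?_
  filter_upwards [c.toReal_J_zero] with p hp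
  simp [hp]

theorem setIntegral_surface {g : R3 → ℝ}
    (hg : AEStronglyMeasurable (fun p => g (c.f p)) (volume.restrict c.A)) :
    ∫ x in c.W, g x ∂(surfaceMeasure E) = ∫ p in c.A, c.J (p, 0) * g (c.f p) := by
  have hm := c.aestronglyMeasurable_of_comp_f hg
  rw [c.surfaceMeasure_restrict] at *
  rw [integral_map c.measurable_f.aemeasurable hm,
    integral_withDensity_eq_integral_toReal_smul₀ c.aemeasurable_J_zero.ennreal_ofReal
      (Eventually.of_forall fun _ => ENNReal.ofReal_lt_top)]
  refine integral_congr_ae ?_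
  filter_upwards [c.toReal_J_zero] with p hp
  simp [hp]

theorem volume_restrict_dom : (volume : Measure (R2 × ℝ)).restrict c.dom
    = (volume.restrict c.A).prod (volume.restrict (Ioo (-c.τ) c.τ)) := c.volume_restrict_prod _

/-- In normal coordinates the boundary is the null slice t = 0. -/
theorem ae_notMem_frontier : ∀ᵐ x ∂(volume.restrict c.W), x ∉ frontier E := by
  rw [← c.map_pt_withDensity, ae_map_iff c.measurable_pt.aemeasurable
    isClosed_frontier.measurableSet.compl]
  refine (withDensity_absolutelyContinuous _ _).ae_le ?_
  have h0 : ∀ᵐ q : R2 × ℝ ∂((volume.restrict c.A).prod (volume.restrict (Ioo (-c.τ) c.τ))),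
      q.2 ≠ 0 := by
    refine Measure.quasiMeasurePreserving_snd.ae (p := fun t => t ≠ 0) ?_
    exact ae_restrict_of_ae (by simp [ae_iff, measure_singleton])
  rw [← c.volume_restrict_dom] at h0
  filter_upwards [h0, ae_restrict_mem c.isOpen_dom.measurableSet] with q hq hqd hqE
  exact hq ((c.mem_frontier_iff q.1 hqd.1 q.2 hqd.2).1 hqE)

theorem toReal_J : ∀ᵐ q ∂(volume.restrict c.dom), (ENNReal.ofReal (c.J q)).toReal = c.J q := by
  filter_upwards [ae_restrict_mem c.isOpen_dom.measurableSet] with q hq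
  exact ENNReal.toReal_ofReal (c.J_pos hq).le

theorem smul_ae_eq_J_mul (g : R3 → ℝ) :
    (fun q => (ENNReal.ofReal (c.J q)).toReal • (g ∘ c.pt) q)
      =ᵐ[volume.restrict c.dom] fun q => c.J q * g (c.pt q) := by
  filter_upwards [c.toReal_J] with q hq
  simp [hq]

theorem integrable_J_mul {g : R3 → ℝ} (hg : IntegrableOn g c.W) :
    Integrable (fun q => c.J q * g (c.pt q))
      ((volume.restrict c.A).prod (volume.restrict (Ioo (-c.τ) c.τ))) := by
  rw [IntegrableOn, ← c.map_pt_withDensity] at hg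
  rw [← c.volume_restrict_dom]
  exact ((integrable_withDensity_iff_integrable_smul₀' c.aemeasurable_J.ennreal_ofReal
      (Eventually.of_forall fun _ => ENNReal.ofReal_lt_top)).1
    ((integrable_map_measure hg.1 c.measurable_pt.aemeasurable).1 hg)).congr (c.smul_ae_eq_J_mul g)

theorem setIntegral_W {g : R3 → ℝ} (hg : IntegrableOn g c.W) :
    ∫ x in c.W, g x
      = ∫ p in c.A, ∫ t in Ioo (-c.τ) c.τ, c.J (p, t) * g (c.pt (p, t)) := by
  have h3 := c.integrable_J_mul hg
  rw [IntegrableOn, ← c.map_pt_withDensity] at hg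
  rw [← c.map_pt_withDensity, integral_map c.measurable_pt.aemeasurable hg.1,
    integral_withDensity_eq_integral_toReal_smul₀ c.aemeasurable_J.ennreal_ofReal
      (Eventually.of_forall fun _ => ENNReal.ofReal_lt_top)]
  refine (integral_congr_ae (c.smul_ae_eq_J_mul g)).trans ?_
  rw [c.volume_restrict_dom]
  exact integral_prod _ h3

end BoundaryChart

/-! ### Normal derivatives of U as traces of its gradient -/

theorem exists_forall_eventually {α β : Type*} [Nonempty β] {l : Filter α} {r : α → β → Prop}
    (h : ∀ᶠ x in l, ∃ y, r x y) : ∃ f : α → β, ∀ᶠ x in l, r x (f x) :=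
  ⟨fun x => Classical.epsilon (r x), h.mono fun _ hx => Classical.epsilon_spec hx⟩

/-- The gradient of U is a weak gradient on all of space, so the segments may cross the boundary and
the primitive can be based at t = 0. One u works for all charts. -/
theorem exists_line_representative (E : Set R3) {U : R3 → ℝ} {G : R3 → R3}
    (hw : ∀ j, IsWeakPartial ⊤ j U fun x => G x j) :
    ∃ u : R3 → ℝ, u =ᵐ[volume] U ∧ ∀ c : BoundaryChart E, ∀ᵐ p ∂(volume.restrict c.A),
      ∀ t ∈ Icc (-c.τ) c.τ,
        u (c.pt (p, t)) = u (c.f p) + ∫ s in (0 : ℝ)..t, c.normalComp G (p, s) := by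
  obtain ⟨u, huU, hu⟩ := exists_absolutelyContinuous_representative hw
  refine ⟨u, by filter_upwards [huU] with y hy using hy trivial, fun c => ?_⟩
  obtain ⟨C, hC', hC⟩ := c.exists_map_box_le
  obtain ⟨K, hK, -, hmap⟩ := hC _ _ le_rfl le_rfl
  have hτ := c.τ_pos
  filter_upwards [hu c.f c.N c.A _ _ K C c.measurable_f c.measurable_N c.norm_N_le
    (show -c.τ < c.τ by linarith) hK (subset_univ _) hC' hmap] with p ⟨hi, hp, _⟩ t ht
  have h0 : (0 : ℝ) ∈ Icc (-c.τ) c.τ := ⟨by linarith, hτ.le⟩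
  have hl : -c.τ ∈ Icc (-c.τ) c.τ := ⟨le_rfl, by linarith⟩
  have h1 := hp 0 h0
  rw [zero_smul, add_zero] at h1
  change u (c.f p + t • c.N p) = _ + ∫ s in (0 : ℝ)..t, ∑ j, G (c.f p + s • c.N p) j * c.N p j
  rw [hp t ht, h1, add_assoc, intervalIntegral.integral_add_adjacent_intervals]
  · exact (hi.mono_set (uIcc_subset_Icc hl h0)).intervalIntegrable
  · exact (hi.mono_set (uIcc_subset_Icc h0 ht)).intervalIntegrable

namespace BoundaryChart

variable {E : Set R3} (c : BoundaryChart E)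

/-- The normal component of `G` extends continuously to the boundary from both sides along almost
every normal segment. -/
structure HasTraces (G : R3 → R3) (M : R2 → ℝ) (H₁ H₂ : R2 → ℝ → ℝ) : Prop where
  integrableOn_bound : IntegrableOn M c.A
  ae_continuous : ∀ᵐ p ∂(volume.restrict c.A), Continuous (H₁ p) ∧ Continuous (H₂ p)
  ae_eq_right : ∀ᵐ p ∂(volume.restrict c.A), ∀ᵐ t, t ∈ Ioc 0 c.τ → c.normalComp G (p, t) = H₁ p t
  ae_eq_left : ∀ᵐ p ∂(volume.restrict c.A),
    ∀ᵐ t, t ∈ Ico (-c.τ) 0 → c.normalComp G (p, t) = H₂ p t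
  ae_bound : ∀ᵐ p ∂(volume.restrict c.A), ∀ t ∈ Icc (-c.τ) c.τ, |H₁ p t| ≤ M p ∧ |H₂ p t| ≤ M p

theorem exists_hasTraces {G : R3 → R3} {D : Fin 3 → Fin 3 → R3 → ℝ}
    (hG : ∀ i, LocallyIntegrable fun x => G x i) (hD : ∀ i j, Integrable (D i j))
    (hw : ∀ i j, IsWeakPartial (offBoundary E) j (fun x => G x i) (D i j)) :
    ∃ M H₁ H₂, c.HasTraces G M H₁ H₂ := by
  obtain ⟨M, hM, h⟩ := c.ae_exists_normalComp_extensions hG hD hw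
  obtain ⟨H₁, h⟩ := exists_forall_eventually h
  obtain ⟨H₂, h⟩ := exists_forall_eventually h
  exact ⟨M, H₁, H₂, hM, h.mono fun _ h => ⟨h.1, h.2.1⟩, h.mono fun _ h => h.2.2.1,
    h.mono fun _ h => h.2.2.2.1, h.mono fun _ h => h.2.2.2.2⟩

variable {c} {G : R3 → R3} {M : R2 → ℝ} {H₁ H₂ : R2 → ℝ → ℝ}

theorem tendsto_right_quotient {v κ H : ℝ → ℝ} {τ : ℝ} (hτ : 0 < τ) (hH : Continuous H)
    (he : ∀ᵐ t, t ∈ Ioc 0 τ → κ t = H t)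
    (hv : ∀ t ∈ Icc (-τ) τ, v t = v 0 + ∫ s in (0 : ℝ)..t, κ s) :
    Tendsto (fun t => (v t - v 0) / t) (𝓝[>] 0) (𝓝 (H 0)) :=
  tendsto_div_of_primitive hτ hH he fun t ht => hv t ⟨by linarith [ht.1], ht.2⟩

theorem tendsto_left_quotient {v κ H : ℝ → ℝ} {τ : ℝ} (hτ : 0 < τ) (hH : Continuous H)
    (he : ∀ᵐ t, t ∈ Ico (-τ) 0 → κ t = H t)
    (hv : ∀ t ∈ Icc (-τ) τ, v t = v 0 + ∫ s in (0 : ℝ)..t, κ s) :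
    Tendsto (fun t => (v (-t) - v 0) / t) (𝓝[>] 0) (𝓝 (-H 0)) := by
  -- Reflection t ↦ -t reduces the left side to the right side and turns H into -H.
  have := tendsto_div_of_primitive (v := fun t => v (-t)) (κ := fun t => -κ (-t))
    (H := fun t => -H (-t)) hτ (by fun_prop) ?_ fun t ht => ?_
  · simpa using this
  · have h1 := (Measure.measurePreserving_neg (volume : Measure ℝ)).quasiMeasurePreserving.ae he
    filter_upwards [h1] with t ht htS
    rw [ht ⟨neg_le_neg htS.2, neg_lt_zero.2 htS.1⟩]
  · have := hv (-t) ⟨neg_le_neg ht.2, by linarith [ht.1]⟩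
    simp only [neg_zero]
    rw [this, intervalIntegral.integral_neg, intervalIntegral.integral_comp_neg, neg_zero,
      intervalIntegral.integral_symm]

theorem HasTraces.ae_hasOneSidedDeriv (h : c.HasTraces G M H₁ H₂) {u : R3 → ℝ}
    (hu : ∀ᵐ p ∂(volume.restrict c.A), ∀ t ∈ Icc (-c.τ) c.τ,
      u (c.pt (p, t)) = u (c.f p) + ∫ s in (0 : ℝ)..t, c.normalComp G (p, s)) :
    ∀ᵐ p ∂(volume.restrict c.A), HasOneSidedDeriv u (c.f p) (c.N p) (H₁ p 0) ∧
      HasOneSidedDeriv u (c.f p) (-c.N p) (-H₂ p 0) := by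
  filter_upwards [hu, h.ae_continuous, h.ae_eq_right, h.ae_eq_left] with p hp hc h1 h2
  have hv : ∀ t ∈ Icc (-c.τ) c.τ, u (c.pt (p, t)) = u (c.pt (p, 0))
      + ∫ s in (0 : ℝ)..t, c.normalComp G (p, s) := by
    simpa only [c.pt_zero] using hp
  have hr := tendsto_right_quotient c.τ_pos hc.1 h1 hv
  have hl := tendsto_left_quotient c.τ_pos hc.2 h2 hv
  rw [c.pt_zero] at hr hl
  refine ⟨hr, ?_⟩
  simpa [HasOneSidedDeriv, pt] using hl

/-- The null set where u and v differ meets almost every normal segment in a null set, and one-sided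
derivatives do not see such sets. -/
theorem HasTraces.ae_eq_of_hasOneSidedDeriv (h : c.HasTraces G M H₁ H₂) {u v : R3 → ℝ}
    (hu : ∀ᵐ p ∂(volume.restrict c.A), ∀ t ∈ Icc (-c.τ) c.τ,
      u (c.pt (p, t)) = u (c.f p) + ∫ s in (0 : ℝ)..t, c.normalComp G (p, s))
    (huv : u =ᵐ[volume] v) {a b : R2 → ℝ}
    (hv : ∀ᵐ p ∂(volume.restrict c.A), HasOneSidedDeriv v (c.f p) (c.N p) (a p) ∧
      HasOneSidedDeriv v (c.f p) (-c.N p) (b p)) :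
    ∀ᵐ p ∂(volume.restrict c.A), H₁ p 0 = a p ∧ -H₂ p 0 = b p := by
  filter_upwards [hv, h.ae_hasOneSidedDeriv hu, c.ae_pt_of_ae huv] with p hp hp' he
  have he' := (ae_restrict_iff' measurableSet_Icc).1 he
  have hτ := c.τ_pos
  constructor
  · refine oneSided_deriv_unique hτ (v := fun t => u (c.f p + t • c.N p))
      (w := fun t => v (c.f p + t • c.N p)) ?_ (by simpa [HasOneSidedDeriv] using hp'.1)
      (by simpa [HasOneSidedDeriv] using hp.1)
    filter_upwards [he'] with t ht htS
    exact ht ⟨by linarith [htS.1], htS.2⟩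
  · refine oneSided_deriv_unique hτ (v := fun t => u (c.f p + t • -c.N p))
      (w := fun t => v (c.f p + t • -c.N p)) ?_ (by simpa [HasOneSidedDeriv] using hp'.2)
      (by simpa [HasOneSidedDeriv] using hp.2)
    filter_upwards [(Measure.measurePreserving_neg (volume : Measure ℝ)).quasiMeasurePreserving.ae
      he'] with t ht htS
    have := ht ⟨neg_le_neg htS.2, by linarith [htS.1]⟩
    simpa [pt] using this

/-- H₁ and H₂ come from pointwise choices without measurability. Their values at 0 are limits of
averages of G · N over shrinking segments, which are measurable in p by Fubini, and M dominates
them. -/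
theorem HasTraces.integrableOn (h : c.HasTraces G M H₁ H₂)
    (hG : ∀ i, LocallyIntegrable fun x => G x i) :
    IntegrableOn (fun p => H₁ p 0) c.A ∧ IntegrableOn (fun p => H₂ p 0) c.A := by
  have hτ := c.τ_pos
  have h0 : (0 : ℝ) ∈ Icc (-c.τ) c.τ := ⟨by linarith, hτ.le⟩
  have hδ : Tendsto (fun n : ℕ => c.τ / ((n : ℝ) + 1)) atTop (𝓝[>] 0) := by
    refine tendsto_nhdsWithin_iff.2 ⟨?_, Eventually.of_forall fun n => mem_Ioi.2 (by positivity)⟩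
    have := (tendsto_one_div_add_atTop_nhds_zero_nat (𝕜 := ℝ)).const_mul c.τ
    simpa [div_eq_mul_inv] using this
  have hδτ : ∀ n : ℕ, c.τ / ((n : ℝ) + 1) ≤ c.τ := fun n =>
    div_le_self hτ.le (by linarith [n.cast_nonneg (α := ℝ)])
  have hi : ∀ S ⊆ Icc (-c.τ) c.τ, AEStronglyMeasurable
      (fun p => ∫ s in S, c.normalComp G (p, s)) (volume.restrict c.A) := by
    intro S hS
    exact ((c.integrable_normalComp hG).mono_measure
      (Measure.prod_mono le_rfl (Measure.restrict_mono hS le_rfl))).integral_prod_left.1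
  constructor
  · refine h.integrableOn_bound.mono' ?_ ?_
    · refine aestronglyMeasurable_of_tendsto_ae (u := atTop)
        (f := fun (n : ℕ) p => (∫ s in Ioc 0 (c.τ / (n + 1)), c.normalComp G (p, s))
          / (c.τ / (n + 1)))
        (fun n => ((hi (Ioc 0 (c.τ / (n + 1))) fun t ht =>
          ⟨by linarith [ht.1], ht.2.trans (hδτ n)⟩).aemeasurable.div_const _).aestronglyMeasurable)
        ?_
      filter_upwards [h.ae_continuous, h.ae_eq_right] with p hc he
      have := (tendsto_right_quotient (v := fun t => ∫ s in (0 : ℝ)..t, c.normalComp G (p, s))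
        hτ hc.1 he fun t _ => by simp).comp hδ
      refine this.congr fun n => ?_
      simp only [Function.comp_apply, intervalIntegral.integral_same, sub_zero]
      rw [intervalIntegral.integral_of_le (by positivity)]
    · filter_upwards [h.ae_bound] with p hp using (hp 0 h0).1
  · refine h.integrableOn_bound.mono' ?_ ?_
    · refine aestronglyMeasurable_of_tendsto_ae (u := atTop)
        (f := fun (n : ℕ) p => (∫ s in Ioc (-(c.τ / (n + 1))) 0, c.normalComp G (p, s))
          / (c.τ / (n + 1)))
        (fun n => ((hi (Ioc (-(c.τ / (n + 1))) 0) fun t ht =>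
          ⟨by linarith [ht.1, hδτ n], by linarith [ht.2]⟩).aemeasurable.div_const
            _).aestronglyMeasurable) ?_
      filter_upwards [h.ae_continuous, h.ae_eq_left] with p hc he
      have := ((tendsto_left_quotient (v := fun t => ∫ s in (0 : ℝ)..t, c.normalComp G (p, s))
        hτ hc.2 he fun t _ => by simp).comp hδ).neg
      rw [neg_neg] at this
      refine this.congr fun n => ?_
      simp only [Function.comp_apply, intervalIntegral.integral_same, sub_zero]
      rw [← intervalIntegral.integral_of_le (neg_nonpos.2 (by positivity)),
        intervalIntegral.integral_symm, neg_div, neg_neg]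
    · filter_upwards [h.ae_bound] with p hp using (hp 0 h0).2

end BoundaryChart

/-! ### The divergence formula with a jump, in one chart -/

theorem integrable_mul_of_hasCompactSupport {f χ : R3 → ℝ} (hf : LocallyIntegrable f)
    (hχ : Continuous χ) (hc : HasCompactSupport χ) : Integrable fun x => f x * χ x :=
  integrable_mul_of_tsupport_subset (Ω := univ) (locallyIntegrableOn_univ.2 hf) hχ hc
    (subset_univ _)

theorem continuous_fderiv_single {φ : R3 → ℝ} (hφ : ContDiff ℝ ∞ φ) (i : Fin 3) :
    Continuous fun x => fderiv ℝ φ x (EuclideanSpace.single i 1) :=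
  (hφ.continuous_fderiv (by simp)).clm_apply continuous_const

theorem hasCompactSupport_fderiv_single {φ : R3 → ℝ} (hφ : HasCompactSupport φ) (i : Fin 3) :
    HasCompactSupport fun x => fderiv ℝ φ x (EuclideanSpace.single i 1) :=
  hφ.fderiv_apply ℝ _

theorem fderiv_single_eq_zero {φ : R3 → ℝ} {x : R3} (hx : x ∉ tsupport φ) (i : Fin 3) :
    fderiv ℝ φ x (EuclideanSpace.single i 1) = 0 := by
  rw [image_eq_zero_of_notMem_tsupport fun h => hx (tsupport_fderiv_subset ℝ h)]
  simp

/-- The divergence formula for test functions supported off the boundary. -/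
theorem integral_gradient_eq_of_tsupport_subset {Ω : TopologicalSpace.Opens R3} {G : R3 → R3}
    {D : Fin 3 → Fin 3 → R3 → ℝ} (hG : ∀ i, LocallyIntegrable fun x => G x i)
    (hD : ∀ i j, Integrable (D i j)) (hw : ∀ i j, IsWeakPartial Ω j (fun x => G x i) (D i j))
    {ζ : R3 → ℝ} (hζ : ContDiff ℝ ∞ ζ) (hc : HasCompactSupport ζ) (hs : tsupport ζ ⊆ Ω) :
    ∫ x, ∑ i, G x i * fderiv ℝ ζ x (EuclideanSpace.single i 1)
      = -∫ x, (∑ i, D i i x) * ζ x := by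
  simp only [Finset.sum_mul]
  rw [integral_finsetSum _ fun i _ => integrable_mul_of_hasCompactSupport (hG i)
      (continuous_fderiv_single hζ i) (hasCompactSupport_fderiv_single hc i),
    integral_finsetSum _ fun i _ => integrable_mul_of_hasCompactSupport
      (hD i i).locallyIntegrable hζ.continuous hc, ← Finset.sum_neg_distrib]
  exact Finset.sum_congr rfl fun i _ => (hw i i).integral_mul_fderiv hζ hc hs

namespace BoundaryChart

variable {E : Set R3} (c : BoundaryChart E)

theorem contDiffAt_d_of_mem {x : R3} (hx : x ∈ c.W) : ContDiffAt ℝ ∞ c.d x := by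
  obtain ⟨⟨p, t⟩, ⟨hp, ht⟩, rfl⟩ := hx
  exact c.contDiffAt_d p hp t ht

theorem continuousOn_d : ContinuousOn c.d c.W := fun _ hx =>
  (c.contDiffAt_d_of_mem hx).continuousAt.continuousWithinAt

theorem d_eq_zero_iff {x : R3} (hx : x ∈ c.W) : c.d x = 0 ↔ x ∈ frontier E := by
  obtain ⟨⟨p, t⟩, ⟨hp, ht⟩, rfl⟩ := hx
  exact (iff_of_eq (congrArg (· = 0) (c.d_apply p hp t ht))).trans
    (c.mem_frontier_iff p hp t ht).symm

/-- The function `φ` cut off near the boundary. -/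
noncomputable def cutOff (φ : R3 → ℝ) (δ : ℝ) (x : R3) : ℝ := φ x * collar (c.d x / δ)

theorem tsupport_cutOff_subset (φ : R3 → ℝ) (δ : ℝ) : tsupport (c.cutOff φ δ) ⊆ tsupport φ :=
  tsupport_mul_subset_left

variable {c} {φ : R3 → ℝ} {δ : ℝ}

/-- The coordinate d is smooth only on the chart; outside the support of φ the product is locally
zero. -/
theorem contDiff_cutOff (hφ : ContDiff ℝ ∞ φ) (hs : tsupport φ ⊆ c.W) :
    ContDiff ℝ ∞ (c.cutOff φ δ) := by
  refine contDiff_iff_contDiffAt.2 fun x => ?_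
  by_cases hx : x ∈ tsupport φ
  · exact hφ.contDiffAt.mul
      (contDiff_collar.contDiffAt.comp x ((c.contDiffAt_d_of_mem (hs hx)).div_const _))
  · have h0 : c.cutOff φ δ =ᶠ[𝓝 x] fun _ => 0 := by
      filter_upwards [(isClosed_tsupport φ).isOpen_compl.mem_nhds hx] with y hy
      rw [cutOff, image_eq_zero_of_notMem_tsupport hy, zero_mul]
    exact contDiffAt_const.congr_of_eventuallyEq h0

theorem tsupport_cutOff_subset_offBoundary (hs : tsupport φ ⊆ c.W) :
    tsupport (c.cutOff φ δ) ⊆ offBoundary E := by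
  intro x hx hxE
  have hxW := hs (c.tsupport_cutOff_subset φ δ hx)
  have hd : c.d x = 0 := (c.d_eq_zero_iff hxW).2 hxE
  have hct : ContinuousAt (fun y => |c.d y / δ|) x :=
    ((c.contDiffAt_d_of_mem hxW).continuousAt.div_const δ).abs
  have h0 : c.cutOff φ δ =ᶠ[𝓝 x] 0 := by
    filter_upwards [hct.eventually_lt_const (show |c.d x / δ| < 1 by simp [hd])] with y hy
    simp [cutOff, collar_eq_zero hy.le]
  exact (notMem_tsupport_iff_eventuallyEq.2 h0) hx

theorem fderiv_cutOff (hφ : ContDiff ℝ ∞ φ) {x : R3} (hx : x ∈ c.W) (i : Fin 3) :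
    fderiv ℝ (c.cutOff φ δ) x (EuclideanSpace.single i 1)
      = collar (c.d x / δ) * fderiv ℝ φ x (EuclideanSpace.single i 1)
        + φ x * (deriv collar (c.d x / δ) / δ * fderiv ℝ c.d x (EuclideanSpace.single i 1)) := by
  have hd : HasFDerivAt c.d (fderiv ℝ c.d x) x :=
    ((c.contDiffAt_d_of_mem hx).differentiableAt (by simp)).hasFDerivAt
  have h1 : HasFDerivAt (fun y => c.d y / δ) (δ⁻¹ • fderiv ℝ c.d x) x := by
    simpa only [div_eq_mul_inv] using hd.mul_const δ⁻¹
  have h2 := (hasDerivAt_collar (c.d x / δ)).comp_hasFDerivAt x h1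
  have h3 := ((hφ.differentiable (by simp) x).hasFDerivAt).mul h2
  have h4 : fderiv ℝ (c.cutOff φ δ) x = _ := h3.fderiv
  rw [h4]
  simp
  ring

variable {G : R3 → R3} {D : Fin 3 → Fin 3 → R3 → ℝ} {M : R2 → ℝ} {H₁ H₂ : R2 → ℝ → ℝ}

/-- The divergence formula near the boundary. -/
theorem HasTraces.integral_gradient_eq (h : c.HasTraces G M H₁ H₂)
    (hG : ∀ i, LocallyIntegrable fun x => G x i) (hD : ∀ i j, Integrable (D i j))
    (hw : ∀ i j, IsWeakPartial (offBoundary E) j (fun x => G x i) (D i j))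
    (hφ : ContDiff ℝ ∞ φ) (hc : HasCompactSupport φ) (hs : tsupport φ ⊆ c.W) :
    (∫ x, ∑ i, G x i * fderiv ℝ φ x (EuclideanSpace.single i 1))
      + ∫ p in c.A, c.J (p, 0) * (φ (c.f p) * (H₁ p 0 - H₂ p 0))
      = -∫ x, (∑ i, D i i x) * φ x := by
  set a : R3 → ℝ := fun x => ∑ i, G x i * fderiv ℝ φ x (EuclideanSpace.single i 1)
  set b : R3 → ℝ := fun x => (∑ i, D i i x) * φ x
  set δ : ℕ → ℝ := fun n => 1 / ((n : ℝ) + 1)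
  have hδ : ∀ n, 0 < δ n := fun n => by positivity
  have hδ0 : Tendsto δ atTop (𝓝 0) := tendsto_one_div_add_atTop_nhds_zero_nat
  have ha : Integrable a := integrable_finsetSum _ fun i _ =>
    integrable_mul_of_hasCompactSupport (hG i) (continuous_fderiv_single hφ i)
      (hasCompactSupport_fderiv_single hc i)
  have hb : Integrable b := integrable_mul_of_hasCompactSupport
    (integrable_finsetSum _ fun i _ => hD i i).locallyIntegrable hφ.continuous hc
  have hzero : ∀ x, x ∉ c.W → x ∉ tsupport φ := fun x hx hx' => hx (hs hx')
  have ha0 : ∫ x, a x = ∫ x in c.W, a x := by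
    refine (setIntegral_eq_integral_of_forall_compl_eq_zero fun x hx => ?_).symm
    simp [a, fderiv_single_eq_zero (hzero x hx)]
  have hb0 : ∫ x, b x = ∫ x in c.W, b x := by
    refine (setIntegral_eq_integral_of_forall_compl_eq_zero fun x hx => ?_).symm
    simp [b, image_eq_zero_of_notMem_tsupport (hzero x hx)]
  have hem : ∀ n, AEStronglyMeasurable (fun x => collar (c.d x / δ n)) (volume.restrict c.W) :=
    fun n => (contDiff_collar.continuous.comp_continuousOn
      (c.continuousOn_d.div_const _)).aestronglyMeasurable c.isOpen_W.measurableSet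
  -- Off the boundary, which is null in the chart, the cutoff equals 1 as soon as 2δ is below |d|.
  have hlim : ∀ {F : R3 → ℝ}, Integrable F →
      (∀ n, IntegrableOn (fun x => collar (c.d x / δ n) * F x) c.W) ∧
      Tendsto (fun n => ∫ x in c.W, collar (c.d x / δ n) * F x) atTop (𝓝 (∫ x in c.W, F x)) := by
    intro F hF
    refine ⟨fun n => hF.integrableOn.bdd_mul (c := 1) (hem n)
      (Eventually.of_forall fun x => abs_collar_le _), ?_⟩
    refine tendsto_integral_of_dominated_convergence (fun x => |F x|)
      (fun n => (hem n).mul hF.integrableOn.1) hF.integrableOn.abs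
      (fun n => Eventually.of_forall fun x => ?_) ?_
    · rw [norm_mul]
      exact mul_le_of_le_one_left (abs_nonneg _) (abs_collar_le _)
    · filter_upwards [c.ae_notMem_frontier, ae_restrict_mem c.isOpen_W.measurableSet]
        with x hx hxW
      have hd : 0 < |c.d x| := abs_pos.2 fun h0 => hx ((c.d_eq_zero_iff hxW).1 h0)
      refine tendsto_const_nhds.congr' ?_
      filter_upwards [hδ0.eventually_lt_const (show 0 < |c.d x| / 2 by positivity)] with n hn
      rw [collar_eq_one, one_mul]
      rw [abs_div, abs_of_pos (hδ n), le_div_iff₀ (hδ n)]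
      linarith
  -- The term in which the derivative falls on the cutoff; it alone produces the surface integral.
  set g : ℕ → R3 → ℝ := fun n x => ∑ i, G x i *
    (φ x * (deriv collar (c.d x / δ n) / δ n * fderiv ℝ c.d x (EuclideanSpace.single i 1)))
  set s : ℕ → R3 → ℝ := fun n x =>
    ∑ i, G x i * fderiv ℝ (c.cutOff φ (δ n)) x (EuclideanSpace.single i 1)
  have hcn : ∀ n, HasCompactSupport (c.cutOff φ (δ n)) := fun n =>
    hc.mono' (subset_closure.trans (c.tsupport_cutOff_subset φ _))
  have hsint : ∀ n, Integrable (s n) := fun n => integrable_finsetSum _ fun i _ =>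
    integrable_mul_of_hasCompactSupport (hG i) (continuous_fderiv_single (contDiff_cutOff hφ hs) i)
      (hasCompactSupport_fderiv_single (hcn n) i)
  have hsg : ∀ n, ∀ x ∈ c.W, s n x = collar (c.d x / δ n) * a x + g n x := by
    intro n x hx
    simp only [s, a, g, fderiv_cutOff hφ hx, mul_add, Finset.sum_add_distrib, Finset.mul_sum]
    congr 1
    exact Finset.sum_congr rfl fun i _ => by ring
  have hgint : ∀ n, IntegrableOn (g n) c.W := by
    intro n
    refine ((hsint n).integrableOn.sub ((hlim ha).1 n)).congr ?_
    filter_upwards [ae_restrict_mem c.isOpen_W.measurableSet] with x hx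
    simp [hsg n x hx]
  have hkey : ∀ n, (∫ x in c.W, collar (c.d x / δ n) * a x) + ∫ x in c.W, g n x
      = -∫ x in c.W, collar (c.d x / δ n) * b x := by
    intro n
    have h1 := integral_gradient_eq_of_tsupport_subset hG hD hw
      (contDiff_cutOff (δ := δ n) hφ hs) (hcn n) (tsupport_cutOff_subset_offBoundary hs)
    have h2 : ∫ x, s n x = ∫ x in c.W, s n x := by
      refine (setIntegral_eq_integral_of_forall_compl_eq_zero fun x hx => ?_).symm
      simp only [s]
      refine Finset.sum_eq_zero fun i _ => ?_
      rw [fderiv_single_eq_zero fun h' => hzero x hx (c.tsupport_cutOff_subset φ _ h'), mul_zero]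
    have h3 : ∫ x, (∑ i, D i i x) * c.cutOff φ (δ n) x
        = ∫ x in c.W, collar (c.d x / δ n) * b x := by
      rw [← setIntegral_eq_integral_of_forall_compl_eq_zero (s := c.W)]
      · refine integral_congr_ae (Eventually.of_forall fun x => ?_)
        simp only [cutOff, b]
        ring
      · intro x hx
        simp [cutOff, image_eq_zero_of_notMem_tsupport (hzero x hx)]
    rw [← integral_add ((hlim ha).1 n) (hgint n), ← h3, ← h1]
    change _ = ∫ x, s n x
    rw [h2]
    exact setIntegral_congr_fun c.isOpen_W.measurableSet fun x hx => (hsg n x hx).symm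
  -- Since ∇d = N, this term becomes, on each segment, a rescaled derivative of the collar against J
  -- φ (G · N). Its limit is the jump at t = 0, and M gives domination in p.
  have hglim : Tendsto (fun n => ∫ x in c.W, g n x) atTop
      (𝓝 (∫ p in c.A, c.J (p, 0) * (φ (c.f p) * (H₁ p 0 - H₂ p 0)))) := by
    obtain ⟨Cφ, hCφ⟩ := hφ.continuous.bounded_above_of_compact_support hc
    obtain ⟨b₀, CJ, -, hJ⟩ := c.exists_bounds_J
    have hA := c.isOpen_A.measurableSet
    have hCφ0 : 0 ≤ Cφ := (norm_nonneg _).trans (hCφ 0)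
    -- A point of A is needed only to see that the upper bound for J is nonnegative.
    by_cases hne : c.A.Nonempty
    swap
    · rw [not_nonempty_iff_eq_empty] at hne
      have hW : c.W = ∅ := by simp [W, dom, hne]
      simp [hne, hW]
    have hCJ0 : 0 ≤ CJ := by
      obtain ⟨p, hp⟩ := hne
      exact (c.J_pos (c.mem_dom_zero hp)).le.trans (hJ _ (c.mem_dom_zero hp)).2
    simp only [c.setIntegral_W (hgint _)]
    have hform : ∀ n, ∀ p ∈ c.A,
        ∫ t in Ioo (-c.τ) c.τ, c.J (p, t) * g n (c.pt (p, t))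
          = ∫ t in Ioo (-c.τ) c.τ, deriv collar (t / δ n) / δ n *
            ((c.J (p, t) * φ (c.pt (p, t))) * c.normalComp G (p, t)) := by
      intro n p hp
      refine setIntegral_congr_fun measurableSet_Ioo fun t ht => ?_
      have h1 : c.d (c.pt (p, t)) = t := c.d_apply p hp t ht
      have h2 : ∀ i, fderiv ℝ c.d (c.pt (p, t)) (EuclideanSpace.single i 1) = c.N p i :=
        c.fderiv_d p hp t ht
      simp only [g, h1, h2, normalComp, Finset.mul_sum]
      exact Finset.sum_congr rfl fun i _ => by ring
    have hp : ∀ᵐ p ∂(volume.restrict c.A),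
        Tendsto (fun n => ∫ t in Ioo (-c.τ) c.τ, c.J (p, t) * g n (c.pt (p, t))) atTop
          (𝓝 (c.J (p, 0) * (φ (c.f p) * (H₁ p 0 - H₂ p 0)))) ∧
        ∀ n, ‖∫ t in Ioo (-c.τ) c.τ, c.J (p, t) * g n (c.pt (p, t))‖
          ≤ (∫ s, |deriv collar s|) * (CJ * Cφ * M p) := by
      filter_upwards [h.ae_continuous, h.ae_eq_right, h.ae_eq_left, h.ae_bound,
        ae_restrict_mem hA] with p hc he₁ he₂ hM hpA
      have hcont : Continuous fun t : ℝ => c.f p + t • c.N p := by fun_prop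
      have := tendsto_integral_rescaled_mul (C := CJ * Cφ) c.τ_pos (mul_nonneg hCJ0 hCφ0)
        integrable_deriv_collar (B := fun t => c.J (p, t) * φ (c.pt (p, t)))
        ((c.continuousOn_J.comp (by fun_prop) fun t ht => ⟨hpA, ht⟩).mul
          (hφ.continuous.comp hcont).continuousOn)
        (fun t ht => by
          rw [abs_mul, abs_of_pos (c.J_pos ⟨hpA, ht⟩)]
          exact mul_le_mul (hJ _ ⟨hpA, ht⟩).2 (hCφ _) (abs_nonneg _) hCJ0)
        hc.1 hc.2 he₁ he₂ hM hδ hδ0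
      simp only [integral_deriv_collar_mul, c.pt_zero, mul_assoc (c.J (p, 0))] at this
      simp only [hform _ p hpA]
      exact this
    refine tendsto_integral_of_dominated_convergence
      (fun p => (∫ s, |deriv collar s|) * (CJ * Cφ * M p))
      (fun n => (c.integrable_J_mul (hgint n)).integral_prod_left.1)
      ((h.integrableOn_bound.const_mul _).const_mul _)
      (fun n => hp.mono fun p hp => hp.2 n) (hp.mono fun p hp => hp.1)
  rw [ha0, hb0]
  exact tendsto_nhds_unique (((hlim ha).2.add hglim).congr hkey) (hlim hb).2.neg

end BoundaryChart

/-! ### Finite covers by charts and partition of a test function -/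

theorem exists_finite_charts {E : Set R3} (hE : IsCompact E) (hEs : HasSmoothBoundary E) :
    ∃ (ι : Type) (_ : Fintype ι) (c : ι → BoundaryChart E), frontier E ⊆ ⋃ i, (c i).W := by
  have h : ∀ a : frontier E, ∃ c : BoundaryChart E, (a : R3) ∈ c.W := fun a =>
    exists_boundaryChart hE hEs a.2
  choose c hc using h
  have hK : IsCompact (frontier E) := hE.of_isClosed_subset isClosed_frontier hE.isClosed.frontier_subset
  obtain ⟨t, ht⟩ := hK.elim_finite_subcover (fun a : frontier E => (c a).W)
    (fun a => (c a).isOpen_W) fun x hx => mem_iUnion.2 ⟨⟨x, hx⟩, hc ⟨x, hx⟩⟩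
  refine ⟨Fin t.card, inferInstance, fun i => c (t.equivFin.symm i), fun x hx => ?_⟩
  obtain ⟨a, hat, ha⟩ := mem_iUnion₂.1 (ht hx)
  exact mem_iUnion.2 ⟨t.equivFin ⟨a, hat⟩, by simpa using ha⟩

theorem surfaceMeasure_restrict_iUnion {E : Set R3} {ι : Type} {c : ι → BoundaryChart E}
    (hc : frontier E ⊆ ⋃ i, (c i).W) :
    (surfaceMeasure E).restrict (⋃ i, (c i).W) = surfaceMeasure E := by
  refine Measure.restrict_eq_self_of_ae_mem ?_
  filter_upwards [ae_restrict_mem isClosed_frontier.measurableSet] with x hx using hc hx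

section Surface

variable {E : Set R3} {ι : Type} [Finite ι] {c : ι → BoundaryChart E}

theorem ae_surfaceMeasure_of_charts (hc : frontier E ⊆ ⋃ i, (c i).W) {P : R3 → Prop}
    (h : ∀ i, ∀ᵐ p ∂(volume.restrict (c i).A), P ((c i).f p)) :
    ∀ᵐ x ∂(surfaceMeasure E), P x := by
  rw [← surfaceMeasure_restrict_iUnion hc, ae_restrict_iUnion_iff]
  exact fun i => (c i).ae_of_ae_f (h i)

theorem integrable_surfaceMeasure_of_charts (hc : frontier E ⊆ ⋃ i, (c i).W) {g : R3 → ℝ}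
    (h : ∀ i, IntegrableOn (fun p => g ((c i).f p)) (c i).A) : Integrable g (surfaceMeasure E) := by
  rw [← surfaceMeasure_restrict_iUnion hc]
  exact integrableOn_finite_iUnion.2 fun i => (c i).integrable_surface (h i)

end Surface

/-- A test function is a sum of test functions supported in the sets of a finite open cover. -/
theorem exists_smooth_decomposition {ι : Type} [Fintype ι] {O : ι → Set R3}
    (hO : ∀ i, IsOpen (O i)) (hcov : ⋃ i, O i = univ) {φ : R3 → ℝ} (hφ : ContDiff ℝ ∞ φ)
    (hc : HasCompactSupport φ) :
    ∃ ψ : ι → R3 → ℝ, (∀ i, ContDiff ℝ ∞ (ψ i)) ∧ (∀ i, HasCompactSupport (ψ i)) ∧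
      (∀ i, tsupport (ψ i) ⊆ O i) ∧ ∀ x, φ x = ∑ i, ψ i x := by
  obtain ⟨f, hf⟩ := SmoothPartitionOfUnity.exists_isSubordinate (modelWithCornersSelf ℝ R3)
    (isClosed_univ (X := R3)) O hO hcov.ge
  refine ⟨fun i x => f i x * φ x, fun i => (f i).contMDiff.contDiff.mul hφ,
    fun i => hc.mul_left, fun i => (tsupport_mul_subset_left).trans (hf i), fun x => ?_⟩
  have := f.sum_eq_one (mem_univ x)
  rw [finsum_eq_sum_of_fintype] at this
  rw [← Finset.sum_mul, this, one_mul]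

/-! ### Gradients of test functions and the values of l on them -/

theorem HasL2Gradient.locallyIntegrable {f : R3 → ℝ} {G : R3 → R3} (h : HasL2Gradient f G)
    (i : Fin 3) : LocallyIntegrable fun x => G x i := by
  simpa using locallyIntegrableOn_univ.1 (h.2 i).2.1

/-- By the fundamental lemma of the calculus of variations. It allows the chosen `grad` of a test
function to be replaced by the classical gradient. -/
theorem HasL2Gradient.ae_eq {f : R3 → ℝ} {G G' : R3 → R3} (h : HasL2Gradient f G)
    (h' : HasL2Gradient f G') : G =ᵐ[volume] G' := by
  have : ∀ i, ∀ᵐ x, G x i = G' x i := by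
    intro i
    refine ae_eq_of_integral_contDiff_smul_eq (h.locallyIntegrable i) (h'.locallyIntegrable i)
      fun g hg hc => ?_
    have h1 := (h.2 i).integral_mul_fderiv hg hc (subset_univ _)
    have h2 := (h'.2 i).integral_mul_fderiv hg hc (subset_univ _)
    simp only [smul_eq_mul, mul_comm (g _)]
    exact neg_injective (h1.symm.trans h2)
  filter_upwards [ae_all_iff.2 this] with x hx
  ext i
  exact hx i

theorem hasL2Gradient_grad {f : R3 → ℝ} (h : ∃ G, HasL2Gradient f G) :
    HasL2Gradient f (grad f) := by
  rw [grad, dif_pos h]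
  exact h.choose_spec

theorem hasL2Gradient_of_contDiff {φ : R3 → ℝ} (hφ : ContDiff ℝ ∞ φ) (hc : HasCompactSupport φ) :
    HasL2Gradient φ fun x =>
      WithLp.toLp 2 fun i => fderiv ℝ φ x (EuclideanSpace.single i 1) := by
  constructor
  · refine Continuous.memLp_of_hasCompactSupport ?_ ?_
    · exact (PiLp.continuous_toLp 2 _).comp (continuous_pi fun i => continuous_fderiv_single hφ i)
    · refine (hc.fderiv ℝ).mono fun x hx h0 => hx ?_
      ext i
      simp [h0]
  · intro i
    have h1 := continuous_fderiv_single hφ i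
    refine ⟨hφ.continuous.locallyIntegrable.locallyIntegrableOn _,
      h1.locallyIntegrable.locallyIntegrableOn _, fun ψ => ?_⟩
    have hψ : ContDiff ℝ ∞ ψ := ψ.contDiff
    have hψc := ψ.hasCompactSupport
    exact integral_mul_fderiv_eq_neg_fderiv_mul_of_integrable
      (integrable_mul_of_hasCompactSupport h1.locallyIntegrable hψ.continuous hψc)
      (integrable_mul_of_hasCompactSupport hφ.continuous.locallyIntegrable
        (continuous_fderiv_single hψ i) (hasCompactSupport_fderiv_single hψc i))
      (integrable_mul_of_hasCompactSupport hφ.continuous.locallyIntegrable hψ.continuous hψc)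
      (fun x _ => hφ.differentiable (by simp) x) (fun x _ => hψ.differentiable (by simp) x)

theorem memDirichlet_of_contDiff {φ : R3 → ℝ} (hφ : ContDiff ℝ ∞ φ) (hc : HasCompactSupport φ) :
    MemDirichlet φ :=
  ⟨hφ.continuous.memLp_of_hasCompactSupport hc, _, hasL2Gradient_of_contDiff hφ hc⟩

theorem dirichletNorm_zero : dirichletNorm (fun _ => 0) = 0 := by
  have h := hasL2Gradient_of_contDiff (φ := fun _ => 0) contDiff_const HasCompactSupport.zero
  have h1 := (hasL2Gradient_grad ⟨_, h⟩).ae_eq h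
  have h2 : ∫ x, ‖grad (fun _ => 0) x‖ ^ 2 = ∫ _ : R3, (0 : ℝ) := by
    refine integral_congr_ae ?_
    filter_upwards [h1] with x hx
    have : (WithLp.toLp 2 fun i : Fin 3 => (0 : ℝ)) = (0 : R3) := rfl
    simp [hx, this]
  rw [dirichletNorm, h2]
  simp

/-- A test function is at Dirichlet distance zero from itself, so it belongs to every set of the
filter along which the limit is taken. -/
theorem HasValue.eq {l : GenFn} {φ : TestFn} {a : ℝ} (h : HasValue l φ a) : l φ = a := by
  have h0 : pure φ ≤ comap (fun ψ : TestFn => dirichletNorm fun x => ψ x - φ x) (𝓝 0) := by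
    rw [← map_le_iff_le_comap, map_pure]
    simp only [sub_self, dirichletNorm_zero]
    exact pure_le_nhds 0
  exact tendsto_nhds_unique (tendsto_pure_nhds _ _) (h.mono_left h0)

theorem dirichletForm_of_contDiff (k : ℝ) (E : Set R3) {φ U : R3 → ℝ} (hφ : ContDiff ℝ ∞ φ)
    (hc : HasCompactSupport φ) :
    dirichletForm k E φ U = 1 / (4 * Real.pi) *
      (∫ x, ∑ i, grad U x i * fderiv ℝ φ x (EuclideanSpace.single i 1))
        - k ^ 2 * ∫ x in E, φ x * U x := by
  have h := hasL2Gradient_of_contDiff hφ hc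
  rw [dirichletForm]
  congr 2
  refine integral_congr_ae ?_
  filter_upwards [(hasL2Gradient_grad ⟨_, h⟩).ae_eq h] with x hx
  simp [hx, PiLp.inner_apply]

/-! ### The global formula -/

section Normals

variable {E : Set R3} {nplus nminus : R3 → R3}

theorem BoundaryChart.ae_normal_eq (c : BoundaryChart E)
    (hnplus : ∀ x ∈ frontier E, IsOuterNormal E x (nplus x))
    (hnminus : ∀ x ∈ frontier E, IsInnerNormal E x (nminus x)) :
    ∀ᵐ p ∂(volume.restrict c.A), nplus (c.f p) = c.N p ∧ nminus (c.f p) = -c.N p := by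
  filter_upwards [ae_restrict_mem c.isOpen_A.measurableSet] with p hp
  exact ⟨c.outerNormal_eq p hp _ (hnplus _ (c.f_mem_frontier hp)),
    c.innerNormal_eq p hp _ (hnminus _ (c.f_mem_frontier hp))⟩

end Normals

/-- The divergence formula with the jump of the normal component on the boundary. -/
theorem integral_gradient_eq_of_charts {E : Set R3} {ι : Type} [Fintype ι]
    {c : ι → BoundaryChart E} (hcov : frontier E ⊆ ⋃ i, (c i).W) {G : R3 → R3}
    {D : Fin 3 → Fin 3 → R3 → ℝ} {M : ι → R2 → ℝ} {H₁ H₂ : ι → R2 → ℝ → ℝ}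
    (hG : ∀ i, LocallyIntegrable fun x => G x i) (hD : ∀ i j, Integrable (D i j))
    (hw : ∀ i j, IsWeakPartial (offBoundary E) j (fun x => G x i) (D i j))
    (h : ∀ i, (c i).HasTraces G (M i) (H₁ i) (H₂ i)) {g : R3 → ℝ}
    (hg : ∀ i, ∀ᵐ p ∂(volume.restrict (c i).A), g ((c i).f p) = H₁ i p 0 - H₂ i p 0)
    (hgi : Integrable g (surfaceMeasure E)) {φ : R3 → ℝ} (hφ : ContDiff ℝ ∞ φ)
    (hc : HasCompactSupport φ) :
    (∫ x, ∑ i, G x i * fderiv ℝ φ x (EuclideanSpace.single i 1))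
      = -(∫ x, φ x * g x ∂(surfaceMeasure E)) - ∫ x, φ x * ∑ i, D i i x := by
  -- The charts cover the boundary; `none` stands for its complement, where the surface term
  -- vanishes and the weak derivatives can be used directly.
  let O : Option ι → Set R3 := fun o => o.elim (offBoundary E : Set R3) fun i => (c i).W
  obtain ⟨ψ, hψ, hψc, hψO, hsum⟩ := exists_smooth_decomposition (O := O)
    (fun o => match o with
      | none => (offBoundary E).isOpen
      | some i => (c i).isOpen_W)
    (eq_univ_of_forall fun x => by
      by_cases hx : x ∈ frontier E
      · obtain ⟨i, hi⟩ := mem_iUnion.1 (hcov hx)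
        exact mem_iUnion.2 ⟨some i, hi⟩
      · exact mem_iUnion.2 ⟨none, hx⟩) hφ hc
  have hi1 : ∀ o, Integrable fun x =>
      ∑ i, G x i * fderiv ℝ (ψ o) x (EuclideanSpace.single i 1) := fun o =>
    integrable_finsetSum _ fun i _ => integrable_mul_of_hasCompactSupport (hG i)
      (continuous_fderiv_single (hψ o) i) (hasCompactSupport_fderiv_single (hψc o) i)
  have hi2 : ∀ o, Integrable (fun x => ψ o x * g x) (surfaceMeasure E) := fun o => by
    obtain ⟨C, hC⟩ := (hψ o).continuous.bounded_above_of_compact_support (hψc o)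
    exact hgi.bdd_mul (hψ o).continuous.aestronglyMeasurable (Eventually.of_forall hC)
  have hi3 : ∀ o, Integrable fun x => (∑ i, D i i x) * ψ o x := fun o =>
    integrable_mul_of_hasCompactSupport
      (integrable_finsetSum _ fun i _ => hD i i).locallyIntegrable (hψ o).continuous (hψc o)
  have hlocal : ∀ o, (∫ x, ∑ i, G x i * fderiv ℝ (ψ o) x (EuclideanSpace.single i 1))
      = -(∫ x, ψ o x * g x ∂(surfaceMeasure E)) - ∫ x, (∑ i, D i i x) * ψ o x := by
    rintro (_ | i)
    · have h0 : ∫ x, ψ none x * g x ∂(surfaceMeasure E) = 0 := by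
        refine integral_eq_zero_of_ae ?_
        filter_upwards [ae_restrict_mem isClosed_frontier.measurableSet] with x hx
        rw [image_eq_zero_of_notMem_tsupport fun h' => hψO none h' hx, zero_mul]
        rfl
      rw [h0, neg_zero, zero_sub]
      exact integral_gradient_eq_of_tsupport_subset hG hD hw (hψ _) (hψc _) (hψO none)
    · have hs : tsupport (ψ (some i)) ⊆ (c i).W := hψO (some i)
      have h0 : ∫ x, ψ (some i) x * g x ∂(surfaceMeasure E)
          = ∫ x in (c i).W, ψ (some i) x * g x ∂(surfaceMeasure E) := by
        refine (setIntegral_eq_integral_of_forall_compl_eq_zero fun x hx => ?_).symm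
        rw [image_eq_zero_of_notMem_tsupport fun h' => hx (hs h'), zero_mul]
      have hm : AEStronglyMeasurable (fun p => ψ (some i) ((c i).f p) * g ((c i).f p))
          (volume.restrict (c i).A) := by
        have h1 := (h i).integrableOn hG
        refine (((hψ (some i)).continuous.measurable.comp (c i).measurable_f).aestronglyMeasurable.mul
          (h1.1.1.sub h1.2.1)).congr ?_
        filter_upwards [hg i] with p hp
        simp [hp]
      rw [h0, (c i).setIntegral_surface (g := fun x => ψ (some i) x * g x) hm]
      have h1 := (h i).integral_gradient_eq hG hD hw (hψ (some i)) (hψc (some i)) hs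
      have h2 : ∫ p in (c i).A, (c i).J (p, 0) * (ψ (some i) ((c i).f p) * g ((c i).f p))
          = ∫ p in (c i).A,
            (c i).J (p, 0) * (ψ (some i) ((c i).f p) * (H₁ i p 0 - H₂ i p 0)) := by
        refine integral_congr_ae ?_
        filter_upwards [hg i] with p hp
        rw [hp]
      rw [h2]
      linarith
  have e1 : ∀ x, ∑ i, G x i * fderiv ℝ φ x (EuclideanSpace.single i 1)
      = ∑ o, ∑ i, G x i * fderiv ℝ (ψ o) x (EuclideanSpace.single i 1) := by
    intro x
    have : φ = fun x => ∑ o, ψ o x := funext hsum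
    rw [this, fderiv_fun_sum fun o _ => (hψ o).differentiable (by simp) x, Finset.sum_comm]
    simp [Finset.mul_sum, mul_add]
  have e2 : ∫ x, φ x * g x ∂(surfaceMeasure E)
      = ∑ o, ∫ x, ψ o x * g x ∂(surfaceMeasure E) := by
    simp only [hsum, Finset.sum_mul]
    exact integral_finsetSum _ fun o _ => hi2 o
  have e3 : ∫ x, φ x * ∑ i, D i i x = ∑ o, ∫ x, (∑ i, D i i x) * ψ o x := by
    simp only [mul_comm (φ _)]
    simp only [hsum, Finset.mul_sum (Finset.univ : Finset (Option ι))]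
    exact integral_finsetSum _ fun o _ => hi3 o
  simp only [e1]
  rw [integral_finsetSum _ fun o _ => hi1 o, e2, e3, Finset.sum_congr rfl fun o _ => hlocal o,
    Finset.sum_sub_distrib, Finset.sum_neg_distrib]

end ChargeDistribution

/-! ### The main theorem -/

theorem theorem3
    (k : ℝ) (E : Set ChargeDistribution.R3) (hE : IsCompact E)
    (hE_smooth : ChargeDistribution.HasSmoothBoundary E)
    (l : ChargeDistribution.GenFn) (hl : ChargeDistribution.MemDirichletDual l)
    (hl_supp : Distribution.dsupport l ⊆ E)
    (U : ChargeDistribution.R3 → ℝ) (hU : ChargeDistribution.IsPotential k E l U)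
    -- the second order derivatives of `U` off the boundary of `E`, which are integrable
    (D2U : Fin 3 → Fin 3 → ChargeDistribution.R3 → ℝ)
    (hD2U : ∀ i j : Fin 3, ChargeDistribution.IsWeakPartial (ChargeDistribution.offBoundary E) j
      (fun x => ChargeDistribution.grad U x i) (D2U i j))
    (hD2U_int : ∀ i j : Fin 3, Integrable (D2U i j) volume)
    -- the outer and the inner unit normal field on the boundary of `E`
    (nplus nminus : ChargeDistribution.R3 → ChargeDistribution.R3)
    (hnplus : ∀ x ∈ frontier E, ChargeDistribution.IsOuterNormal E x (nplus x))
    (hnminus : ∀ x ∈ frontier E, ChargeDistribution.IsInnerNormal E x (nminus x)) :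
    -- some representative of `U` has one-sided normal derivatives almost everywhere on the boundary
    (∃ u : ChargeDistribution.R3 → ℝ, u =ᵐ[volume] U ∧ ∃ dplus dminus : ChargeDistribution.R3 → ℝ,
      (∀ᵐ x ∂(ChargeDistribution.surfaceMeasure E),
        ChargeDistribution.HasOneSidedDeriv u x (nplus x) (dplus x) ∧
        ChargeDistribution.HasOneSidedDeriv u x (nminus x) (dminus x))) ∧
    -- for every such representative, the normal derivatives are integrable and the formula holds
    ∀ u : ChargeDistribution.R3 → ℝ, u =ᵐ[volume] U → ∀ dplus dminus : ChargeDistribution.R3 → ℝ,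
      (∀ᵐ x ∂(ChargeDistribution.surfaceMeasure E),
        ChargeDistribution.HasOneSidedDeriv u x (nplus x) (dplus x) ∧
        ChargeDistribution.HasOneSidedDeriv u x (nminus x) (dminus x)) →
      Integrable dplus (ChargeDistribution.surfaceMeasure E) ∧
      Integrable dminus (ChargeDistribution.surfaceMeasure E) ∧
      ∀ φ : ChargeDistribution.TestFn,
        l φ = -k ^ 2 * (∫ x in E, φ x * U x)
          - 1 / (4 * Real.pi) *
            (∫ x, φ x * (dplus x + dminus x) ∂(ChargeDistribution.surfaceMeasure E))
          - 1 / (4 * Real.pi) * ∫ x, φ x * ∑ i : Fin 3, D2U i i x := by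
  obtain ⟨ι, _, c, hcov⟩ := ChargeDistribution.exists_finite_charts hE hE_smooth
  have hgrad := ChargeDistribution.hasL2Gradient_grad hU.1.2
  have hG := hgrad.locallyIntegrable
  obtain ⟨u, huU, hu⟩ := ChargeDistribution.exists_line_representative E hgrad.2
  have htr := fun i => (c i).exists_hasTraces hG hD2U_int hD2U
  choose M H₁ H₂ htr using htr
  have hnormal := fun i => (c i).ae_normal_eq hnplus hnminus
  refine ⟨⟨u, huU, ?_⟩, fun v hv dplus dminus hd => ?_⟩
  -- The derivatives are first found chart by chart, then chosen globally as functions on the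
  -- boundary; no compatibility of charts is needed, as existence is a pointwise property.
  · have hex : ∀ᵐ x ∂(ChargeDistribution.surfaceMeasure E), ∃ d : ℝ × ℝ,
        ChargeDistribution.HasOneSidedDeriv u x (nplus x) d.1 ∧
        ChargeDistribution.HasOneSidedDeriv u x (nminus x) d.2 := by
      refine ChargeDistribution.ae_surfaceMeasure_of_charts hcov fun i => ?_
      filter_upwards [hnormal i, (htr i).ae_hasOneSidedDeriv (hu (c i))] with p hp hp'
      rw [hp.1, hp.2]
      exact ⟨(_, _), hp'⟩
    obtain ⟨d, hd⟩ := ChargeDistribution.exists_forall_eventually hex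
    exact ⟨fun x => (d x).1, fun x => (d x).2, hd⟩
  -- For an arbitrary representative the derivatives must be the traces H₁ and -H₂, which gives
  -- their integrability and makes their sum the jump H₁ - H₂.
  · have heq : ∀ i, ∀ᵐ p ∂(volume.restrict (c i).A),
        H₁ i p 0 = dplus ((c i).f p) ∧ -H₂ i p 0 = dminus ((c i).f p) := by
      intro i
      refine (htr i).ae_eq_of_hasOneSidedDeriv (hu (c i)) (huU.trans hv.symm) ?_
      filter_upwards [hnormal i, (c i).ae_f_of_ae hd] with p hp hp'
      rwa [hp.1, hp.2] at hp'
    have hplus : Integrable dplus (ChargeDistribution.surfaceMeasure E) :=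
      ChargeDistribution.integrable_surfaceMeasure_of_charts hcov fun i =>
        ((htr i).integrableOn hG).1.congr ((heq i).mono fun p hp => hp.1)
    have hminus : Integrable dminus (ChargeDistribution.surfaceMeasure E) :=
      ChargeDistribution.integrable_surfaceMeasure_of_charts hcov fun i =>
        ((htr i).integrableOn hG).2.neg.congr ((heq i).mono fun p hp => hp.2)
    refine ⟨hplus, hminus, fun φ => ?_⟩
    have hφ := φ.contDiff
    have hφc := φ.hasCompactSupport
    have hgreen := ChargeDistribution.integral_gradient_eq_of_charts hcov hG hD2U_int hD2U htr
      (g := fun x => dplus x + dminus x)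
      (fun i => (heq i).mono fun p hp => by
        rw [← hp.1, ← hp.2]
        ring)
      (hplus.add hminus) hφ hφc
    rw [(hU.2 φ (ChargeDistribution.memDirichlet_of_contDiff hφ hφc)).eq,
      ChargeDistribution.dirichletForm_of_contDiff k E hφ hφc, hgreen]
    ring
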